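/- **Setting.** Let $\Gamma,\Lambda_w,\Lambda_b$ be positive definite even lattices of the same rank and let $\pi_w\colon\Gamma\to\Lambda_w$, $\pi_b\colon\Gamma\to\Lambda_b$ be injective isometric homomorphisms. Write $\mathfrak h=\Gamma\otimes\mathbb R$ and $H=\Gamma\otimes\mathbb R/\mathbb Z$, $T_w=\Lambda_w\otimes\mathbb R/\mathbb Z$, $T_b=\Lambda_b\otimes\mathbb R/\mathbb Z$ for the tori, and $\exp\colon\mathfrak h\to H$ for the projection. Through the isometries $\mathbb R\pi_w,\mathbb R\pi_b$ we regard $\Lambda_w,\Lambda_b$ as lattices in $\mathfrak h$, and we write $\Lambda_w\cap\Lambda_b$ and $\Lambda_w-\Lambda_b$ for their intersection and the group of differences in $\mathfrak h$; so $(\Lambda_w\cap\Lambda_b)/\Gamma\subseteq H$. Let $\mathbb T$ be the circle group of complex numbers of modulus one. **The group.** Parametrise $S^1$ by $[0,1]$, with $q$ at $0$ and $1$ and $p$ at $1/2$. Let $L=L(T_w,H,T_b)$ be the abelian group of triples $\gamma=(\gamma_w,\gamma_m,\gamma_b)$ of smooth maps $\gamma_w\colon[1/2,1]\to T_w$, $\gamma_b\colon[0,1/2]\to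 T_b$ and a map $\gamma_m\colon\{p,q\}\to H$, such that $\gamma_m$ is sent by $\pi_w$ and $\pi_b$ to the values of $\gamma_w$ and $\gamma_b$ at $p$ and $q$, and such that all derivatives of order $k\ge1$ of $\gamma_w$ and $\gamma_b$, seen as elements of $\mathfrak h$, agree at $p$ and at $q$. Let $\mathrm{Pth}(\gamma)\colon[0,1]\to H$ be the smooth path that lifts $\gamma_b$ on $[0,1/2]$ and $\gamma_w$ on $[1/2,1]$ and has the value $\gamma_m(p)$ at $1/2$. Choose a smooth $\xi_\gamma\colon[0,1]\to\mathfrak h$ with $\exp\circ\,\xi_\gamma=\mathrm{Pth}(\gamma)$, and put $\Delta'_\gamma=\xi_\gamma(1)-\xi_\gamma(0)\in\Lambda_w-\Lambda_b$. Let $\epsilon$ be a normalised $\mathbb T$-valued $2$-cocycle on $\Lambda_w-\Lambda_b$ such that $$\epsilon(\lambda,\mu)\,\epsilon(\mu,\lambda)^{-1}=e^{\pi i\langle\mu,\lambda\rangle}\,e^{2\pi i\langle\mu,\lambda_b\rangle}\qquad\text{whenever }\lambda=\lambda_w-\lambda_b,\ \lambda_w\in\Lambda_w,\ \lambda_b\in\Lambda_b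 .$$ The central extension $\widetilde L=\widetilde L(T_w,H,T_b)$ is the set $L\times\mathbb T$ with the product $(\gamma,z)(\rho,w)=(\gamma+\rho,\,zw\,c(\gamma,\rho))$, where $$c(\gamma,\rho)=\epsilon(\Delta'_\gamma,\Delta'_\rho)\,e^{2\pi iS'(\xi_\gamma,\xi_\rho)},\qquad S'(\xi,\eta)=\tfrac12\int_0^1\langle\xi'(\theta),\eta(\theta)\rangle\,d\theta+\tfrac12\langle\xi(1)-\xi(0),\eta(0)\rangle .$$ Let $N=\widetilde{\ker}(\Delta'\circ\mathrm{Pth})$ be the normal subgroup of all $(\gamma,z)\in\widetilde L$ with $\Delta'_\gamma=0$. **The representation $W_{\chi,l}$.** Let $V\mathfrak h$ be the space of smooth loops $\mathbb R/\mathbb Z\to\mathfrak h$ with average zero, with the skew form $S(\xi,\eta)=\frac12\int_0^1\langle\xi',\eta\rangle$ and the operator $J$ that multiplies the Fourier mode $e^{2\pi ik\theta}$ by $i$ for $k>0$ and by $-i$ for $k<0$. It is a complex pre-Hilbert space, in which the imaginary unit acts as $-J$, with inner product $\langle\xi,\eta\rangle=2\pi\bigl(S(\xi,J\eta)-iS(\xi,\eta)\bigr)$,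 conjugate linear in $\xi$. Let $\mathcal S$ be the bosonic Fock space over $V\mathfrak h$ (the Hilbert space sum of the completed symmetric powers) and let $W(\xi)$, $\xi\in V\mathfrak h$, be the unitary Weyl operators on it: $W(\xi)e^{\kappa}=e^{-\frac12\|\xi\|^2-\langle\xi,\kappa\rangle}e^{\kappa+\xi}$ on the coherent vectors $e^\kappa$. They satisfy $W(\xi)W(\eta)=e^{2\pi iS(\xi,\eta)}W(\xi+\eta)$. For a character $\chi\colon(\Lambda_w\cap\Lambda_b)/\Gamma\to\mathbb T$ and a continuous character $l\colon H\to\mathbb T$ the unitary representation $W_{\chi,l}$ of $N$ on $\mathcal S$ is $$W_{\chi,l}(\gamma,z)=z\;\chi\bigl(\gamma_m(q)-\mathrm{Pth}(\gamma)(1)\bigr)\;l\bigl(\exp\textstyle\int_0^1\xi_\gamma\bigr)\;W\bigl(\xi_\gamma-\textstyle\int_0^1\xi_\gamma\bigr).$$ **Induction.** For a unitary representation $Q$ of a subgroup $N$ of $G$ on a Hilbert space $K$, the induced representation of $G$ acts on the Hilbert space sum over the left cosets $\sigma\in G/N$ of the spaces $\sigma\times_NK$ (classes $[x,v]$ of pairs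 $(x,v)\in\sigma\times K$ with $[xn,v]=[x,Q(n)v]$) by $g[x,v]=[gx,v]$. A unitary representation is irreducible if its space is nonzero and has no invariant closed subspaces other than $0$ and itself. **Proposition.** For all $\epsilon$, $\chi$ and $l$ as above, $W_{\chi,l}$ is an irreducible representation of $N$, and the induced representation $$\mathrm{Ind}_{N}^{\widetilde L(T_w,H,T_b)}\,W_{\chi,l}$$ of $\widetilde L(T_w,H,T_b)$ is irreducible. Moreover, for $\alpha\in\mathfrak h$ let $\rho_\alpha\in N$ be the constant loop with value $\exp\alpha$ (with circle component $1$). Then $W_{\chi,l}(\rho_\alpha)$ is multiplication by $l(\exp\alpha)$, and for every $g=(\gamma,z)\in\widetilde L(T_w,H,T_b)\setminus N$ the conjugate representation $W_{\chi,l}^{g}(k)=W_{\chi,l}(g^{-1}kg)$ of $N$ satisfies $$W_{\chi,l}^{g}(\rho_\alpha)=l(\exp\alpha)\,e^{-2\pi i\langle\Delta'_\gamma,\alpha\rangle}\qquad\text{for all }\alpha\in\mathfrak h ,$$ so the constant loops act in $W^g_{\chi,l}$ by the character $l-\Delta'_\gamma$; this character is different from $l$. -/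

import Mathlib

namespace Fock
noncomputable section
open scoped InnerProductSpace ComplexOrder
open UniformSpace

variable {V : Type*} [SeminormedAddCommGroup V] [InnerProductSpace ℂ V]

/-- The inner product of two monomials of degree `k`: the sum over all permutations of the
products of the inner products of the factors. -/
def permInner (k : ℕ) (ξ η : Fin k → V) : ℂ :=
  ∑ σ : Equiv.Perm (Fin k), ∏ i, inner ℂ (ξ i) (η (σ i))

/-- Finite formal complex combinations of monomials of degree `k`. -/
def PreSym (V : Type*) (k : ℕ) : Type _ := (Fin k → V) →₀ ℂ

instance (k : ℕ) : AddCommGroup (PreSym V k) := inferInstanceAs (AddCommGroup ((Fin k → V) →₀ ℂ))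
instance (k : ℕ) : Module ℂ (PreSym V k) := inferInstanceAs (Module ℂ ((Fin k → V) →₀ ℂ))

/-- A formal combination of monomials, given by its coefficients. -/
def PreSym.of {k : ℕ} (a : (Fin k → V) →₀ ℂ) : PreSym V k := a

/-- Sesquilinear extension of `permInner`. -/
def preInner (k : ℕ) (x y : (Fin k → V) →₀ ℂ) : ℂ :=
  x.sum fun ξ a => y.sum fun η b => (starRingEnd ℂ) a * b * permInner k ξ η

theorem permInner_conj (k : ℕ) (ξ η : Fin k → V) :
    (starRingEnd ℂ) (permInner k η ξ) = permInner k ξ η := by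
  unfold permInner
  rw [map_sum, ← Equiv.sum_comp (Equiv.inv (Equiv.Perm (Fin k)))]
  refine Finset.sum_congr rfl fun σ _ => ?_
  rw [map_prod, ← Equiv.prod_comp σ]
  refine Finset.prod_congr rfl fun i _ => ?_
  simp

theorem prod_gram_posSemidef {ι κ : Type*} [Fintype ι] [Fintype κ] (u : ι → κ → V) :
    (Matrix.of fun a b => ∏ i, inner ℂ (u a i) (u b i) : Matrix ι ι ℂ).PosSemidef := by
  classical
  have : ∀ s : Finset κ,
      (Matrix.of fun a b => ∏ i ∈ s, inner ℂ (u a i) (u b i) : Matrix ι ι ℂ).PosSemidef := by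
    intro s
    induction s using Finset.induction_on with
    | empty =>
      have e : (Matrix.of fun a b => ∏ i ∈ (∅ : Finset κ), inner ℂ (u a i) (u b i) : Matrix ι ι ℂ)
          = Matrix.gram ℂ (fun _ : ι => (1 : ℂ)) := by
        ext a b
        simp [Matrix.gram]
      rw [e]
      exact Matrix.posSemidef_gram ℂ (fun _ : ι => (1 : ℂ))
    | insert i s hi ih =>
      have e : (Matrix.of fun a b => ∏ j ∈ insert i s, inner ℂ (u a j) (u b j) : Matrix ι ι ℂ)
          = Matrix.hadamard (Matrix.gram ℂ (fun a : ι => u a i))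
            (Matrix.of fun a b => ∏ j ∈ s, inner ℂ (u a j) (u b j)) := by
        ext a b
        simp [Matrix.gram, hi]
      rw [e]
      exact Matrix.PosSemidef.hadamard (Matrix.posSemidef_gram ℂ (fun a : ι => u a i)) ih
  exact this Finset.univ

theorem permInner_double (k : ℕ) (ξ η : Fin k → V) :
    ∑ τ : Equiv.Perm (Fin k), ∑ σ : Equiv.Perm (Fin k),
      ∏ i, inner ℂ (ξ (τ i)) (η (σ i)) = (Nat.factorial k : ℂ) * permInner k ξ η := by
  have : ∀ τ : Equiv.Perm (Fin k), ∑ σ : Equiv.Perm (Fin k),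
      ∏ i, inner ℂ (ξ (τ i)) (η (σ i)) = permInner k ξ η := by
    intro τ
    unfold permInner
    rw [← Equiv.sum_comp (Equiv.mulRight τ)]
    refine Finset.sum_congr rfl fun σ _ => ?_
    rw [← Equiv.prod_comp τ (fun i => inner ℂ (ξ i) (η (σ i)))]
    rfl
  simp [this, Fintype.card_perm]

theorem preInner_self_nonneg (k : ℕ) (x : (Fin k → V) →₀ ℂ) : 0 ≤ (preInner k x x).re := by
  classical
  have h := (prod_gram_posSemidef (fun (a : x.support × Equiv.Perm (Fin k)) (i : Fin k) => (a.1 : Fin k → V) (a.2 i)))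
  have h2 := h.dotProduct_mulVec_nonneg (fun a => x (a.1 : Fin k → V))
  have h3 : (Nat.factorial k : ℂ) * preInner k x x = dotProduct (star fun a : x.support × Equiv.Perm (Fin k) => x (a.1 : Fin k → V))
      ((Matrix.of fun a b : x.support × Equiv.Perm (Fin k) => ∏ i, inner ℂ ((a.1 : Fin k → V) (a.2 i)) ((b.1 : Fin k → V) (b.2 i))).mulVec
        (fun a => x (a.1 : Fin k → V))) := by
    simp only [dotProduct, Matrix.mulVec, Matrix.of_apply, Fintype.sum_prod_type, Pi.star_apply]
    have e : preInner k x x = ∑ ξ : x.support, ∑ η : x.support,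
        (starRingEnd ℂ) (x ξ) * x η * permInner k (ξ : Fin k → V) (η : Fin k → V) := by
      unfold preInner Finsupp.sum
      rw [← Finset.sum_coe_sort x.support]
      refine Finset.sum_congr rfl fun ξ _ => ?_
      exact (Finset.sum_coe_sort x.support
        (fun η => (starRingEnd ℂ) (x ξ) * x η * permInner k ξ η)).symm
    rw [e, Finset.mul_sum]
    refine Finset.sum_congr rfl fun ξ _ => ?_
    rw [← Finset.mul_sum, Finset.sum_comm, Finset.mul_sum, Finset.mul_sum]
    refine Finset.sum_congr rfl fun η _ => ?_
    have e2 := permInner_double k (ξ : Fin k → V) (η : Fin k → V)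
    simp only [← Finset.sum_mul]
    rw [e2]
    simp only [starRingEnd_apply]
    ring
  rw [← h3] at h2
  have h4 := (Complex.le_def.1 h2).1
  simp only [Complex.zero_re, Complex.mul_re, Complex.natCast_re, Complex.natCast_im, zero_mul, sub_zero] at h4
  exact nonneg_of_mul_nonneg_right h4 (by positivity)


theorem preInner_add_left (k : ℕ) (x y z : (Fin k → V) →₀ ℂ) :
    preInner k (x + y) z = preInner k x z + preInner k y z := by
  classical
  unfold preInner
  rw [Finsupp.sum_add_index']
  · intro ξ; simp
  · intro ξ a b
    simp only [Finsupp.sum, map_add, add_mul, Finset.sum_add_distrib]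

theorem preInner_smul_left (k : ℕ) (x z : (Fin k → V) →₀ ℂ) (c : ℂ) :
    preInner k (c • x) z = (starRingEnd ℂ) c * preInner k x z := by
  classical
  unfold preInner
  rw [Finsupp.sum_smul_index (by intro ξ; simp)]
  simp only [Finsupp.sum, Finset.mul_sum, map_mul]
  refine Finset.sum_congr rfl fun ξ _ => Finset.sum_congr rfl fun η _ => by ring

theorem preInner_conj (k : ℕ) (x y : (Fin k → V) →₀ ℂ) :
    (starRingEnd ℂ) (preInner k y x) = preInner k x y := by
  unfold preInner
  simp only [Finsupp.sum, map_sum, map_mul, permInner_conj, Complex.conj_conj]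
  rw [Finset.sum_comm]
  refine Finset.sum_congr rfl fun ξ _ => Finset.sum_congr rfl fun η _ => by ring

/-- The positive semidefinite inner product on formal combinations of monomials. -/
@[reducible] def preSymCore (V : Type*) [SeminormedAddCommGroup V] [InnerProductSpace ℂ V] (k : ℕ) :
    PreInnerProductSpace.Core ℂ (PreSym V k) where
  inner x y := preInner k x y
  conj_inner_symm x y := preInner_conj k x y
  re_inner_nonneg x := preInner_self_nonneg k x
  add_left x y z := preInner_add_left k x y z
  smul_left x y c := preInner_smul_left k x y c

instance (k : ℕ) : SeminormedAddCommGroup (PreSym V k) :=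
  @InnerProductSpace.Core.toSeminormedAddCommGroup ℂ (PreSym V k) _ _ _ (preSymCore V k)

instance (k : ℕ) : InnerProductSpace ℂ (PreSym V k) :=
  InnerProductSpace.ofCore (preSymCore V k)

/-- The `k`-th symmetric power as a Hilbert space: the Hausdorff completion of the formal
combinations of monomials of degree `k`. Passing to the quotient by the vectors of length zero
imposes exactly the relations of multilinearity and symmetry. -/
abbrev Sym (V : Type*) [SeminormedAddCommGroup V] [InnerProductSpace ℂ V] (k : ℕ) : Type _ :=
  Completion (PreSym V k)

/-- The symmetric product `ξ₁ ⋯ ξₖ`. -/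
def monomial (k : ℕ) (ξ : Fin k → V) : Sym V k :=
  ((PreSym.of (Finsupp.single ξ (1 : ℂ)) : PreSym V k) : Completion (PreSym V k))

theorem inner_monomial (k : ℕ) (ξ η : Fin k → V) :
    inner ℂ (monomial k ξ) (monomial k η) = permInner k ξ η := by
  unfold monomial
  rw [Completion.inner_coe]
  change preInner k (Finsupp.single ξ 1) (Finsupp.single η 1) = _
  simp [preInner]

/-- The bosonic Fock space: the Hilbert sum of all symmetric powers. -/
abbrev FockSpace (V : Type*) [SeminormedAddCommGroup V] [InnerProductSpace ℂ V] : Type _ :=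
  lp (fun k : ℕ => Sym V k) 2


theorem permInner_const (k : ℕ) (ξ η : V) :
    permInner k (fun _ => ξ) (fun _ => η) = (Nat.factorial k : ℂ) * (inner ℂ ξ η) ^ k := by
  simp [permInner, Fintype.card_perm]

theorem coherent_memℓp (ξ : V) :
    Memℓp (fun k : ℕ => (((Nat.factorial k : ℂ))⁻¹ • monomial k (fun _ => ξ) : Sym V k)) 2 := by
  rw [memℓp_gen_iff (by norm_num)]
  refine (Real.summable_pow_div_factorial (‖ξ‖ ^ 2)).congr fun k => ?_
  have h1 : ‖monomial k (fun _ => ξ)‖ ^ 2 = (Nat.factorial k : ℝ) * (‖ξ‖ ^ 2) ^ k := by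
    have := inner_self_eq_norm_sq_to_K (𝕜 := ℂ) (monomial k (fun _ => ξ))
    rw [inner_monomial, permInner_const, inner_self_eq_norm_sq_to_K] at this
    simp only [Complex.coe_algebraMap] at this
    exact_mod_cast this.symm
  have h0 : (Nat.factorial k : ℝ) ≠ 0 := by positivity
  simp only [ENNReal.toReal_ofNat, Real.rpow_ofNat, norm_smul, norm_inv, mul_pow, h1,
    Complex.norm_natCast]
  field_simp

/-- The coherent vector `e^ξ = ∑ ξᵏ / k!`. -/
def coherent (ξ : V) : FockSpace V :=
  ⟨fun k => ((Nat.factorial k : ℂ))⁻¹ • monomial k (fun _ => ξ), coherent_memℓp ξ⟩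

theorem inner_coherent (ξ η : V) :
    inner ℂ (coherent ξ) (coherent η) = Complex.exp (inner ℂ ξ η) := by
  rw [lp.inner_eq_tsum, Complex.exp_eq_exp_ℂ, NormedSpace.exp_eq_tsum_div]
  refine tsum_congr fun k => ?_
  change inner ℂ (((Nat.factorial k : ℂ))⁻¹ • monomial k (fun _ => ξ))
    (((Nat.factorial k : ℂ))⁻¹ • monomial k (fun _ => η)) = _
  have h0 : (Nat.factorial k : ℂ) ≠ 0 := by exact_mod_cast Nat.factorial_ne_zero k
  rw [inner_smul_left, inner_smul_right, inner_monomial, permInner_const]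
  simp only [map_inv₀, Complex.conj_natCast]
  field_simp

/-- A vector of the symmetric power is determined by its inner products with monomials. -/
theorem sym_ext (k : ℕ) {x y : Sym V k}
    (h : ∀ ξ, inner ℂ (monomial k ξ) x = inner ℂ (monomial k ξ) y) : x = y := by
  refine ext_inner_left ℂ fun v => ?_
  induction v using Completion.induction_on with
  | hp => exact isClosed_eq (by fun_prop) (by fun_prop)
  | ih a =>
    have : ∀ a : (Fin k → V) →₀ ℂ, inner ℂ (PreSym.of a : Sym V k) x =
        inner ℂ (PreSym.of a : Sym V k) y := by
      intro a
      induction a using Finsupp.induction_linear with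
      | zero =>
        change inner ℂ (((0 : PreSym V k)) : Sym V k) x = inner ℂ (((0 : PreSym V k)) : Sym V k) y
        rw [Completion.coe_zero, inner_zero_left, inner_zero_left]
      | add f g hf hg =>
        change inner ℂ (((PreSym.of f + PreSym.of g) : PreSym V k) : Sym V k) x
          = inner ℂ (((PreSym.of f + PreSym.of g) : PreSym V k) : Sym V k) y
        rw [Completion.coe_add, inner_add_left, inner_add_left]
        exact congrArg₂ (· + ·) hf hg
      | single ξ c =>
        have e : (PreSym.of (Finsupp.single ξ c) : Sym V k) = c • monomial k ξ := by
          have e2 : PreSym.of (Finsupp.single ξ c) =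
              c • PreSym.of (Finsupp.single ξ (1 : ℂ)) := by
            change Finsupp.single ξ c = c • Finsupp.single ξ (1 : ℂ)
            simp
          unfold monomial
          rw [e2, Completion.coe_smul]
        rw [e, inner_smul_left, inner_smul_left, h]
    exact this a

/-- `permInner` as a multilinear function of its second argument. -/
theorem permInner_eq_multilinear (k : ℕ) (η ξ : Fin k → V) :
    permInner k η ξ = (∑ σ : Equiv.Perm (Fin k),
      (MultilinearMap.mkPiAlgebra ℂ (Fin k) ℂ).compLinearMap
        (fun j => (innerₛₗ ℂ (η (σ⁻¹ j)) : V →ₗ[ℂ] ℂ))) ξ := by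
  rw [sum_apply]
  refine Finset.sum_congr rfl fun σ _ => ?_
  rw [MultilinearMap.compLinearMap_apply, MultilinearMap.mkPiAlgebra_apply,
    ← Equiv.prod_comp σ (fun i => (innerₛₗ ℂ (η (σ⁻¹ i)) : V →ₗ[ℂ] ℂ) (ξ i))]
  simp

/-- The symmetric product as a multilinear map. -/
def monomialMul (k : ℕ) : MultilinearMap ℂ (fun _ : Fin k => V) (Sym V k) where
  toFun := monomial k
  map_update_add' {inst} m i x y := by
    refine sym_ext k fun η => ?_
    rw [inner_add_right]
    simp only [inner_monomial, permInner_eq_multilinear]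
    rw [MultilinearMap.map_update_add]
  map_update_smul' {inst} m i c x := by
    refine sym_ext k fun η => ?_
    rw [inner_smul_right]
    simp only [inner_monomial, permInner_eq_multilinear]
    rw [MultilinearMap.map_update_smul, smul_eq_mul]

theorem monomial_perm (k : ℕ) (ξ : Fin k → V) (σ : Equiv.Perm (Fin k)) :
    monomial k (fun i => ξ (σ i)) = monomial k ξ := by
  refine sym_ext k fun η => ?_
  rw [inner_monomial, inner_monomial]
  unfold permInner
  exact Equiv.sum_comp (Equiv.mulLeft σ) (fun τ => ∏ i, inner ℂ (η i) (ξ (τ i)))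

/-- Polarisation. -/
theorem polarize {k : ℕ} (B : MultilinearMap ℂ (fun _ : Fin k => V) ℂ)
    (hs : ∀ (ξ : Fin k → V) (σ : Equiv.Perm (Fin k)), B (fun i => ξ (σ i)) = B ξ)
    (h0 : ∀ v, B (fun _ => v) = 0) (ξ : Fin k → V) : B ξ = 0 := by
  classical
  have key : ∀ r : Fin k → Fin k,
      ∑ S ∈ (Finset.univ : Finset (Fin k)).powerset, (∏ i ∈ S, (-1 : ℂ)) *
        ∏ j, (if r j ∈ S then (1 : ℂ) else 0) =
      if Function.Bijective r then (-1) ^ k else 0 := by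
    intro r
    have e : ∀ S ∈ (Finset.univ : Finset (Fin k)).powerset,
        (∏ i ∈ S, (-1 : ℂ)) * ∏ j, (if r j ∈ S then (1 : ℂ) else 0) =
        (∏ i ∈ S, (-1 : ℂ)) * ∏ i ∈ Finset.univ \ S, (if i ∈ Set.range r then (0 : ℂ) else 1) := by
      intro S _
      congr 1
      by_cases hS : ∀ j, r j ∈ S
      · rw [Finset.prod_eq_one (fun j _ => by simp [hS j]), Finset.prod_eq_one]
        intro i hi
        rw [if_neg]
        rintro ⟨j, rfl⟩
        exact (Finset.mem_sdiff.1 hi).2 (hS j)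
      · push Not at hS
        obtain ⟨j, hj⟩ := hS
        rw [Finset.prod_eq_zero (Finset.mem_univ j) (by simp [hj]),
          Finset.prod_eq_zero (i := r j) (by simp [hj]) (by simp)]
    rw [Finset.sum_congr rfl e, ← Finset.prod_add]
    by_cases hr : Function.Bijective r
    · rw [if_pos hr, Finset.prod_congr rfl (g := fun _ => (-1 : ℂ))]
      · simp
      · intro i _
        rw [if_pos (show i ∈ Set.range r from hr.2 i), add_zero]
    · rw [if_neg hr]
      have : ¬ Function.Surjective r := fun h => hr ⟨Finite.injective_iff_surjective.2 h, h⟩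
      simp only [Function.Surjective, not_forall] at this
      obtain ⟨i, hi⟩ := this
      refine Finset.prod_eq_zero (Finset.mem_univ i) ?_
      rw [if_neg (show i ∉ Set.range r from hi)]; norm_num
  have h1 : ∀ S : Finset (Fin k), ∑ r : Fin k → Fin k,
      (∏ j, (if r j ∈ S then (1 : ℂ) else 0)) * B (fun j => ξ (r j)) = 0 := by
    intro S
    have := h0 (∑ i, (if i ∈ S then (1 : ℂ) else 0) • ξ i)
    rw [MultilinearMap.map_sum (f := B)
      (g := fun _ i => (if i ∈ S then (1 : ℂ) else 0) • ξ i)] at this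
    refine Eq.trans (Finset.sum_congr rfl fun r _ => ?_) this
    rw [MultilinearMap.map_smul_univ, smul_eq_mul]
  have h2 : ∑ r : Fin k → Fin k, (if Function.Bijective r then (-1 : ℂ) ^ k else 0) *
      B (fun j => ξ (r j)) = 0 := by
    simp_rw [← key, Finset.sum_mul]
    rw [Finset.sum_comm]
    refine Finset.sum_eq_zero fun S _ => ?_
    simp_rw [mul_assoc]
    rw [← Finset.mul_sum, h1, mul_zero]
  have h3 : ∑ r : Fin k → Fin k, (if Function.Bijective r then (-1 : ℂ) ^ k else 0) *
      B (fun j => ξ (r j)) =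
      ((Finset.univ.filter (fun r : Fin k → Fin k => Function.Bijective r)).card : ℂ) *
        ((-1) ^ k * B ξ) := by
    rw [← nsmul_eq_mul, ← Finset.sum_const, Finset.sum_filter]
    refine Finset.sum_congr rfl fun r _ => ?_
    split_ifs with hr
    · rw [show B (fun j => ξ (r j)) = B ξ from hs ξ (Equiv.ofBijective r hr)]
    · simp
  rw [h3] at h2
  have h4 : (Finset.univ.filter (fun r : Fin k → Fin k => Function.Bijective r)).card ≠ 0 :=
    Finset.card_ne_zero.2 ⟨id, Finset.mem_filter.2 ⟨Finset.mem_univ _, Function.bijective_id⟩⟩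
  have h5 : ((-1 : ℂ) ^ k * B ξ) = 0 := (mul_eq_zero.1 h2).resolve_left (Nat.cast_ne_zero.2 h4)
  exact (mul_eq_zero.1 h5).resolve_left (pow_ne_zero _ (by norm_num))

theorem sym_eq_zero (k : ℕ) (x : Sym V k)
    (h : ∀ v : V, inner ℂ x (monomial k (fun _ => v)) = 0) : x = 0 := by
  refine sym_ext k fun ξ => ?_
  rw [inner_zero_right, ← inner_conj_symm]
  have := polarize ((innerₛₗ ℂ x : Sym V k →ₗ[ℂ] ℂ).compMultilinearMap (monomialMul k))
    (fun ξ σ => by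
      change inner ℂ x (monomial k (fun i => ξ (σ i))) = inner ℂ x (monomial k ξ)
      rw [monomial_perm])
    (fun v => h v) ξ
  change inner ℂ x (monomial k ξ) = 0 at this
  rw [this, map_zero]

theorem eq_zero_of_inner_coherent (f : FockSpace V)
    (h : ∀ v : V, inner ℂ f (coherent v) = 0) : f = 0 := by
  ext1
  funext k
  refine sym_eq_zero k _ fun v => ?_
  let a : ℕ → ℂ := fun k => ((Nat.factorial k : ℂ))⁻¹ * inner ℂ (f k) (monomial k (fun _ => v))
  have hs : ∀ t : ℂ, HasSum (fun k => a k * t ^ k) 0 := by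
    intro t
    have := lp.hasSum_inner (𝕜 := ℂ) f (coherent (t • v))
    rw [h] at this
    refine Eq.mp (congrArg (fun F => HasSum F 0) (funext fun k => ?_)) this
    change inner ℂ (f k) (((Nat.factorial k : ℂ))⁻¹ • monomial k (fun _ => t • v)) = _
    have e : monomial k (fun _ => t • v) = t ^ k • monomial k (fun _ => v) := by
      have := (monomialMul (V := V) k).map_smul_univ (fun _ => t) (fun _ => v)
      simp only [Finset.prod_const, Finset.card_univ, Fintype.card_fin] at this
      exact this
    rw [e, inner_smul_right, inner_smul_right]
    simp only [a]
    ring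
  have hp : HasFPowerSeriesAt (fun _ : ℂ => (0 : ℂ)) (FormalMultilinearSeries.ofScalars ℂ a) 0 := by
    rw [hasFPowerSeriesAt_iff]
    refine Filter.Eventually.of_forall fun t => ?_
    simp only [FormalMultilinearSeries.coeff_ofScalars, smul_eq_mul]
    simpa only [mul_comm] using hs t
  have hk : a k = 0 := by
    have := hp.eq_zero
    rw [← FormalMultilinearSeries.ofScalars_eq_zero (E := ℂ) (c := a) k, this]
    rfl
  have h0 : (Nat.factorial k : ℂ) ≠ 0 := by exact_mod_cast Nat.factorial_ne_zero k
  simpa [a, h0] using hk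

/-- The linear map that sends formal combinations of points to combinations of coherent vectors. -/
def cohSpan (V : Type*) [SeminormedAddCommGroup V] [InnerProductSpace ℂ V] :
    (V →₀ ℂ) →ₗ[ℂ] FockSpace V := Finsupp.linearCombination ℂ coherent

theorem dense_coherent : DenseRange (cohSpan V) := by
  have : (LinearMap.range (cohSpan V)).topologicalClosure = ⊤ := by
    rw [Submodule.topologicalClosure_eq_top_iff, Submodule.eq_bot_iff]
    intro f hf
    refine eq_zero_of_inner_coherent f fun v => ?_
    rw [Submodule.mem_orthogonal'] at hf
    refine hf _ ⟨Finsupp.single v 1, ?_⟩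
    simp [cohSpan]
  have h2 := Submodule.dense_iff_topologicalClosure_eq_top.2 this
  rwa [LinearMap.coe_range] at h2

/-- The coefficient `e^{-½⟨ξ,ξ⟩-⟨ξ,κ⟩}` (inner products are conjugate linear on the left). -/
def weylCoeff (ξ κ : V) : ℂ := Complex.exp (-(1 / 2) * inner ℂ ξ ξ - inner ℂ ξ κ)

/-- The Weyl operator on finite combinations of coherent vectors. -/
def weylPre (ξ : V) : (V →₀ ℂ) →ₗ[ℂ] FockSpace V :=
  Finsupp.linearCombination ℂ fun κ => weylCoeff ξ κ • coherent (κ + ξ)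

theorem inner_weylPre (ξ : V) (x y : V →₀ ℂ) :
    inner ℂ (weylPre ξ x) (weylPre ξ y) = inner ℂ (cohSpan V x) (cohSpan V y) := by
  simp only [weylPre, cohSpan, Finsupp.linearCombination_apply, Finsupp.sum, sum_inner, inner_sum,
    inner_smul_left, inner_smul_right, inner_coherent, Finset.mul_sum]
  refine Finset.sum_congr rfl fun μ _ => Finset.sum_congr rfl fun κ _ => ?_
  have : (starRingEnd ℂ) (weylCoeff ξ κ) * weylCoeff ξ μ * Complex.exp (inner ℂ (κ + ξ) (μ + ξ)) =
      Complex.exp (inner ℂ κ μ) := by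
    unfold weylCoeff
    rw [← Complex.exp_conj, ← Complex.exp_add, ← Complex.exp_add]
    congr 1
    simp only [map_sub, map_mul, map_neg, inner_conj_symm, inner_add_left, inner_add_right, map_div₀,
      map_one, map_ofNat]
    ring
  rw [← this]
  ring

theorem norm_weylPre (ξ : V) (x : V →₀ ℂ) : ‖weylPre ξ x‖ = ‖cohSpan V x‖ := by
  rw [@norm_eq_sqrt_re_inner ℂ, @norm_eq_sqrt_re_inner ℂ, inner_weylPre]

/-- The bounded extension of the Weyl operator to the Fock space. -/
def weylCLM (ξ : V) : FockSpace V →L[ℂ] FockSpace V := (weylPre ξ).extendOfNorm (cohSpan V)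

theorem weylCLM_coherent (ξ κ : V) :
    weylCLM ξ (coherent κ) = weylCoeff ξ κ • coherent (κ + ξ) := by
  have := LinearMap.extendOfNorm_eq (f := weylPre ξ) (dense_coherent (V := V))
    ⟨1, fun x => by rw [norm_weylPre, one_mul]⟩ (Finsupp.single κ 1)
  simp only [cohSpan, weylPre, Finsupp.linearCombination_single, one_smul] at this
  exact this

theorem clm_ext_coherent {S T : FockSpace V →L[ℂ] FockSpace V}
    (h : ∀ κ, S (coherent κ) = T (coherent κ)) : S = T := by
  refine ContinuousLinearMap.coeFn_injective
    (dense_coherent.equalizer S.continuous T.continuous (funext fun x => ?_))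
  simp only [Function.comp, cohSpan, Finsupp.linearCombination_apply, Finsupp.sum, map_sum,
    map_smul, h]

theorem norm_weylCLM (ξ : V) (x : FockSpace V) : ‖weylCLM ξ x‖ = ‖x‖ := by
  refine dense_coherent.induction_on (p := fun x => ‖weylCLM ξ x‖ = ‖x‖) x
    (isClosed_eq (by fun_prop) (by fun_prop)) fun a => ?_
  unfold weylCLM
  rw [LinearMap.extendOfNorm_eq dense_coherent ⟨1, fun x => by rw [norm_weylPre, one_mul]⟩,
    norm_weylPre]

theorem weylCLM_comp (ξ η : V) :
    (weylCLM ξ).comp (weylCLM η) =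
      Complex.exp (((inner ℂ η ξ).im : ℂ) * Complex.I) • weylCLM (ξ + η) := by
  refine clm_ext_coherent fun κ => ?_
  simp only [ContinuousLinearMap.comp_apply, smul_apply, weylCLM_coherent,
    map_smul, smul_smul]
  rw [show κ + η + ξ = κ + (ξ + η) by abel]
  congr 1
  unfold weylCoeff
  rw [← Complex.exp_add, ← Complex.exp_add]
  congr 1
  have h1 : (((inner ℂ η ξ).im : ℂ) * Complex.I) = (inner ℂ η ξ - inner ℂ ξ η) / 2 := by
    rw [← inner_conj_symm ξ η, Complex.sub_conj]
    push_cast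
    ring
  rw [h1]
  simp only [inner_add_left, inner_add_right]
  ring

theorem weylCLM_zero : weylCLM (0 : V) = ContinuousLinearMap.id ℂ _ := by
  refine clm_ext_coherent fun κ => ?_
  simp [weylCLM_coherent, weylCoeff]

theorem weylCLM_neg_apply (ξ : V) (x : FockSpace V) : weylCLM (-ξ) (weylCLM ξ x) = x := by
  have h := weylCLM_comp (-ξ) ξ
  have h2 : ((inner ℂ ξ (-ξ)).im : ℂ) = 0 := by
    rw [inner_neg_right, inner_self_eq_norm_sq_to_K]
    norm_cast
  rw [h2, neg_add_cancel, weylCLM_zero] at h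
  have := congrArg (fun T : FockSpace V →L[ℂ] FockSpace V => T x) h
  simpa using this

/-- The unitary Weyl operator of `ξ`. -/
def weyl (ξ : V) : FockSpace V ≃ₗᵢ[ℂ] FockSpace V where
  toLinearMap := (weylCLM ξ : FockSpace V →ₗ[ℂ] FockSpace V)
  invFun := weylCLM (-ξ)
  left_inv x := weylCLM_neg_apply ξ x
  right_inv x := by simpa using weylCLM_neg_apply (-ξ) x
  norm_map' := norm_weylCLM ξ

theorem weyl_apply (ξ : V) (x : FockSpace V) : weyl ξ x = weylCLM ξ x := rfl

theorem weyl_weyl (ξ η : V) (x : FockSpace V) :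
    weyl ξ (weyl η x) =
      Complex.exp (((inner ℂ η ξ).im : ℂ) * Complex.I) • weyl (ξ + η) x := by
  have := congrArg (fun T : FockSpace V →L[ℂ] FockSpace V => T x) (weylCLM_comp ξ η)
  exact this

end
end Fock

namespace BiLoop
noncomputable section
open scoped TensorProduct InnerProductSpace
open Set

/-- A positive definite even lattice: a finitely generated free abelian group with a symmetric
bilinear form with values in `ℤ` that is even and positive definite. -/
class EvenLattice (Λ : Type*) [AddCommGroup Λ] where
  free : Module.Free ℤ Λ
  finite : Module.Finite ℤ Λ
  form : Λ →ₗ[ℤ] Λ →ₗ[ℤ] ℤ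
  symm : ∀ x y, form x y = form y x
  even : ∀ x, Even (form x x)
  pos : ∀ x, x ≠ 0 → 0 < form x x

attribute [instance] EvenLattice.free EvenLattice.finite

/-- The Lie algebra `Λ ⊗ ℝ` of the torus `Λ ⊗ ℝ/ℤ`. -/
def LieAlg (Λ : Type*) [AddCommGroup Λ] : Type _ := ℝ ⊗[ℤ] Λ

/-- The torus `Λ ⊗ ℝ/ℤ`. -/
def Torus (Λ : Type*) [AddCommGroup Λ] : Type _ := UnitAddCircle ⊗[ℤ] Λ

section lattice
variable (Λ : Type*) [AddCommGroup Λ]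

instance : AddCommGroup (LieAlg Λ) := inferInstanceAs (AddCommGroup (ℝ ⊗[ℤ] Λ))
instance : Module ℝ (LieAlg Λ) := inferInstanceAs (Module ℝ (ℝ ⊗[ℤ] Λ))
instance : AddCommGroup (Torus Λ) := inferInstanceAs (AddCommGroup (UnitAddCircle ⊗[ℤ] Λ))

/-- The inclusion of the lattice into the Lie algebra. -/
def incl : Λ →+ LieAlg Λ := (TensorProduct.mk ℤ ℝ Λ 1).toAddMonoidHom

/-- The exponential map from the Lie algebra onto the torus. -/
def torusExp : LieAlg Λ →+ Torus Λ :=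
  (LinearMap.rTensor Λ (QuotientAddGroup.mk' (AddSubgroup.zmultiples (1 : ℝ))).toIntLinearMap
    : ℝ ⊗[ℤ] Λ →ₗ[ℤ] UnitAddCircle ⊗[ℤ] Λ).toAddMonoidHom

theorem torusExp_surjective : Function.Surjective (torusExp Λ) :=
  LinearMap.rTensor_surjective Λ (QuotientAddGroup.mk'_surjective _)

theorem torusExp_eq_zero_iff (x : LieAlg Λ) : torusExp Λ x = 0 ↔ ∃ l, incl Λ l = x := by
  have h := rTensor_exact (R := ℤ) Λ
    (f := (zmultiplesHom ℝ (1 : ℝ)).toIntLinearMap)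
    (g := (QuotientAddGroup.mk' (AddSubgroup.zmultiples (1 : ℝ))).toIntLinearMap)
    (by
      intro y
      change (QuotientAddGroup.mk y : UnitAddCircle) = 0 ↔ _
      rw [QuotientAddGroup.eq_zero_iff, AddSubgroup.mem_zmultiples_iff]
      simp)
    (QuotientAddGroup.mk'_surjective _)
  refine (h x).trans ⟨?_, ?_⟩
  · rintro ⟨y, rfl⟩
    refine ⟨TensorProduct.lid ℤ Λ y, ?_⟩
    induction y with
    | zero => simp; rfl
    | add a b ha hb => rw [map_add, map_add, ha, hb, map_add]; rfl
    | tmul n l =>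
      change (1 : ℝ) ⊗ₜ[ℤ] (n • l) = ((zmultiplesHom ℝ (1 : ℝ)) n) ⊗ₜ[ℤ] l
      rw [TensorProduct.tmul_smul, TensorProduct.smul_tmul']
      simp
  · rintro ⟨l, rfl⟩
    refine ⟨(1 : ℤ) ⊗ₜ[ℤ] l, ?_⟩
    change ((zmultiplesHom ℝ (1 : ℝ)) 1) ⊗ₜ[ℤ] l = (1 : ℝ) ⊗ₜ[ℤ] l
    simp

variable [EvenLattice Λ]

/-- The real bilinear extension of the form of the lattice. -/
def realForm : LinearMap.BilinForm ℝ (ℝ ⊗[ℤ] Λ) :=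
  LinearMap.BilinForm.baseChange ℝ (EvenLattice.form : LinearMap.BilinForm ℤ Λ)

theorem realForm_tmul (a b : ℝ) (x y : Λ) :
    realForm Λ (a ⊗ₜ x) (b ⊗ₜ y) = a * b * (EvenLattice.form x y : ℤ) := by
  simp [realForm, LinearMap.BilinForm.baseChange_tmul]
  ring

theorem realForm_symm (x y : ℝ ⊗[ℤ] Λ) : realForm Λ x y = realForm Λ y x := by
  induction x with
  | zero => simp
  | add a b ha hb => simp [ha, hb]
  | tmul a l =>
    induction y with
    | zero => simp
    | add a b ha hb => simp [ha, hb]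
    | tmul b m => rw [realForm_tmul, realForm_tmul, EvenLattice.symm l m]; ring

/-- The Gram matrix of the lattice in some basis. -/
def gram : Matrix (Module.Free.ChooseBasisIndex ℤ Λ) (Module.Free.ChooseBasisIndex ℤ Λ) ℤ :=
  Matrix.of fun i j => EvenLattice.form (Module.Free.chooseBasis ℤ Λ i)
    (Module.Free.chooseBasis ℤ Λ j)

theorem gram_int_pos (c : Module.Free.ChooseBasisIndex ℤ Λ → ℤ) (hc : c ≠ 0) :
    0 < ∑ i, ∑ j, c i * c j * gram Λ i j := by
  have h := EvenLattice.pos (∑ i, c i • Module.Free.chooseBasis ℤ Λ i) (by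
    intro h
    apply hc
    funext i
    exact (Fintype.linearIndependent_iff.1 (Module.Free.chooseBasis ℤ Λ).linearIndependent) c h i)
  simp only [map_sum, map_smul, LinearMap.sum_apply, LinearMap.smul_apply, smul_eq_mul,
    Finset.mul_sum] at h
  convert h using 1
  rw [Finset.sum_comm]
  simp [gram]
  refine Finset.sum_congr rfl fun i _ => Finset.sum_congr rfl fun j _ => by ring

theorem gram_real_nonneg (c : Module.Free.ChooseBasisIndex ℤ Λ → ℝ) :
    0 ≤ ∑ i, ∑ j, c i * c j * (gram Λ i j : ℝ) := by
  have hd : DenseRange (fun (q : Module.Free.ChooseBasisIndex ℤ Λ → ℚ) i => (q i : ℝ)) :=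
    DenseRange.piMap (fun _ => Rat.denseRange_cast)
  refine hd.induction_on (p := fun c => 0 ≤ ∑ i, ∑ j, c i * c j * (gram Λ i j : ℝ)) c
    (isClosed_le (by fun_prop) (by fun_prop)) fun q => ?_
  obtain ⟨N, hN⟩ := IsLocalization.exist_integer_multiples_of_finite (nonZeroDivisors ℤ) q
  choose z hz using hN
  have hN0 : (0 : ℝ) < ((N : ℤ) : ℝ) ^ 2 := by
    have : (N : ℤ) ≠ 0 := nonZeroDivisors.ne_zero N.2
    positivity
  have hz' : ∀ i, ((z i : ℤ) : ℝ) = ((N : ℤ) : ℝ) * (q i : ℝ) := by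
    intro i
    have := hz i
    simp only [Algebra.smul_def, eq_intCast] at this
    exact_mod_cast this
  have h0 : (0 : ℝ) ≤ ∑ i, ∑ j, (z i : ℝ) * z j * (gram Λ i j : ℝ) := by
    by_cases h : z = 0
    · simp [h]
    · exact_mod_cast (gram_int_pos Λ z h).le
  have h1 : ∑ i, ∑ j, (z i : ℝ) * z j * (gram Λ i j : ℝ) =
      ((N : ℤ) : ℝ) ^ 2 * ∑ i, ∑ j, (q i : ℝ) * q j * (gram Λ i j : ℝ) := by
    simp only [Finset.mul_sum, hz']
    refine Finset.sum_congr rfl fun i _ => Finset.sum_congr rfl fun j _ => by ring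
  rw [h1] at h0
  exact nonneg_of_mul_nonneg_right h0 hN0

theorem gram_posDef : ((gram Λ).map (Int.cast : ℤ → ℝ)).PosDef := by
  classical
  have hsd : ((gram Λ).map (Int.cast : ℤ → ℝ)).PosSemidef := by
    refine Matrix.PosSemidef.of_dotProduct_mulVec_nonneg ?_ fun c => ?_
    · ext i j
      simp [gram, EvenLattice.symm]
    · refine (gram_real_nonneg Λ c).trans_eq ?_
      simp only [dotProduct, Matrix.mulVec, Matrix.map_apply, Finset.mul_sum, Pi.star_apply,
        star_trivial]
      refine Finset.sum_congr rfl fun i _ => Finset.sum_congr rfl fun j _ => by ring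
  refine hsd.posDef_iff_isUnit.2 ?_
  rw [Matrix.isUnit_iff_isUnit_det, isUnit_iff_ne_zero]
  have : ((gram Λ).map (Int.cast : ℤ → ℝ)).det = (((gram Λ).det : ℤ) : ℝ) := by
    exact (RingHom.map_det (Int.castRingHom ℝ) (gram Λ)).symm
  rw [this]
  norm_cast
  intro h
  obtain ⟨v, hv, hv0⟩ := Matrix.exists_mulVec_eq_zero_iff.2 h
  have h1 := gram_int_pos Λ v hv
  have h2 : ∑ i, ∑ j, v i * v j * gram Λ i j = dotProduct v ((gram Λ).mulVec v) := by
    simp only [dotProduct, Matrix.mulVec, Finset.mul_sum]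
    refine Finset.sum_congr rfl fun i _ => Finset.sum_congr rfl fun j _ => by ring
  rw [h2, hv0] at h1
  simp at h1

theorem realForm_pos (x : ℝ ⊗[ℤ] Λ) (hx : x ≠ 0) : 0 < realForm Λ x x := by
  let b := Algebra.TensorProduct.basis ℝ (Module.Free.chooseBasis ℤ Λ)
  have hc : (b.repr x : Module.Free.ChooseBasisIndex ℤ Λ → ℝ) ≠ 0 := by
    intro h
    apply hx
    apply b.repr.injective
    rw [map_zero]
    exact DFunLike.coe_injective h
  have h := (gram_posDef Λ).dotProduct_mulVec_pos hc
  suffices e : realForm Λ x x = dotProduct (star (b.repr x : Module.Free.ChooseBasisIndex ℤ Λ → ℝ))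
      (((gram Λ).map (Int.cast : ℤ → ℝ)).mulVec (b.repr x)) by
    rw [e]; exact h
  conv_lhs => rw [← b.sum_repr x]
  simp only [map_sum, map_smul, LinearMap.sum_apply, LinearMap.smul_apply, smul_eq_mul,
    dotProduct, Matrix.mulVec, Matrix.map_apply, Finset.mul_sum, Pi.star_apply, star_trivial]
  rw [Finset.sum_comm]
  refine Finset.sum_congr rfl fun i _ => Finset.sum_congr rfl fun j _ => ?_
  have : realForm Λ (b i) (b j) = (gram Λ i j : ℝ) := by
    simp [b, Algebra.TensorProduct.basis_apply, realForm_tmul, gram]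
  rw [this]; ring

/-- The inner product of the Lie algebra. -/
@[reducible] def lieCore : InnerProductSpace.Core ℝ (LieAlg Λ) where
  inner x y := realForm Λ x y
  conj_inner_symm x y := realForm_symm Λ y x
  re_inner_nonneg x := by
    by_cases h : x = 0
    · subst h
      exact le_of_eq (LinearMap.BilinForm.zero_left (B := realForm Λ) (0 : ℝ ⊗[ℤ] Λ)).symm
    · exact (realForm_pos Λ x h).le
  add_left x y z := LinearMap.BilinForm.add_left (B := realForm Λ) x y z
  smul_left x y c := LinearMap.BilinForm.smul_left (B := realForm Λ) c x y
  definite x h := by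
    by_contra hx
    exact (realForm_pos Λ x hx).ne' h

instance : NormedAddCommGroup (LieAlg Λ) :=
  @InnerProductSpace.Core.toNormedAddCommGroup ℝ (LieAlg Λ) _ _ _ (lieCore Λ)

instance : InnerProductSpace ℝ (LieAlg Λ) := InnerProductSpace.ofCore (lieCore Λ).toCore

instance : FiniteDimensional ℝ (LieAlg Λ) := inferInstanceAs (FiniteDimensional ℝ (ℝ ⊗[ℤ] Λ))

theorem inner_eq_realForm (x y : LieAlg Λ) : inner ℝ x y = realForm Λ x y := rfl

theorem countable_lattice : Countable Λ :=
  (Module.Free.chooseBasis ℤ Λ).equivFun.toEquiv.countable_iff.2 inferInstance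

end lattice

/-- An injective isometric homomorphism between lattices of the same rank. -/
structure LatticeHom (Γ Λ : Type*) [AddCommGroup Γ] [EvenLattice Γ] [AddCommGroup Λ]
    [EvenLattice Λ] where
  toHom : Γ →ₗ[ℤ] Λ
  injective : Function.Injective toHom
  isometric : ∀ x y, (EvenLattice.form (toHom x) (toHom y) : ℤ) = EvenLattice.form x y
  rank_eq : Module.finrank ℤ Γ = Module.finrank ℤ Λ

namespace LatticeHom
variable {Γ Λ : Type*} [AddCommGroup Γ] [EvenLattice Γ] [AddCommGroup Λ] [EvenLattice Λ]
  (π : LatticeHom Γ Λ)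

theorem realForm_baseChange (x y : ℝ ⊗[ℤ] Γ) :
    realForm Λ (π.toHom.baseChange ℝ x) (π.toHom.baseChange ℝ y) = realForm Γ x y := by
  induction x with
  | zero => simp
  | add a b ha hb => simp [ha, hb]
  | tmul a l =>
    induction y with
    | zero => simp
    | add a b ha hb => simp only [map_add, ha, hb]
    | tmul b m => simp [realForm_tmul, π.isometric]

/-- The isometry `ℝπ` between the Lie algebras induced by a homomorphism of lattices. -/
def lie : LieAlg Γ ≃ₗᵢ[ℝ] LieAlg Λ :=
  LinearIsometry.toLinearIsometryEquiv
    (LinearMap.isometryOfInner (show LieAlg Γ →ₗ[ℝ] LieAlg Λ from π.toHom.baseChange ℝ)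
      (fun x y => π.realForm_baseChange x y))
    (by
      change Module.finrank ℝ (ℝ ⊗[ℤ] Γ) = Module.finrank ℝ (ℝ ⊗[ℤ] Λ)
      rw [Module.finrank_baseChange, Module.finrank_baseChange, π.rank_eq])

theorem lie_tmul (a : ℝ) (l : Γ) : π.lie (show LieAlg Γ from a ⊗ₜ[ℤ] l) =
    (show LieAlg Λ from a ⊗ₜ[ℤ] π.toHom l) := rfl

/-- The homomorphism `𝕋π` between the tori induced by a homomorphism of lattices. -/
def torus : Torus Γ →+ Torus Λ :=
  (LinearMap.lTensor UnitAddCircle π.toHom :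
    UnitAddCircle ⊗[ℤ] Γ →ₗ[ℤ] UnitAddCircle ⊗[ℤ] Λ).toAddMonoidHom

theorem torus_exp (x : LieAlg Γ) : π.torus (torusExp Γ x) = torusExp Λ (π.lie x) := by
  have : ∀ x : ℝ ⊗[ℤ] Γ, π.torus (torusExp Γ x) = torusExp Λ (π.lie x) := by
    intro x
    induction x with
    | zero =>
      exact (map_zero (π.torus.comp (torusExp Γ))).trans (map_zero ((torusExp Λ).comp
        (π.lie.toLinearEquiv.toAddEquiv : LieAlg Γ →+ LieAlg Λ))).symm
    | add a b ha hb =>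
      exact (map_add (π.torus.comp (torusExp Γ)) a b).trans ((congrArg₂ (· + ·) ha hb).trans
        (map_add ((torusExp Λ).comp
          (π.lie.toLinearEquiv.toAddEquiv : LieAlg Γ →+ LieAlg Λ)) a b).symm)
    | tmul a l => rfl
  exact this x

theorem lie_incl (l : Γ) : π.lie (incl Γ l) = incl Λ (π.toHom l) := rfl

end LatticeHom
end
end BiLoop

namespace BiLoop
noncomputable section
open scoped ContDiff Pointwise
open Set
variable {E : Type*} [NormedAddCommGroup E] [NormedSpace ℝ E]

/-- Two functions glued at the point `b`. -/
def glue (b : ℝ) (f g : ℝ → E) : ℝ → E := fun x => if x ≤ b then f x else g x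

theorem hasDerivWithinAt_glue {a b c : ℝ} (hab : a < b) (hbc : b < c) {f g f' g' : ℝ → E}
    (hf : ∀ x ∈ Icc a b, HasDerivWithinAt f (f' x) (Icc a b) x)
    (hg : ∀ x ∈ Icc b c, HasDerivWithinAt g (g' x) (Icc b c) x)
    (h0 : f b = g b) (h1 : f' b = g' b) :
    ∀ x ∈ Icc a c, HasDerivWithinAt (glue b f g) (glue b f' g' x) (Icc a c) x := by
  have eL : ∀ x ∈ Icc a b, glue b f g x = f x := fun x hx => if_pos hx.2
  have eR : ∀ x ∈ Icc b c, glue b f g x = g x := by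
    intro x hx
    by_cases h : x ≤ b
    · have : x = b := le_antisymm h hx.1
      subst this
      simp [glue, h0]
    · simp [glue, h]
  intro x hx
  rw [← Icc_union_Icc_eq_Icc hab.le hbc.le]
  refine HasDerivWithinAt.union ?_ ?_
  · by_cases h : x ≤ b
    · have : glue b f' g' x = f' x := if_pos h
      rw [this]
      exact (hf x ⟨hx.1, h⟩).congr eL (eL x ⟨hx.1, h⟩)
    · refine HasFDerivWithinAt.of_notMem_closure ?_
      rw [isClosed_Icc.closure_eq]
      exact fun h' => h h'.2
  · by_cases h : b ≤ x
    · have : glue b f' g' x = g' x := by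
        by_cases h2 : x ≤ b
        · have : x = b := le_antisymm h2 h
          subst this
          simp [glue, h1]
        · simp [glue, h2]
      rw [this]
      exact (hg x ⟨h, hx.2⟩).congr eR (eR x ⟨h, hx.2⟩)
    · refine HasFDerivWithinAt.of_notMem_closure ?_
      rw [isClosed_Icc.closure_eq]
      exact fun h' => h h'.1

theorem contDiffOn_glue_nat {a b c : ℝ} (hab : a < b) (hbc : b < c) (n : ℕ) :
    ∀ {f g : ℝ → E}, ContDiffOn ℝ ∞ f (Icc a b) → ContDiffOn ℝ ∞ g (Icc b c) →
    (∀ k, iteratedDerivWithin k f (Icc a b) b = iteratedDerivWithin k g (Icc b c) b) →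
    ContDiffOn ℝ n (glue b f g) (Icc a c) := by
  induction n with
  | zero =>
    intro f g hf hg h
    have h0 : f b = g b := by simpa using h 0
    have hf1 := (contDiffOn_infty_iff_derivWithin (uniqueDiffOn_Icc hab)).1 hf
    have hg1 := (contDiffOn_infty_iff_derivWithin (uniqueDiffOn_Icc hbc)).1 hg
    have h1 : derivWithin f (Icc a b) b = derivWithin g (Icc b c) b := by
      simpa using h 1
    have := hasDerivWithinAt_glue hab hbc (fun x hx => (hf1.1 x hx).hasDerivWithinAt)
      (fun x hx => (hg1.1 x hx).hasDerivWithinAt) h0 h1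
    exact contDiffOn_zero.2 fun x hx => (this x hx).continuousWithinAt
  | succ n ih =>
    intro f g hf hg h
    have h0 : f b = g b := by simpa using h 0
    have hf1 := (contDiffOn_infty_iff_derivWithin (uniqueDiffOn_Icc hab)).1 hf
    have hg1 := (contDiffOn_infty_iff_derivWithin (uniqueDiffOn_Icc hbc)).1 hg
    have h1 : derivWithin f (Icc a b) b = derivWithin g (Icc b c) b := by
      simpa using h 1
    have H := hasDerivWithinAt_glue hab hbc (fun x hx => (hf1.1 x hx).hasDerivWithinAt)
      (fun x hx => (hg1.1 x hx).hasDerivWithinAt) h0 h1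
    have hac := uniqueDiffOn_Icc (hab.trans hbc)
    rw [Nat.cast_succ, contDiffOn_succ_iff_derivWithin hac]
    refine ⟨fun x hx => (H x hx).differentiableWithinAt, by simp, ?_⟩
    refine (ih hf1.2 hg1.2 fun k => ?_).congr fun x hx => (H x hx).derivWithin (hac x hx)
    rw [← iteratedDerivWithin_succ', ← iteratedDerivWithin_succ']
    exact h (k + 1)

/-- Two smooth pieces whose derivatives of all orders agree at the common endpoint
glue to a smooth function. -/
theorem contDiffOn_glue {a b c : ℝ} (hab : a < b) (hbc : b < c) {f g : ℝ → E}
    (hf : ContDiffOn ℝ ∞ f (Icc a b)) (hg : ContDiffOn ℝ ∞ g (Icc b c))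
    (h : ∀ k, iteratedDerivWithin k f (Icc a b) b = iteratedDerivWithin k g (Icc b c) b) :
    ContDiffOn ℝ ∞ (glue b f g) (Icc a c) :=
  contDiffOn_infty.2 fun n => contDiffOn_glue_nat hab hbc n hf hg h

/-- The `1`-periodic extension of a function on `[0,1)`. -/
def periodize (f : ℝ → E) : ℝ → E := fun x => f (Int.fract x)

theorem contDiff_periodize {f : ℝ → E} (hf : ContDiffOn ℝ ∞ f (Icc 0 1))
    (h : ∀ k, iteratedDerivWithin k f (Icc 0 1) 1 = iteratedDerivWithin k f (Icc 0 1) 0) :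
    ContDiff ℝ ∞ (periodize f) := by
  have hs : ∀ m : ℝ, (fun z => m + z) ⁻¹' (Icc 0 1 : Set ℝ) = Icc (-m) (1 - m) := by
    intro m; rw [preimage_const_add_Icc]; simp
  have hsm : ∀ m : ℝ, ContDiffOn ℝ ∞ (fun z => f (m + z)) (Icc (-m) (1 - m)) := by
    intro m
    rw [← hs m]
    exact hf.comp (by fun_prop) (fun x hx => hx)
  have hd : ∀ (m : ℝ) (k : ℕ) (x : ℝ), iteratedDerivWithin k (fun z => f (m + z))
      (Icc (-m) (1 - m)) x = iteratedDerivWithin k f (Icc 0 1) (m + x) := by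
    intro m k x
    rw [iteratedDerivWithin_comp_const_add m]
    have e : m +ᵥ Icc (-m) (1 - m) = Icc (0 : ℝ) 1 := by
      change (fun z => m + z) '' _ = _
      rw [image_const_add_Icc]
      simp
    rw [e]
  rw [contDiff_iff_contDiffAt]
  intro x
  set n := ⌊x⌋ with hn
  have h1 : ContDiffOn ℝ ∞ (glue (n : ℝ) (fun z => f ((1 - n : ℝ) + z)) (fun z => f ((-n : ℝ) + z)))
      (Icc (n - 1) (n + 1)) := by
    refine contDiffOn_glue (by linarith) (by linarith) ?_ ?_ fun k => ?_
    · have := hsm (1 - n)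
      convert this using 2 <;> ring
    · have := hsm (-n)
      convert this using 2 <;> ring
    · have e1 := hd (1 - n) k n
      have e2 := hd (-n) k n
      rw [show (1 - n + n : ℝ) = 1 by ring, show -(1 - n : ℝ) = n - 1 by ring,
        show (1 - (1 - n) : ℝ) = n by ring] at e1
      rw [show (-n + n : ℝ) = 0 by ring, neg_neg, show (1 - -n : ℝ) = n + 1 by ring] at e2
      rw [e1, e2, h k]
  have hx : x ∈ Ioo (n - 1 : ℝ) (n + 1) := ⟨by linarith [Int.floor_le x], Int.lt_floor_add_one x⟩
  refine (h1.contDiffAt (Icc_mem_nhds hx.1 hx.2)).congr_of_eventuallyEq ?_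
  filter_upwards [Ioo_mem_nhds hx.1 hx.2] with y hy
  have h01 : f 1 = f 0 := by simpa using h 0
  unfold periodize glue
  split_ifs with hyn
  · rcases hyn.eq_or_lt with e | e
    · rw [e]; simp [h01]
    · have : Int.fract y = 1 - n + y := by
        have : ⌊y⌋ = n - 1 := by
          rw [Int.floor_eq_iff]; push_cast; constructor <;> linarith [hy.1]
        rw [Int.fract, this]; push_cast; ring
      rw [this]
  · have : Int.fract y = -n + y := by
      have : ⌊y⌋ = n := by
        rw [Int.floor_eq_iff]; constructor <;> linarith [hy.2]
      rw [Int.fract, this]; ring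
    rw [this]

theorem periodize_periodic {E : Type*} (f : ℝ → E) : Function.Periodic (periodize f) 1 := by
  intro x
  simp [periodize]

/-- A continuous function on an interval with values in a countable set is constant. -/
theorem eq_of_countable {E : Type*} [NormedAddCommGroup E] {a b : ℝ} {f : ℝ → E} (hf : ContinuousOn f (Icc a b)) {S : Set E}
    (hS : S.Countable) (h : ∀ x ∈ Icc a b, f x ∈ S) {x y : ℝ} (hx : x ∈ Icc a b)
    (hy : y ∈ Icc a b) : f x = f y :=
  hS.isTotallyDisconnected (f '' Icc a b) (by rintro _ ⟨z, hz, rfl⟩; exact h z hz)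
    (isPreconnected_Icc.image f hf) (mem_image_of_mem f hx) (mem_image_of_mem f hy)

end
end BiLoop

namespace BiLoop
noncomputable section
open scoped ContDiff InnerProductSpace
open Set MeasureTheory intervalIntegral

section trig

theorem cos_period (k : ℕ) (s : ℝ) :
    Real.cos (2 * Real.pi * k * (s + 1)) = Real.cos (2 * Real.pi * k * s) := by
  rw [show 2 * Real.pi * k * (s + 1) = 2 * Real.pi * k * s + k * (2 * Real.pi) by ring,
    Real.cos_add_nat_mul_two_pi]

theorem sin_period (k : ℕ) (s : ℝ) :
    Real.sin (2 * Real.pi * k * (s + 1)) = Real.sin (2 * Real.pi * k * s) := by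
  rw [show 2 * Real.pi * k * (s + 1) = 2 * Real.pi * k * s + k * (2 * Real.pi) by ring,
    Real.sin_add_nat_mul_two_pi]

theorem integral_cos_int (n : ℤ) :
    ∫ s in (0 : ℝ)..1, Real.cos (2 * Real.pi * n * s) = if n = 0 then 1 else 0 := by
  split_ifs with h
  · simp [h]
  · have h0 : 2 * Real.pi * (n : ℝ) ≠ 0 := by
      have : (n : ℝ) ≠ 0 := by exact_mod_cast h
      have := Real.pi_ne_zero
      positivity
    rw [intervalIntegral.integral_comp_mul_left (fun x => Real.cos x) h0, integral_cos]
    have := Real.sin_int_mul_pi (2 * n)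
    push_cast at this
    rw [show 2 * Real.pi * n * 1 = 2 * n * Real.pi by ring, this]
    simp

theorem integral_sin_int (n : ℤ) :
    ∫ s in (0 : ℝ)..1, Real.sin (2 * Real.pi * n * s) = 0 := by
  by_cases h : n = 0
  · simp [h]
  · have h0 : 2 * Real.pi * (n : ℝ) ≠ 0 := by
      have : (n : ℝ) ≠ 0 := by exact_mod_cast h
      have := Real.pi_ne_zero
      positivity
    rw [intervalIntegral.integral_comp_mul_left (fun x => Real.sin x) h0, integral_sin]
    have := Real.cos_int_mul_two_pi n
    rw [show 2 * Real.pi * n * 1 = n * (2 * Real.pi) by ring, this]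
    simp

theorem integral_cos_cos (j k : ℕ) :
    ∫ s in (0 : ℝ)..1, Real.cos (2 * Real.pi * (j + 1 : ℕ) * s) *
      (2 * Real.cos (2 * Real.pi * (k + 1 : ℕ) * s)) = if j = k then 1 else 0 := by
  have e : ∀ s : ℝ, Real.cos (2 * Real.pi * (j + 1 : ℕ) * s) *
      (2 * Real.cos (2 * Real.pi * (k + 1 : ℕ) * s)) =
      Real.cos (2 * Real.pi * ((j - k : ℤ) : ℝ) * s) +
        Real.cos (2 * Real.pi * ((j + k + 2 : ℤ) : ℝ) * s) := by
    intro s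
    rw [show 2 * Real.pi * ((j - k : ℤ) : ℝ) * s = 2 * Real.pi * (j + 1 : ℕ) * s -
        2 * Real.pi * (k + 1 : ℕ) * s by push_cast; ring,
      show 2 * Real.pi * ((j + k + 2 : ℤ) : ℝ) * s = 2 * Real.pi * (j + 1 : ℕ) * s +
        2 * Real.pi * (k + 1 : ℕ) * s by push_cast; ring, Real.cos_sub, Real.cos_add]
    ring
  simp only [e]
  rw [intervalIntegral.integral_add (Continuous.intervalIntegrable (by fun_prop) _ _)
    (Continuous.intervalIntegrable (by fun_prop) _ _), integral_cos_int, integral_cos_int]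
  have h2 : ¬ ((j : ℤ) + k + 2 = 0) := by omega
  rw [if_neg h2, add_zero]
  by_cases h : j = k
  · simp [h]
  · rw [if_neg h, if_neg (by omega)]

theorem integral_sin_sin (j k : ℕ) :
    ∫ s in (0 : ℝ)..1, Real.sin (2 * Real.pi * (j + 1 : ℕ) * s) *
      (2 * Real.sin (2 * Real.pi * (k + 1 : ℕ) * s)) = if j = k then 1 else 0 := by
  have e : ∀ s : ℝ, Real.sin (2 * Real.pi * (j + 1 : ℕ) * s) *
      (2 * Real.sin (2 * Real.pi * (k + 1 : ℕ) * s)) =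
      Real.cos (2 * Real.pi * ((j - k : ℤ) : ℝ) * s) -
        Real.cos (2 * Real.pi * ((j + k + 2 : ℤ) : ℝ) * s) := by
    intro s
    rw [show 2 * Real.pi * ((j - k : ℤ) : ℝ) * s = 2 * Real.pi * (j + 1 : ℕ) * s -
        2 * Real.pi * (k + 1 : ℕ) * s by push_cast; ring,
      show 2 * Real.pi * ((j + k + 2 : ℤ) : ℝ) * s = 2 * Real.pi * (j + 1 : ℕ) * s +
        2 * Real.pi * (k + 1 : ℕ) * s by push_cast; ring, Real.cos_sub, Real.cos_add]
    ring
  simp only [e]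
  rw [intervalIntegral.integral_sub (Continuous.intervalIntegrable (by fun_prop) _ _)
    (Continuous.intervalIntegrable (by fun_prop) _ _), integral_cos_int, integral_cos_int]
  have h2 : ¬ ((j : ℤ) + k + 2 = 0) := by omega
  rw [if_neg h2, sub_zero]
  by_cases h : j = k
  · simp [h]
  · rw [if_neg h, if_neg (by omega)]

theorem integral_sin_cos (j k : ℕ) :
    ∫ s in (0 : ℝ)..1, Real.sin (2 * Real.pi * (j + 1 : ℕ) * s) *
      (2 * Real.cos (2 * Real.pi * (k + 1 : ℕ) * s)) = 0 := by
  have e : ∀ s : ℝ, Real.sin (2 * Real.pi * (j + 1 : ℕ) * s) *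
      (2 * Real.cos (2 * Real.pi * (k + 1 : ℕ) * s)) =
      Real.sin (2 * Real.pi * ((j - k : ℤ) : ℝ) * s) +
        Real.sin (2 * Real.pi * ((j + k + 2 : ℤ) : ℝ) * s) := by
    intro s
    rw [show 2 * Real.pi * ((j - k : ℤ) : ℝ) * s = 2 * Real.pi * (j + 1 : ℕ) * s -
        2 * Real.pi * (k + 1 : ℕ) * s by push_cast; ring,
      show 2 * Real.pi * ((j + k + 2 : ℤ) : ℝ) * s = 2 * Real.pi * (j + 1 : ℕ) * s +
        2 * Real.pi * (k + 1 : ℕ) * s by push_cast; ring, Real.sin_sub, Real.sin_add]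
    ring
  simp only [e]
  rw [intervalIntegral.integral_add (Continuous.intervalIntegrable (by fun_prop) _ _)
    (Continuous.intervalIntegrable (by fun_prop) _ _), integral_sin_int, integral_sin_int, add_zero]

end trig

variable {E : Type*} [NormedAddCommGroup E] [InnerProductSpace ℝ E]

/-- The cosine coefficient `∫₀¹ cos(2πks) f(s) ds`. -/
def cosCoeff (k : ℕ) (f : ℝ → E) : E := ∫ s in (0 : ℝ)..1, Real.cos (2 * Real.pi * k * s) • f s

/-- The sine coefficient `∫₀¹ sin(2πks) f(s) ds`. -/
def sinCoeff (k : ℕ) (f : ℝ → E) : E := ∫ s in (0 : ℝ)..1, Real.sin (2 * Real.pi * k * s) • f s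

/-- The trigonometric series `∑_{k ≥ 1} 2 (cos(2πkθ) a_k + sin(2πkθ) b_k)`, where `a` and `b` are
indexed by `k - 1`. -/
def trigSeries (a b : ℕ → E) (θ : ℝ) : E :=
  ∑' k : ℕ, ((2 * Real.cos (2 * Real.pi * (k + 1 : ℕ) * θ)) • a k +
    (2 * Real.sin (2 * Real.pi * (k + 1 : ℕ) * θ)) • b k)

/-- Rapid decay of a sequence. -/
def Rapid {E : Type*} [NormedAddCommGroup E] (a : ℕ → E) : Prop := ∀ m : ℕ, Summable fun k : ℕ => ((k + 1 : ℕ) : ℝ) ^ m * ‖a k‖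

theorem Rapid.mul {a : ℕ → E} (h : Rapid a) (c : ℝ) :
    Rapid fun k : ℕ => (c * ((k + 1 : ℕ) : ℝ)) • a k := by
  intro m
  refine ((h (m + 1)).mul_left |c|).congr fun k => ?_
  rw [norm_smul, norm_mul, Real.norm_natCast, Real.norm_eq_abs]
  ring

theorem Rapid.neg {E : Type*} [NormedAddCommGroup E] {a : ℕ → E} (h : Rapid a) : Rapid fun k => - a k := by
  intro m
  simpa using h m

theorem Rapid.summable {E : Type*} [NormedAddCommGroup E] {a : ℕ → E} (h : Rapid a) : Summable fun k => ‖a k‖ := by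
  simpa using h 0

theorem trig_term_bound (a b : ℕ → E) (k : ℕ) (θ : ℝ) :
    ‖(2 * Real.cos (2 * Real.pi * (k + 1 : ℕ) * θ)) • a k +
      (2 * Real.sin (2 * Real.pi * (k + 1 : ℕ) * θ)) • b k‖ ≤ 2 * ‖a k‖ + 2 * ‖b k‖ := by
  refine (norm_add_le _ _).trans (add_le_add ?_ ?_)
  · rw [norm_smul, norm_mul]
    have := Real.abs_cos_le_one (2 * Real.pi * (k + 1 : ℕ) * θ)
    rw [← Real.norm_eq_abs] at this
    simp only [Real.norm_ofNat]
    nlinarith [norm_nonneg (a k)]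
  · rw [norm_smul, norm_mul]
    have := Real.abs_sin_le_one (2 * Real.pi * (k + 1 : ℕ) * θ)
    rw [← Real.norm_eq_abs] at this
    simp only [Real.norm_ofNat]
    nlinarith [norm_nonneg (b k)]

theorem trig_bound_summable {E : Type*} [NormedAddCommGroup E] {a b : ℕ → E} (ha : Rapid a) (hb : Rapid b) :
    Summable fun k => 2 * ‖a k‖ + 2 * ‖b k‖ :=
  (ha.summable.mul_left 2).add (hb.summable.mul_left 2)

theorem periodic_trigSeries (a b : ℕ → E) : Function.Periodic (trigSeries a b) 1 := by
  intro θ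
  unfold trigSeries
  simp only [cos_period, sin_period]

variable [CompleteSpace E]

theorem hasDerivAt_trigSeries {a b : ℕ → E} (ha : Rapid a) (hb : Rapid b) (θ : ℝ) :
    HasDerivAt (trigSeries a b) (trigSeries (fun k => ((2 * Real.pi) * ((k + 1 : ℕ) : ℝ)) • b k)
      (fun k => - (((2 * Real.pi) * ((k + 1 : ℕ) : ℝ)) • a k)) θ) θ := by
  refine hasDerivAt_tsum (trig_bound_summable (hb.mul (2 * Real.pi)) (ha.mul (2 * Real.pi)).neg)
    (g' := fun k y => (2 * Real.cos (2 * Real.pi * (k + 1 : ℕ) * y)) •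
      (((2 * Real.pi) * ((k + 1 : ℕ) : ℝ)) • b k) +
      (2 * Real.sin (2 * Real.pi * (k + 1 : ℕ) * y)) • (- (((2 * Real.pi) * ((k + 1 : ℕ) : ℝ)) • a k)))
    (y₀ := 0) (fun k y => ?_)
    (fun k y => trig_term_bound (fun k => ((2 * Real.pi) * ((k + 1 : ℕ) : ℝ)) • b k)
      (fun k => - (((2 * Real.pi) * ((k + 1 : ℕ) : ℝ)) • a k)) k y) ?_ θ
  · have h1 : HasDerivAt (fun y : ℝ => 2 * Real.pi * (k + 1 : ℕ) * y) (2 * Real.pi * (k + 1 : ℕ)) y := by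
      simpa using (hasDerivAt_id y).const_mul (2 * Real.pi * (k + 1 : ℕ))
    have h2 := (((h1.cos).const_mul 2).smul_const (a k)).add
      (((h1.sin).const_mul 2).smul_const (b k))
    refine h2.congr_deriv ?_
    simp only [← neg_smul, smul_smul]
    rw [add_comm]
    congr 2 <;> ring
  · exact Summable.of_norm_bounded (trig_bound_summable ha hb) (fun k => trig_term_bound a b k 0)

theorem contDiff_trigSeries_nat (n : ℕ) : ∀ {a b : ℕ → E}, Rapid a → Rapid b →
    ContDiff ℝ n (trigSeries a b) := by
  induction n with
  | zero =>
    intro a b ha hb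
    exact contDiff_zero.2 (Differentiable.continuous fun θ =>
      (hasDerivAt_trigSeries ha hb θ).differentiableAt)
  | succ n ih =>
    intro a b ha hb
    rw [Nat.cast_succ, contDiff_succ_iff_deriv]
    refine ⟨fun θ => (hasDerivAt_trigSeries ha hb θ).differentiableAt, by simp, ?_⟩
    rw [funext fun θ => (hasDerivAt_trigSeries ha hb θ).deriv]
    exact ih (hb.mul _) (ha.mul _).neg

theorem contDiff_trigSeries {a b : ℕ → E} (ha : Rapid a) (hb : Rapid b) :
    ContDiff ℝ ∞ (trigSeries a b) :=
  contDiff_infty.2 fun n => contDiff_trigSeries_nat n ha hb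

/-- Integration of a trigonometric series against a bounded continuous family of linear maps. -/
theorem integral_trigSeries {F : Type*} [NormedAddCommGroup F] [NormedSpace ℝ F]
    [CompleteSpace F] {a b : ℕ → E} (ha : Rapid a) (hb : Rapid b)
    (T : ℝ → E →L[ℝ] F) (hT : Continuous T) :
    HasSum (fun k : ℕ => ∫ s in (0 : ℝ)..1, T s ((2 * Real.cos (2 * Real.pi * (k + 1 : ℕ) * s)) • a k +
      (2 * Real.sin (2 * Real.pi * (k + 1 : ℕ) * s)) • b k))
      (∫ s in (0 : ℝ)..1, T s (trigSeries a b s)) := by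
  obtain ⟨C, hC⟩ := isCompact_Icc.exists_bound_of_continuousOn (s := Icc (0 : ℝ) 1) hT.continuousOn
  refine intervalIntegral.hasSum_integral_of_dominated_convergence
    (fun k _ => C * (2 * ‖a k‖ + 2 * ‖b k‖)) (fun k => ?_) (fun k => ?_) ?_ ?_ ?_
  · exact (Continuous.aestronglyMeasurable (by fun_prop))
  · refine Filter.Eventually.of_forall fun s hs => ?_
    rw [uIoc_of_le zero_le_one] at hs
    have h1 := hC s ⟨hs.1.le, hs.2⟩
    refine ((T s).le_opNorm _).trans ?_
    exact mul_le_mul h1 (trig_term_bound a b k s) (norm_nonneg _) ((norm_nonneg _).trans h1)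
  · exact Filter.Eventually.of_forall fun s _ => (trig_bound_summable ha hb).mul_left C
  · exact intervalIntegrable_const
  · refine Filter.Eventually.of_forall fun s _ => ?_
    exact (T s).hasSum (Summable.of_norm_bounded (trig_bound_summable ha hb)
      (fun k => trig_term_bound a b k s)).hasSum

theorem cosCoeff_trigSeries {a b : ℕ → E} (ha : Rapid a) (hb : Rapid b) (j : ℕ) :
    cosCoeff (j + 1) (trigSeries a b) = a j := by
  have h := integral_trigSeries ha hb (fun s => Real.cos (2 * Real.pi * (j + 1 : ℕ) * s) •
    ContinuousLinearMap.id ℝ E) (by fun_prop)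
  have e : ∀ k : ℕ, (∫ s in (0 : ℝ)..1, (Real.cos (2 * Real.pi * (j + 1 : ℕ) * s) •
      ContinuousLinearMap.id ℝ E) ((2 * Real.cos (2 * Real.pi * (k + 1 : ℕ) * s)) • a k +
      (2 * Real.sin (2 * Real.pi * (k + 1 : ℕ) * s)) • b k)) = if k = j then a j else 0 := by
    intro k
    simp only [smul_apply, ContinuousLinearMap.id_apply, smul_add, smul_smul]
    rw [intervalIntegral.integral_add (Continuous.intervalIntegrable (by fun_prop) _ _)
      (Continuous.intervalIntegrable (by fun_prop) _ _), intervalIntegral.integral_smul_const,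
      intervalIntegral.integral_smul_const, integral_cos_cos]
    have := integral_sin_cos k j
    rw [show (∫ s in (0 : ℝ)..1, Real.cos (2 * Real.pi * (j + 1 : ℕ) * s) *
      (2 * Real.sin (2 * Real.pi * (k + 1 : ℕ) * s))) = 0 by
        rw [← this]; congr 1; funext s; ring]
    by_cases hjk : j = k
    · subst hjk; simp
    · simp [hjk, Ne.symm hjk]
  have h2 := h.unique (by simpa only [e] using hasSum_ite_eq j (a j))
  exact h2

theorem sinCoeff_trigSeries {a b : ℕ → E} (ha : Rapid a) (hb : Rapid b) (j : ℕ) :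
    sinCoeff (j + 1) (trigSeries a b) = b j := by
  have h := integral_trigSeries ha hb (fun s => Real.sin (2 * Real.pi * (j + 1 : ℕ) * s) •
    ContinuousLinearMap.id ℝ E) (by fun_prop)
  have e : ∀ k : ℕ, (∫ s in (0 : ℝ)..1, (Real.sin (2 * Real.pi * (j + 1 : ℕ) * s) •
      ContinuousLinearMap.id ℝ E) ((2 * Real.cos (2 * Real.pi * (k + 1 : ℕ) * s)) • a k +
      (2 * Real.sin (2 * Real.pi * (k + 1 : ℕ) * s)) • b k)) = if k = j then b j else 0 := by
    intro k
    simp only [smul_apply, ContinuousLinearMap.id_apply, smul_add, smul_smul]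
    rw [intervalIntegral.integral_add (Continuous.intervalIntegrable (by fun_prop) _ _)
      (Continuous.intervalIntegrable (by fun_prop) _ _), intervalIntegral.integral_smul_const,
      intervalIntegral.integral_smul_const, integral_sin_sin, integral_sin_cos]
    by_cases hjk : j = k
    · subst hjk; simp
    · simp [hjk, Ne.symm hjk]
  have h2 := h.unique (by simpa only [e] using hasSum_ite_eq j (b j))
  exact h2

theorem integral_trigSeries_eq_zero {a b : ℕ → E} (ha : Rapid a) (hb : Rapid b) :
    ∫ s in (0 : ℝ)..1, trigSeries a b s = 0 := by
  have h := integral_trigSeries ha hb (fun _ => ContinuousLinearMap.id ℝ E) continuous_const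
  have e : ∀ k : ℕ, (∫ s in (0 : ℝ)..1, (ContinuousLinearMap.id ℝ E)
      ((2 * Real.cos (2 * Real.pi * (k + 1 : ℕ) * s)) • a k +
      (2 * Real.sin (2 * Real.pi * (k + 1 : ℕ) * s)) • b k)) = 0 := by
    intro k
    simp only [ContinuousLinearMap.id_apply]
    rw [intervalIntegral.integral_add (Continuous.intervalIntegrable (by fun_prop) _ _)
      (Continuous.intervalIntegrable (by fun_prop) _ _), intervalIntegral.integral_smul_const,
      intervalIntegral.integral_smul_const, intervalIntegral.integral_const_mul,
      intervalIntegral.integral_const_mul]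
    have h1 := integral_cos_int (k + 1)
    have h2 := integral_sin_int (k + 1)
    rw [if_neg (by omega)] at h1
    push_cast at h1 h2 ⊢
    rw [h1, h2]
    simp
  exact h.unique (by simpa only [e] using hasSum_zero)

end
end BiLoop

namespace BiLoop
noncomputable section
open scoped ContDiff InnerProductSpace
open Set MeasureTheory intervalIntegral
variable {E : Type*} [NormedAddCommGroup E] [InnerProductSpace ℝ E]

/-- Smooth `1`-periodic functions, i.e. smooth loops. -/
def SmoothLoop (f : ℝ → E) : Prop := ContDiff ℝ ∞ f ∧ Function.Periodic f 1

theorem SmoothLoop.deriv {f : ℝ → E} (h : SmoothLoop f) : SmoothLoop (deriv f) := by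
  refine ⟨((contDiff_infty_iff_deriv).1 h.1).2, fun x => ?_⟩
  rw [← deriv_comp_add_const]
  congr 1
  exact funext h.2

theorem SmoothLoop.continuous {f : ℝ → E} (h : SmoothLoop f) : Continuous f := h.1.continuous

theorem SmoothLoop.hasDerivAt {f : ℝ → E} (h : SmoothLoop f) (x : ℝ) :
    HasDerivAt f (_root_.deriv f x) x :=
  ((contDiff_infty_iff_deriv).1 h.1).1.differentiableAt.hasDerivAt

theorem cosCoeff_add {f g : ℝ → E} (hf : Continuous f) (hg : Continuous g) (k : ℕ) :
    cosCoeff k (f + g) = cosCoeff k f + cosCoeff k g := by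
  unfold cosCoeff
  rw [← intervalIntegral.integral_add (Continuous.intervalIntegrable (by fun_prop) _ _)
    (Continuous.intervalIntegrable (by fun_prop) _ _)]
  simp only [Pi.add_apply, smul_add]

theorem sinCoeff_add {f g : ℝ → E} (hf : Continuous f) (hg : Continuous g) (k : ℕ) :
    sinCoeff k (f + g) = sinCoeff k f + sinCoeff k g := by
  unfold sinCoeff
  rw [← intervalIntegral.integral_add (Continuous.intervalIntegrable (by fun_prop) _ _)
    (Continuous.intervalIntegrable (by fun_prop) _ _)]
  simp only [Pi.add_apply, smul_add]

theorem cosCoeff_smul (c : ℝ) (f : ℝ → E) (k : ℕ) : cosCoeff k (c • f) = c • cosCoeff k f := by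
  unfold cosCoeff
  rw [← intervalIntegral.integral_smul]
  simp only [Pi.smul_apply, smul_comm c]

theorem sinCoeff_smul (c : ℝ) (f : ℝ → E) (k : ℕ) : sinCoeff k (c • f) = c • sinCoeff k f := by
  unfold sinCoeff
  rw [← intervalIntegral.integral_smul]
  simp only [Pi.smul_apply, smul_comm c]

theorem hasDerivAt_cosk (k : ℕ) (x : ℝ) : HasDerivAt (fun s : ℝ => Real.cos (2 * Real.pi * k * s))
    (-(2 * Real.pi * k) * Real.sin (2 * Real.pi * k * x)) x := by
  have h1 : HasDerivAt (fun y : ℝ => 2 * Real.pi * k * y) (2 * Real.pi * k) x := by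
    simpa using (hasDerivAt_id x).const_mul (2 * Real.pi * k)
  convert h1.cos using 1
  ring

theorem hasDerivAt_sink (k : ℕ) (x : ℝ) : HasDerivAt (fun s : ℝ => Real.sin (2 * Real.pi * k * s))
    ((2 * Real.pi * k) * Real.cos (2 * Real.pi * k * x)) x := by
  have h1 : HasDerivAt (fun y : ℝ => 2 * Real.pi * k * y) (2 * Real.pi * k) x := by
    simpa using (hasDerivAt_id x).const_mul (2 * Real.pi * k)
  convert h1.sin using 1
  ring

theorem summable_of_bound {E : Type*} [NormedAddCommGroup E] {a : ℕ → E} (h : ∀ m : ℕ, ∃ C : ℝ, ∀ k : ℕ,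
    ((k + 1 : ℕ) : ℝ) ^ m * ‖a k‖ ≤ C) : Rapid a := by
  intro m
  obtain ⟨C, hC⟩ := h (m + 2)
  have hs : Summable fun k : ℕ => C * (1 / ((k + 1 : ℕ) : ℝ) ^ 2) :=
    ((summable_nat_add_iff 1).2 (Real.summable_one_div_nat_pow.2 one_lt_two)).mul_left C
  refine Summable.of_nonneg_of_le (fun k => by positivity) (fun k => ?_) hs
  have hk : (0 : ℝ) < ((k + 1 : ℕ) : ℝ) ^ 2 := by positivity
  rw [mul_one_div, le_div_iff₀ hk]
  calc _ = ((k + 1 : ℕ) : ℝ) ^ (m + 2) * ‖a k‖ := by ring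
    _ ≤ C := hC k

section complete
variable [CompleteSpace E]

theorem cosCoeff_deriv {f : ℝ → E} (hf : SmoothLoop f) (k : ℕ) :
    cosCoeff k (deriv f) = (2 * Real.pi * k) • sinCoeff k f := by
  have h := integral_smul_deriv_eq_deriv_smul (a := 0) (b := 1)
    (fun x _ => hasDerivAt_cosk k x) (fun x _ => hf.hasDerivAt x)
    (Continuous.intervalIntegrable (by fun_prop) _ _)
    (Continuous.intervalIntegrable hf.deriv.continuous _ _)
  have h1 : f 1 = f 0 := by simpa using hf.2 0
  have h2 := cos_period k 0
  rw [zero_add] at h2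
  rw [h1, h2, sub_self, zero_sub] at h
  unfold cosCoeff sinCoeff
  rw [h, ← intervalIntegral.integral_neg, ← intervalIntegral.integral_smul]
  congr 1
  funext s
  rw [smul_smul, ← neg_smul]
  congr 1
  ring

theorem sinCoeff_deriv {f : ℝ → E} (hf : SmoothLoop f) (k : ℕ) :
    sinCoeff k (deriv f) = -((2 * Real.pi * k) • cosCoeff k f) := by
  have h := integral_smul_deriv_eq_deriv_smul (a := 0) (b := 1)
    (fun x _ => hasDerivAt_sink k x) (fun x _ => hf.hasDerivAt x)
    (Continuous.intervalIntegrable (by fun_prop) _ _)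
    (Continuous.intervalIntegrable hf.deriv.continuous _ _)
  have h1 : f 1 = f 0 := by simpa using hf.2 0
  have h2 := sin_period k 0
  rw [zero_add] at h2
  rw [h1, h2, sub_self, zero_sub] at h
  unfold cosCoeff sinCoeff
  rw [h, ← intervalIntegral.integral_smul]
  congr 2
  funext s
  rw [smul_smul]

theorem coeff_bound (m : ℕ) : ∀ {f : ℝ → E}, SmoothLoop f → ∃ C : ℝ, ∀ k : ℕ,
    ((k + 1 : ℕ) : ℝ) ^ m * ‖cosCoeff (k + 1) f‖ ≤ C ∧
    ((k + 1 : ℕ) : ℝ) ^ m * ‖sinCoeff (k + 1) f‖ ≤ C := by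
  induction m with
  | zero =>
    intro f hf
    obtain ⟨C, hC⟩ := isCompact_Icc.exists_bound_of_continuousOn (s := Icc (0 : ℝ) 1)
      hf.continuous.continuousOn
    refine ⟨C, fun k => ?_⟩
    simp only [pow_zero, one_mul]
    have key : ∀ c : ℝ → ℝ, (∀ s, ‖c s‖ ≤ 1) → ‖∫ s in (0 : ℝ)..1, c s • f s‖ ≤ C := by
      intro c hc
      refine (intervalIntegral.norm_integral_le_of_norm_le_const (C := C) fun s hs => ?_).trans_eq
        (by simp)
      rw [uIoc_of_le zero_le_one] at hs
      rw [norm_smul]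
      have h1 := hC s ⟨hs.1.le, hs.2⟩
      have h2 := hc s
      nlinarith [norm_nonneg (f s), norm_nonneg (c s)]
    exact ⟨key _ fun s => Real.abs_cos_le_one _, key _ fun s => Real.abs_sin_le_one _⟩
  | succ m ih =>
    intro f hf
    obtain ⟨C, hC⟩ := ih hf.deriv
    refine ⟨C, fun k => ?_⟩
    have h1 := (hC k).1
    have h2 := (hC k).2
    rw [cosCoeff_deriv hf] at h1
    rw [sinCoeff_deriv hf, norm_neg] at h2
    rw [norm_smul, Real.norm_of_nonneg (by positivity)] at h1 h2
    have hp : (1 : ℝ) ≤ 2 * Real.pi := by linarith [Real.pi_gt_three]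
    constructor
    · refine le_trans ?_ h2
      have : 0 ≤ ((k + 1 : ℕ) : ℝ) ^ (m + 1) * ‖cosCoeff (k + 1) f‖ := by positivity
      calc _ ≤ (2 * Real.pi) * (((k + 1 : ℕ) : ℝ) ^ (m + 1) * ‖cosCoeff (k + 1) f‖) := by
            nlinarith
        _ = _ := by ring
    · refine le_trans ?_ h1
      have : 0 ≤ ((k + 1 : ℕ) : ℝ) ^ (m + 1) * ‖sinCoeff (k + 1) f‖ := by positivity
      calc _ ≤ (2 * Real.pi) * (((k + 1 : ℕ) : ℝ) ^ (m + 1) * ‖sinCoeff (k + 1) f‖) := by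
            nlinarith
        _ = _ := by ring

theorem rapid_cosCoeff {f : ℝ → E} (hf : SmoothLoop f) : Rapid fun k => cosCoeff (k + 1) f :=
  summable_of_bound fun m => (coeff_bound m hf).imp fun _ hC k => (hC k).1

theorem rapid_sinCoeff {f : ℝ → E} (hf : SmoothLoop f) : Rapid fun k => sinCoeff (k + 1) f :=
  summable_of_bound fun m => (coeff_bound m hf).imp fun _ hC k => (hC k).2

/-- A continuous loop with vanishing Fourier coefficients vanishes. -/
theorem eq_zero_of_coeff {f : ℝ → E} (hc : Continuous f) (hp : Function.Periodic f 1)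
    (h0 : ∫ s in (0 : ℝ)..1, f s = 0) (hA : ∀ k, cosCoeff (k + 1) f = 0)
    (hB : ∀ k, sinCoeff (k + 1) f = 0) : f = 0 := by
  funext x
  refine ext_inner_left ℝ fun v => ?_
  rw [Pi.zero_apply, inner_zero_right]
  have hg : Continuous fun s => ((inner ℝ v (f s) : ℝ) : ℂ) := by fun_prop
  have hgp : Function.Periodic (fun s => ((inner ℝ v (f s) : ℝ) : ℂ)) 1 := fun s => by
    simp only [hp s]
  let F : C(AddCircle (1 : ℝ), ℂ) := ⟨hgp.lift, continuous_coinduced_dom.2 hg⟩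
  have : Fact (0 < (1 : ℝ)) := ⟨one_pos⟩
  have key : ∀ c : ℝ → ℝ, Continuous c → ∫ s in (0 : ℝ)..1, ((c s : ℝ) : ℂ) *
      ((inner ℝ v (f s) : ℝ) : ℂ) = ((inner ℝ v (∫ s in (0 : ℝ)..1, c s • f s) : ℝ) : ℂ) := by
    intro c hc'
    have h1 := (innerSL ℝ v).intervalIntegral_comp_comm
      (Continuous.intervalIntegrable (μ := volume) (hc'.smul hc) 0 1)
    simp only [innerSL_apply_apply, Pi.smul_apply'] at h1
    rw [← h1, ← intervalIntegral.integral_ofReal]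
    congr 1
    funext s
    simp [inner_smul_right]
  have hcos : ∀ n : ℕ, ∫ s in (0 : ℝ)..1, ((Real.cos (2 * Real.pi * n * s) : ℝ) : ℂ) *
      ((inner ℝ v (f s) : ℝ) : ℂ) = 0 := by
    intro n
    rw [key _ (by fun_prop)]
    rcases n with _ | n
    · simp [h0]
    · have := hA n
      unfold cosCoeff at this
      rw [this]; simp
  have hsin : ∀ n : ℕ, ∫ s in (0 : ℝ)..1, ((Real.sin (2 * Real.pi * n * s) : ℝ) : ℂ) *
      ((inner ℝ v (f s) : ℝ) : ℂ) = 0 := by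
    intro n
    rw [key _ (by fun_prop)]
    rcases n with _ | n
    · simp
    · have := hB n
      unfold sinCoeff at this
      rw [this]; simp
  have hF : ∀ n : ℤ, fourierCoeff F n = 0 := by
    intro n
    rw [fourierCoeff_eq_intervalIntegral _ n 0]
    have e : ∀ s : ℝ, fourier (T := 1) (-n) (s : AddCircle (1 : ℝ)) • F s =
        ((Real.cos (2 * Real.pi * n.natAbs * s) : ℝ) : ℂ) * ((inner ℝ v (f s) : ℝ) : ℂ) -
        (n.sign : ℂ) * Complex.I * (((Real.sin (2 * Real.pi * n.natAbs * s) : ℝ) : ℂ) *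
          ((inner ℝ v (f s) : ℝ) : ℂ)) := by
      intro s
      have e1 : F s = ((inner ℝ v (f s) : ℝ) : ℂ) := rfl
      rw [e1, fourier_coe_apply, smul_eq_mul]
      have e2 : (2 * Real.pi * Complex.I * ((-n : ℤ) : ℂ) * s / ((1 : ℝ) : ℂ)) =
          ((-(2 * Real.pi * n * s) : ℝ) : ℂ) * Complex.I := by push_cast; ring
      rw [e2, Complex.exp_mul_I, ← Complex.ofReal_cos, ← Complex.ofReal_sin, Real.cos_neg,
        Real.sin_neg]
      rcases lt_trichotomy n 0 with h | h | h
      · have : (n.natAbs : ℝ) = -n := by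
          rw [← Int.cast_natCast, Int.ofNat_natAbs_of_nonpos h.le]; push_cast; rfl
        rw [this, Int.sign_eq_neg_one_of_neg h,
          show 2 * Real.pi * (-n : ℝ) * s = -(2 * Real.pi * n * s) by ring, Real.cos_neg,
          Real.sin_neg]
        push_cast; ring
      · subst h; simp
      · have : (n.natAbs : ℝ) = n := by
          rw [← Int.cast_natCast, Int.natAbs_of_nonneg h.le]
        rw [this, Int.sign_eq_one_of_pos h]
        push_cast; ring
    simp only [e, zero_add]
    rw [intervalIntegral.integral_sub (Continuous.intervalIntegrable (by fun_prop) _ _)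
      (Continuous.intervalIntegrable (by fun_prop) _ _), intervalIntegral.integral_const_mul,
      hcos, hsin]
    simp
  have hs := has_pointwise_sum_fourier_series_of_summable (f := F)
    (by rw [funext hF]; exact summable_zero) (x : AddCircle (1 : ℝ))
  simp only [hF, zero_smul] at hs
  have h2 : ((inner ℝ v (f x) : ℝ) : ℂ) = 0 := hs.unique hasSum_zero
  exact_mod_cast h2

end complete

end
end BiLoop

namespace BiLoop
noncomputable section
open scoped ContDiff InnerProductSpace
open Set MeasureTheory intervalIntegral
variable (E : Type*) [NormedAddCommGroup E] [InnerProductSpace ℝ E]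

/-- The real vector space `V𝔥` of smooth loops in `E` with average zero. -/
def loopSubmodule : Submodule ℝ (ℝ → E) where
  carrier := {f | SmoothLoop f ∧ ∫ s in (0 : ℝ)..1, f s = 0}
  zero_mem' := ⟨⟨contDiff_const, fun _ => rfl⟩, by simp⟩
  add_mem' := by
    rintro f g ⟨hf, hf0⟩ ⟨hg, hg0⟩
    refine ⟨⟨hf.1.add hg.1, hf.2.add hg.2⟩, ?_⟩
    simp only [Pi.add_apply]
    rw [intervalIntegral.integral_add (hf.continuous.intervalIntegrable _ _)
      (hg.continuous.intervalIntegrable _ _), hf0, hg0, add_zero]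
  smul_mem' := by
    rintro c f ⟨hf, hf0⟩
    refine ⟨⟨hf.1.const_smul c, fun x => by simp only [Pi.smul_apply, hf.2 x]⟩, ?_⟩
    simp only [Pi.smul_apply]
    rw [intervalIntegral.integral_smul, hf0, smul_zero]

/-- The space `V𝔥` of smooth loops with average zero, which below is given its complex structure
and its Hermitian inner product. -/
def MeanZeroLoop : Type _ := loopSubmodule E

instance : AddCommGroup (MeanZeroLoop E) := inferInstanceAs (AddCommGroup (loopSubmodule E))

variable {E}

namespace MeanZeroLoop

/-- The underlying function. -/
def fn (f : MeanZeroLoop E) : ℝ → E := f.1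

theorem smooth (f : MeanZeroLoop E) : SmoothLoop f.fn := f.2.1

theorem mean (f : MeanZeroLoop E) : ∫ s in (0 : ℝ)..1, f.fn s = 0 := f.2.2

theorem ext {f g : MeanZeroLoop E} (h : f.fn = g.fn) : f = g := Subtype.ext h

@[simp] theorem fn_add (f g : MeanZeroLoop E) : (f + g).fn = f.fn + g.fn := rfl
@[simp] theorem fn_neg (f : MeanZeroLoop E) : (-f).fn = -f.fn := rfl
@[simp] theorem fn_zero : (0 : MeanZeroLoop E).fn = 0 := rfl

/-- Multiplication of a loop by a real number. -/
def rsmul (c : ℝ) (f : MeanZeroLoop E) : MeanZeroLoop E := ⟨c • f.1, (loopSubmodule E).smul_mem c f.2⟩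

@[simp] theorem fn_rsmul (c : ℝ) (f : MeanZeroLoop E) : (rsmul c f).fn = c • f.fn := rfl

/-- Cosine coefficient of order `k + 1`. -/
def A (f : MeanZeroLoop E) (k : ℕ) : E := cosCoeff (k + 1) f.fn

/-- Sine coefficient of order `k + 1`. -/
def B (f : MeanZeroLoop E) (k : ℕ) : E := sinCoeff (k + 1) f.fn

theorem A_add (f g : MeanZeroLoop E) (k : ℕ) : (f + g).A k = f.A k + g.A k :=
  cosCoeff_add f.smooth.continuous g.smooth.continuous _
theorem B_add (f g : MeanZeroLoop E) (k : ℕ) : (f + g).B k = f.B k + g.B k :=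
  sinCoeff_add f.smooth.continuous g.smooth.continuous _
theorem A_rsmul (c : ℝ) (f : MeanZeroLoop E) (k : ℕ) : (rsmul c f).A k = c • f.A k :=
  cosCoeff_smul c f.fn _
theorem B_rsmul (c : ℝ) (f : MeanZeroLoop E) (k : ℕ) : (rsmul c f).B k = c • f.B k :=
  sinCoeff_smul c f.fn _
theorem A_neg (f : MeanZeroLoop E) (k : ℕ) : (-f).A k = -f.A k := by
  have : -f = rsmul (-1) f := ext (by simp)
  rw [this, A_rsmul, neg_one_smul]
theorem B_neg (f : MeanZeroLoop E) (k : ℕ) : (-f).B k = -f.B k := by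
  have : -f = rsmul (-1) f := ext (by simp)
  rw [this, B_rsmul, neg_one_smul]

variable [CompleteSpace E]

theorem ext_coeff {f g : MeanZeroLoop E} (hA : ∀ k, f.A k = g.A k) (hB : ∀ k, f.B k = g.B k) :
    f = g := by
  rw [← sub_eq_zero, sub_eq_add_neg]
  set d := f + -g with hd
  have h1 : d.fn = 0 := eq_zero_of_coeff d.smooth.continuous d.smooth.2 d.mean
    (fun k => by
      change d.A k = 0
      rw [hd, A_add, A_neg, hA, add_neg_cancel])
    (fun k => by
      change d.B k = 0
      rw [hd, B_add, B_neg, hB, add_neg_cancel])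
  exact ext h1

/-- The operator `J` on loops with average zero, which multiplies the Fourier mode `e^{2πikθ}` by
`i` if `k > 0` and by `-i` if `k < 0`: it sends the loop with cosine and sine coefficients
`(A_k, B_k)` to the one with coefficients `(B_k, -A_k)`. -/
def J (f : MeanZeroLoop E) : MeanZeroLoop E :=
  ⟨trigSeries (fun k => f.B k) (fun k => -f.A k),
    ⟨contDiff_trigSeries (rapid_sinCoeff f.smooth) (rapid_cosCoeff f.smooth).neg,
      periodic_trigSeries _ _⟩,
    integral_trigSeries_eq_zero (rapid_sinCoeff f.smooth) (rapid_cosCoeff f.smooth).neg⟩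

@[simp] theorem A_J (f : MeanZeroLoop E) (k : ℕ) : f.J.A k = f.B k :=
  cosCoeff_trigSeries (rapid_sinCoeff f.smooth) (rapid_cosCoeff f.smooth).neg k
@[simp] theorem B_J (f : MeanZeroLoop E) (k : ℕ) : f.J.B k = -f.A k :=
  sinCoeff_trigSeries (rapid_sinCoeff f.smooth) (rapid_cosCoeff f.smooth).neg k

theorem J_J (f : MeanZeroLoop E) : f.J.J = -f :=
  ext_coeff (fun k => by simp [A_neg]) (fun k => by simp [B_neg])
theorem J_add (f g : MeanZeroLoop E) : (f + g).J = f.J + g.J :=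
  ext_coeff (fun k => by simp [A_add, B_add]) (fun k => by rw [B_add, B_J, B_J, B_J, A_add, neg_add])
theorem J_rsmul (c : ℝ) (f : MeanZeroLoop E) : (rsmul c f).J = rsmul c f.J :=
  ext_coeff (fun k => by simp [A_rsmul, B_rsmul]) (fun k => by simp [A_rsmul, B_rsmul])

theorem fn_eq_trigSeries (f : MeanZeroLoop E) : f.fn = trigSeries f.A f.B := by
  have h : f.J.J = -f := J_J f
  have h2 : f = f.J.J.J.J := by rw [J_J (f.J.J), J_J, neg_neg]
  have h3 : f.fn = trigSeries (fun k => f.J.J.J.B k) (fun k => - f.J.J.J.A k) := by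
    conv_lhs => rw [h2]
    rfl
  rw [h3]
  congr 1
  · funext k; simp
  · funext k; simp

/-- The skew form `S(f, g) = ½ ∫₀¹ ⟨f', g⟩`. -/
def S (f g : MeanZeroLoop E) : ℝ := (1 / 2) * ∫ s in (0 : ℝ)..1, inner ℝ (deriv f.fn s) (g.fn s)

/-- The Fourier expansion of the skew form. -/
theorem hasSum_S (f g : MeanZeroLoop E) :
    HasSum (fun k : ℕ => 2 * Real.pi * (k + 1 : ℕ) *
      (inner ℝ (f.B k) (g.A k) - inner ℝ (f.A k) (g.B k))) (S f g) := by
  have h := (integral_trigSeries (rapid_cosCoeff g.smooth) (rapid_sinCoeff g.smooth)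
    (fun s => innerSL ℝ (deriv f.fn s))
    ((innerSL ℝ).continuous.comp f.smooth.deriv.continuous)).mul_left (1 / 2)
  have hfc := f.smooth.deriv.continuous
  have e0 : (1 / 2) * ∫ s in (0 : ℝ)..1, innerSL ℝ (deriv f.fn s)
      (trigSeries (fun k => cosCoeff (k + 1) g.fn) (fun k => sinCoeff (k + 1) g.fn) s) = S f g := by
    unfold S
    conv_rhs => rw [fn_eq_trigSeries g]
    rfl
  rw [e0] at h
  refine Eq.mp (congrArg (fun F => HasSum F _) (funext fun k => ?_)) h
  have key : ∀ (c : ℝ → ℝ) (v : E), Continuous c → ∫ s in (0 : ℝ)..1,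
      inner ℝ (deriv f.fn s) ((2 * c s) • v) =
      2 * inner ℝ (∫ s in (0 : ℝ)..1, c s • deriv f.fn s) v := by
    intro c v hc
    have h1 := (innerSL ℝ v).intervalIntegral_comp_comm
      (Continuous.intervalIntegrable (μ := volume) (hc.smul hfc) 0 1)
    simp only [innerSL_apply_apply, Pi.smul_apply'] at h1
    rw [real_inner_comm, ← h1, ← intervalIntegral.integral_const_mul]
    congr 1
    funext s
    rw [inner_smul_right, inner_smul_right, real_inner_comm]
    ring
  simp only [innerSL_apply_apply, inner_add_right]
  rw [intervalIntegral.integral_add (Continuous.intervalIntegrable (by fun_prop) _ _)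
      (Continuous.intervalIntegrable (by fun_prop) _ _), key _ _ (by fun_prop),
      key _ _ (by fun_prop)]
  have h1 := cosCoeff_deriv f.smooth (k + 1)
  have h2 := sinCoeff_deriv f.smooth (k + 1)
  unfold cosCoeff at h1
  unfold sinCoeff at h2
  rw [h1, h2]
  change 1 / 2 * (2 * inner ℝ ((2 * Real.pi * ((k + 1 : ℕ) : ℝ)) • f.B k) (g.A k) +
    2 * inner ℝ (-((2 * Real.pi * ((k + 1 : ℕ) : ℝ)) • f.A k)) (g.B k)) = _
  rw [inner_neg_left, inner_smul_left, inner_smul_left]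
  simp only [conj_trivial]
  ring

theorem S_of {f g : MeanZeroLoop E} {F : ℕ → ℝ} {x : ℝ} (h : HasSum F x)
    (e : ∀ k : ℕ, F k = 2 * Real.pi * (k + 1 : ℕ) *
      (inner ℝ (f.B k) (g.A k) - inner ℝ (f.A k) (g.B k))) : S f g = x :=
  (hasSum_S f g).unique ((funext e : F = _) ▸ h)

theorem S_add_left (f g h : MeanZeroLoop E) : S (f + g) h = S f h + S g h :=
  S_of ((hasSum_S f h).add (hasSum_S g h)) fun k => by
    simp only [A_add, B_add, inner_add_left]; ring

theorem S_rsmul_left (c : ℝ) (f g : MeanZeroLoop E) : S (rsmul c f) g = c * S f g :=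
  S_of ((hasSum_S f g).mul_left c) fun k => by
    simp only [A_rsmul, B_rsmul, inner_smul_left, conj_trivial]; ring

theorem S_symm (f g : MeanZeroLoop E) : S g f = - S f g :=
  S_of (hasSum_S f g).neg fun k => by
    rw [real_inner_comm (g.A k), real_inner_comm (g.B k)]; ring

theorem S_J_J (f g : MeanZeroLoop E) : S f.J g.J = S f g :=
  S_of (hasSum_S f g) fun k => by
    simp only [A_J, B_J, inner_neg_left, inner_neg_right]; ring

theorem S_self_J_nonneg (f : MeanZeroLoop E) : 0 ≤ S f f.J := by
  refine (hasSum_S f f.J).nonneg fun k => ?_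
  simp only [A_J, B_J, inner_neg_right, sub_neg_eq_add]
  have h1 : 0 ≤ inner ℝ (f.B k) (f.B k) := real_inner_self_nonneg
  have h2 : 0 ≤ inner ℝ (f.A k) (f.A k) := real_inner_self_nonneg
  have := Real.pi_pos
  positivity

theorem S_neg_left (f g : MeanZeroLoop E) : S (-f) g = - S f g := by
  have : -f = rsmul (-1) f := ext (by simp)
  rw [this, S_rsmul_left]; ring

theorem S_neg_right (f g : MeanZeroLoop E) : S f (-g) = - S f g := by
  rw [S_symm (-g), S_neg_left, S_symm g]

theorem S_J_left (f g : MeanZeroLoop E) : S f.J g = - S f g.J := by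
  rw [← S_J_J f.J g, J_J, S_neg_left]

/-- The complex structure: the imaginary unit acts as `-J`. -/
instance : SMul ℂ (MeanZeroLoop E) := ⟨fun z f => rsmul z.re f + rsmul (-z.im) f.J⟩

theorem csmul_def (z : ℂ) (f : MeanZeroLoop E) : z • f = rsmul z.re f + rsmul (-z.im) f.J := rfl

instance : Module ℂ (MeanZeroLoop E) where
  one_smul f := ext (by simp [csmul_def])
  mul_smul z w f := by
    have h1 : ∀ (c : ℝ) (f g : MeanZeroLoop E), rsmul c (f + g) = rsmul c f + rsmul c g :=
      fun c f g => ext (by simp)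
    have h2 : ∀ (c d : ℝ) (f : MeanZeroLoop E), rsmul c (rsmul d f) = rsmul (c * d) f :=
      fun c d f => ext (by simp [mul_smul])
    have h3 : ∀ (c d : ℝ) (f : MeanZeroLoop E), rsmul (c + d) f = rsmul c f + rsmul d f :=
      fun c d f => ext (by simp [add_smul])
    have h4 : ∀ (c : ℝ) (f : MeanZeroLoop E), rsmul c (-f) = rsmul (-c) f :=
      fun c f => ext (by simp)
    simp only [csmul_def, J_add, J_rsmul, J_J, h1, h2, h4, neg_neg, Complex.mul_re, Complex.mul_im]
    rw [sub_eq_add_neg, h3, neg_add, h3,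
      show -(z.im * w.im) = -z.im * w.im by ring, show -(z.im * w.re) = -z.im * w.re by ring,
      show -(z.re * w.im) = z.re * -w.im by ring]
    generalize rsmul (z.re * w.re) f = a
    generalize rsmul (-z.im * w.im) f = b
    generalize rsmul (z.re * -w.im) f.J = c
    generalize rsmul (-z.im * w.re) f.J = d
    abel
  smul_zero z := by
    have : (0 : MeanZeroLoop E).J = 0 := by
      have h := J_add (0 : MeanZeroLoop E) 0
      rw [add_zero] at h
      exact left_eq_add.1 h
    exact ext (by simp [csmul_def, this])
  smul_add z f g := ext (by simp [csmul_def, J_add]; exact add_add_add_comm _ _ _ _)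
  add_smul z w f := ext (by simp [csmul_def, add_smul]; rw [add_comm (-(w.im • _))]; exact add_add_add_comm _ _ _ _)
  zero_smul f := ext (by simp [csmul_def])

/-- The Hermitian inner product, conjugate linear on the left:
`⟨f, g⟩ = 2π (S(f, Jg) - i S(f, g))`. -/
@[reducible] def core : PreInnerProductSpace.Core ℂ (MeanZeroLoop E) where
  inner f g := ⟨2 * Real.pi * S f g.J, -(2 * Real.pi * S f g)⟩
  conj_inner_symm f g := by
    apply Complex.ext
    · simp only [Complex.conj_re]
      rw [S_symm f.J g, S_J_left, neg_neg]
    · simp only [Complex.conj_im]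
      rw [S_symm f g]; ring
  re_inner_nonneg f := by
    have := S_self_J_nonneg f
    have := Real.pi_pos
    change 0 ≤ 2 * Real.pi * S f f.J
    positivity
  add_left f g h := by
    apply Complex.ext <;> simp only [S_add_left, Complex.add_re, Complex.add_im] <;> ring
  smul_left f g z := by
    apply Complex.ext <;> simp only [csmul_def, S_add_left, S_rsmul_left, S_J_left, J_J, S_neg_right,
      Complex.mul_re, Complex.mul_im, Complex.conj_re, Complex.conj_im] <;> ring

instance : SeminormedAddCommGroup (MeanZeroLoop E) :=
  @InnerProductSpace.Core.toSeminormedAddCommGroup ℂ (MeanZeroLoop E) _ _ _ core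

instance : InnerProductSpace ℂ (MeanZeroLoop E) := InnerProductSpace.ofCore core

theorem inner_im (f g : MeanZeroLoop E) : (inner ℂ g f : ℂ).im = 2 * Real.pi * S f g := by
  change -(2 * Real.pi * S g f) = _
  rw [S_symm f g]; ring

end MeanZeroLoop
end
end BiLoop

namespace BiLoop
noncomputable section
open scoped ContDiff InnerProductSpace Topology
open Set MeasureTheory intervalIntegral

instance (Λ : Type*) [AddCommGroup Λ] [EvenLattice Λ] : CompleteSpace (LieAlg Λ) :=
  FiniteDimensional.complete ℝ _

/-- The two points `p` and `q` of the circle that separate its halves. -/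
inductive Defect : Type
  | p
  | q

variable {Γ Λw Λb : Type*} [AddCommGroup Γ] [EvenLattice Γ] [AddCommGroup Λw] [EvenLattice Λw]
  [AddCommGroup Λb] [EvenLattice Λb]

/-- Triples of maps `(γ_w, γ_m, γ_b)`: the circle is parametrised by `[0,1]`, counterclockwise with
unit speed and starting at `q`. The right (black) half is `[0, 1/2]` and runs from `q` to `p`, the
left (white) half is `[1/2, 1]` and runs from `p` to `q`. -/
abbrev Triple (Γ Λw Λb : Type*) [AddCommGroup Γ] [AddCommGroup Λw] [AddCommGroup Λb] : Type _ :=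
  (Icc (1 / 2 : ℝ) 1 → Torus Λw) × (Defect → Torus Γ) × (Icc (0 : ℝ) (1 / 2) → Torus Λb)

/-- `ξ` is a smooth lift to `𝔥`, along `𝔥 ≅ 𝔱 → T`, of the path `γ` in the torus `T`. A path in `T`
is smooth exactly if it has such a lift, and the derivatives of order `k ≥ 1` of the lift are
the images of the derivatives of `γ` under `(ℝπ)⁻¹`. -/
structure IsLift {Λ : Type*} [AddCommGroup Λ] [EvenLattice Λ] (π : LatticeHom Γ Λ) {a b : ℝ}
    (γ : Icc a b → Torus Λ) (ξ : ℝ → LieAlg Γ) : Prop where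
  smooth : ContDiffOn ℝ ∞ ξ (Icc a b)
  exp : ∀ s : Icc a b, torusExp Λ (π.lie (ξ s)) = γ s

/-- The white and the black path are smooth and all their derivatives agree at `p` and `q`. -/
def DerivMatch (πw : LatticeHom Γ Λw) (πb : LatticeHom Γ Λb) (γ : Triple Γ Λw Λb) : Prop :=
  ∃ ξ η : ℝ → LieAlg Γ, IsLift πw γ.1 ξ ∧ IsLift πb γ.2.2 η ∧ ∀ k : ℕ, 1 ≤ k →
    iteratedDerivWithin k ξ (Icc (1 / 2) 1) (1 / 2) =
      iteratedDerivWithin k η (Icc 0 (1 / 2)) (1 / 2) ∧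
    iteratedDerivWithin k ξ (Icc (1 / 2) 1) 1 = iteratedDerivWithin k η (Icc 0 (1 / 2)) 0

theorem udb : UniqueDiffOn ℝ (Icc (0 : ℝ) (1 / 2)) := uniqueDiffOn_Icc (by norm_num)
theorem udw : UniqueDiffOn ℝ (Icc (1 / 2 : ℝ) 1) := uniqueDiffOn_Icc (by norm_num)
theorem half_mem_w : (1 / 2 : ℝ) ∈ Icc (1 / 2 : ℝ) 1 := by constructor <;> norm_num
theorem one_mem_w : (1 : ℝ) ∈ Icc (1 / 2 : ℝ) 1 := by constructor <;> norm_num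
theorem half_mem_b : (1 / 2 : ℝ) ∈ Icc (0 : ℝ) (1 / 2) := by constructor <;> norm_num
theorem zero_mem_b : (0 : ℝ) ∈ Icc (0 : ℝ) (1 / 2) := by constructor <;> norm_num

/-- The bicoloured torus loop group `L(T_w, H, T_b)`. -/
def bicolLoops (πw : LatticeHom Γ Λw) (πb : LatticeHom Γ Λb) : AddSubgroup (Triple Γ Λw Λb) where
  carrier := {γ |
    (πw.torus (γ.2.1 Defect.p) = γ.1 ⟨1 / 2, half_mem_w⟩ ∧
      πb.torus (γ.2.1 Defect.p) = γ.2.2 ⟨1 / 2, half_mem_b⟩) ∧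
    (πw.torus (γ.2.1 Defect.q) = γ.1 ⟨1, one_mem_w⟩ ∧
      πb.torus (γ.2.1 Defect.q) = γ.2.2 ⟨0, zero_mem_b⟩) ∧
    DerivMatch πw πb γ}
  zero_mem' := by
    refine ⟨⟨map_zero _, map_zero _⟩, ⟨map_zero _, map_zero _⟩, 0, 0,
      ⟨contDiffOn_const, fun s => ?_⟩, ⟨contDiffOn_const, fun s => ?_⟩, fun k hk => ?_⟩
    · simp
    · simp
    · simp
  add_mem' := by
    rintro γ ρ ⟨⟨h1, h2⟩, ⟨h3, h4⟩, ξ, η, hξ, hη, h5⟩ ⟨⟨g1, g2⟩, ⟨g3, g4⟩, ξ', η', hξ', hη', g5⟩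
    refine ⟨⟨?_, ?_⟩, ⟨?_, ?_⟩, ξ + ξ', η + η', ⟨hξ.1.add hξ'.1, fun s => ?_⟩,
      ⟨hη.1.add hη'.1, fun s => ?_⟩, fun k hk => ?_⟩
    · exact (map_add _ _ _).trans (congrArg₂ _ h1 g1)
    · exact (map_add _ _ _).trans (congrArg₂ _ h2 g2)
    · exact (map_add _ _ _).trans (congrArg₂ _ h3 g3)
    · exact (map_add _ _ _).trans (congrArg₂ _ h4 g4)
    · simp [hξ.2 s, hξ'.2 s]
    · simp [hη.2 s, hη'.2 s]
    · have c : ∀ {f : ℝ → LieAlg Γ} {s : Set ℝ} {x : ℝ}, ContDiffOn ℝ ∞ f s → x ∈ s →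
          ContDiffWithinAt ℝ k f s x := fun hf hx => (hf _ hx).of_le (by exact_mod_cast le_top)
      rw [iteratedDerivWithin_add half_mem_w udw (c hξ.1 half_mem_w) (c hξ'.1 half_mem_w),
        iteratedDerivWithin_add half_mem_b udb (c hη.1 half_mem_b) (c hη'.1 half_mem_b),
        iteratedDerivWithin_add one_mem_w udw (c hξ.1 one_mem_w) (c hξ'.1 one_mem_w),
        iteratedDerivWithin_add zero_mem_b udb (c hη.1 zero_mem_b) (c hη'.1 zero_mem_b),
        (h5 k hk).1, (h5 k hk).2, (g5 k hk).1, (g5 k hk).2]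
      exact ⟨rfl, rfl⟩
  neg_mem' := by
    rintro γ ⟨⟨h1, h2⟩, ⟨h3, h4⟩, ξ, η, hξ, hη, h5⟩
    refine ⟨⟨?_, ?_⟩, ⟨?_, ?_⟩, -ξ, -η, ⟨hξ.1.neg, fun s => ?_⟩,
      ⟨hη.1.neg, fun s => ?_⟩, fun k hk => ?_⟩
    · exact (map_neg _ _).trans (congrArg _ h1)
    · exact (map_neg _ _).trans (congrArg _ h2)
    · exact (map_neg _ _).trans (congrArg _ h3)
    · exact (map_neg _ _).trans (congrArg _ h4)
    · simp [hξ.2 s]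
    · simp [hη.2 s]
    · simp only [iteratedDerivWithin_neg, (h5 k hk).1, (h5 k hk).2, and_self]

/-- `(ℝπ)⁻¹(Λ) ⊆ 𝔥`. -/
def pullLattice {Λ : Type*} [AddCommGroup Λ] [EvenLattice Λ] (π : LatticeHom Γ Λ) :
    AddSubgroup (LieAlg Γ) :=
  (incl Λ).range.comap (π.lie.toLinearEquiv.toAddEquiv : LieAlg Γ →+ LieAlg Λ)

theorem mem_pullLattice {Λ : Type*} [AddCommGroup Λ] [EvenLattice Λ] (π : LatticeHom Γ Λ)
    (x : LieAlg Γ) : x ∈ pullLattice π ↔ torusExp Λ (π.lie x) = 0 := by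
  rw [torusExp_eq_zero_iff]; rfl

theorem countable_pullLattice {Λ : Type*} [AddCommGroup Λ] [EvenLattice Λ] (π : LatticeHom Γ Λ) :
    (pullLattice π : Set (LieAlg Γ)).Countable := by
  have := countable_lattice Λ
  have h : (range fun l : Λ => π.lie.symm (incl Λ l)).Countable := countable_range _
  refine h.mono ?_
  rintro x ⟨l, hl⟩
  exact ⟨l, by
    change incl Λ l = π.lie x at hl
    simp only [hl, LinearIsometryEquiv.symm_apply_apply]⟩

variable (πw : LatticeHom Γ Λw) (πb : LatticeHom Γ Λb)

/-- `Λ_w ∩ Λ_b ⊆ 𝔥`. -/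
def interLattice : AddSubgroup (LieAlg Γ) := pullLattice πw ⊓ pullLattice πb

/-- `Λ_w - Λ_b ⊆ 𝔥`, the group of all differences (equivalently, of all sums). -/
def diffLattice : AddSubgroup (LieAlg Γ) := pullLattice πw ⊔ pullLattice πb

/-- `(Λ_w ∩ Λ_b) / Γ`, as a subgroup of `H = 𝔥 / Γ`. -/
def interGroup : AddSubgroup (Torus Γ) := (interLattice πw πb).map (torusExp Γ)

theorem incl_mem {Λ : Type*} [AddCommGroup Λ] [EvenLattice Λ] (π : LatticeHom Γ Λ) (g : Γ) :
    incl Γ g ∈ pullLattice π := ⟨π.toHom g, π.lie_incl g⟩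

/-- The pairing of `Λ_w - Λ_b` with `Γ` is integral. -/
theorem inner_diff_incl {x : LieAlg Γ} (hx : x ∈ diffLattice πw πb) (g : Γ) :
    ∃ n : ℤ, inner ℝ x (incl Γ g) = n := by
  have key : ∀ {Λ : Type _} [AddCommGroup Λ] [EvenLattice Λ] (π : LatticeHom Γ Λ) (x : LieAlg Γ),
      x ∈ pullLattice π → ∃ n : ℤ, inner ℝ x (incl Γ g) = n := by
    rintro Λ _ _ π x ⟨l, hl⟩
    change incl Λ l = π.lie x at hl
    refine ⟨EvenLattice.form l (π.toHom g), ?_⟩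
    rw [← π.lie.inner_map_map, ← hl, π.lie_incl, inner_eq_realForm]
    change realForm Λ ((1 : ℝ) ⊗ₜ[ℤ] l) ((1 : ℝ) ⊗ₜ[ℤ] (π.toHom g)) = _
    rw [realForm_tmul]
    simp
  have key2 : ∀ {Λ : Type _} [AddCommGroup Λ] [EvenLattice Λ] (π : LatticeHom Γ Λ) (x : LieAlg Γ),
      x ∈ pullLattice π → ∃ n : ℤ, inner ℝ x (incl Γ g) = n := by
    rintro Λ _ _ π x ⟨l, hl⟩
    change incl Λ l = π.lie x at hl
    refine ⟨EvenLattice.form l (π.toHom g), ?_⟩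
    rw [← π.lie.inner_map_map, ← hl, π.lie_incl, inner_eq_realForm]
    change realForm Λ ((1 : ℝ) ⊗ₜ[ℤ] l) ((1 : ℝ) ⊗ₜ[ℤ] (π.toHom g)) = _
    rw [realForm_tmul]
    simp
  obtain ⟨y, hy, z, hz, rfl⟩ := AddSubgroup.mem_sup.1 hx
  obtain ⟨m, hm⟩ := key πw y hy
  obtain ⟨n, hn⟩ := key2 πb z hz
  exact ⟨m + n, by rw [inner_add_left, hm, hn]; push_cast; rfl⟩

variable {πw πb}

/-- `ξ : [0,1] → 𝔥` lifts the path `Pth γ : [0,1] → H`: the composition of `ξ` with the exponential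
map of `H` lifts `γ_w` and `γ_b` along `𝕋π_w` and `𝕋π_b` and has value `γ_m(p)` at `p`. -/
structure IsPathLift (γ : bicolLoops πw πb) (ξ : ℝ → LieAlg Γ) : Prop where
  smooth : ContDiffOn ℝ ∞ ξ (Icc 0 1)
  white : ∀ s : Icc (1 / 2 : ℝ) 1, πw.torus (torusExp Γ (ξ s)) = γ.1.1 s
  black : ∀ s : Icc (0 : ℝ) (1 / 2), πb.torus (torusExp Γ (ξ s)) = γ.1.2.2 s
  mid : torusExp Γ (ξ (1 / 2)) = γ.1.2.1 Defect.p

theorem exists_pathLift (γ : bicolLoops πw πb) : ∃ ξ, IsPathLift γ ξ ∧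
    ∀ k : ℕ, 1 ≤ k → iteratedDerivWithin k ξ (Icc 0 1) 1 = iteratedDerivWithin k ξ (Icc 0 1) 0 := by
  obtain ⟨⟨h1, h2⟩, -, ξ, η, hξ, hη, h5⟩ := γ.2
  obtain ⟨x, hx⟩ := torusExp_surjective Γ (γ.1.2.1 Defect.p)
  have hw : x - ξ (1 / 2) ∈ pullLattice πw := by
    rw [mem_pullLattice, map_sub, map_sub, ← πw.torus_exp, hx, h1]
    rw [sub_eq_zero]
    exact (hξ.2 ⟨1 / 2, half_mem_w⟩).symm
  have hb : x - η (1 / 2) ∈ pullLattice πb := by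
    rw [mem_pullLattice, map_sub, map_sub, ← πb.torus_exp, hx, h2]
    rw [sub_eq_zero]
    exact (hη.2 ⟨1 / 2, half_mem_b⟩).symm
  set g : ℝ → LieAlg Γ := fun s => (x - ξ (1 / 2)) + ξ s with hg
  set f : ℝ → LieAlg Γ := fun s => (x - η (1 / 2)) + η s with hf
  have hgs : ContDiffOn ℝ ∞ g (Icc (1 / 2) 1) := contDiffOn_const.add hξ.1
  have hfs : ContDiffOn ℝ ∞ f (Icc 0 (1 / 2)) := contDiffOn_const.add hη.1
  have hd : ∀ k, iteratedDerivWithin k f (Icc 0 (1 / 2)) (1 / 2) =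
      iteratedDerivWithin k g (Icc (1 / 2) 1) (1 / 2) := by
    intro k
    rcases Nat.eq_zero_or_pos k with rfl | hk
    · simp [hf, hg]
    · rw [hf, hg, iteratedDerivWithin_const_add hk, iteratedDerivWithin_const_add hk,
        (h5 k hk).1]
  have h01 : (0 : ℝ) < 1 / 2 := by norm_num
  have h12 : (1 / 2 : ℝ) < 1 := by norm_num
  have hL : ∀ s, s ≤ 1 / 2 → glue (1 / 2) f g s = f s := fun s hs => if_pos hs
  have hR : ∀ s, 1 / 2 ≤ s → glue (1 / 2) f g s = g s := by
    intro s hs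
    by_cases h : s ≤ 1 / 2
    · have : s = 1 / 2 := le_antisymm h hs
      subst this
      rw [hL _ le_rfl]
      simp [hf, hg]
    · exact if_neg h
  refine ⟨glue (1 / 2) f g, ⟨contDiffOn_glue h01 h12 hfs hgs hd, fun s => ?_, fun s => ?_, ?_⟩,
    fun k hk => ?_⟩
  · rw [hR _ s.2.1, πw.torus_exp, hg, map_add, map_add, (mem_pullLattice πw _).1 hw, zero_add]
    exact hξ.2 s
  · rw [hL _ s.2.2, πb.torus_exp, hf, map_add, map_add, (mem_pullLattice πb _).1 hb, zero_add]
    exact hη.2 s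
  · rw [hL _ le_rfl, hf]
    simpa using hx
  · have e1 : iteratedDerivWithin k (glue (1 / 2) f g) (Icc 0 1) 1 =
        iteratedDerivWithin k g (Icc (1 / 2) 1) 1 := by
      have hs : (Icc (0 : ℝ) 1) =ᶠ[𝓝 1] Icc (1 / 2) 1 := by
        filter_upwards [Ioi_mem_nhds h12] with y hy
        simp only [mem_Ioi] at hy
        apply propext
        change (0 ≤ y ∧ y ≤ 1) ↔ (1 / 2 ≤ y ∧ y ≤ 1)
        constructor
        · exact fun h => ⟨hy.le, h.2⟩
        · exact fun h => ⟨h01.le.trans h.1, h.2⟩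
      rw [iteratedDerivWithin, iteratedFDerivWithin_congr_set hs, ← iteratedDerivWithin]
      refine Filter.EventuallyEq.iteratedDerivWithin_eq ?_ (hR 1 h12.le)
      filter_upwards [self_mem_nhdsWithin] with y hy using hR y hy.1
    have e0 : iteratedDerivWithin k (glue (1 / 2) f g) (Icc 0 1) 0 =
        iteratedDerivWithin k f (Icc 0 (1 / 2)) 0 := by
      have hs : (Icc (0 : ℝ) 1) =ᶠ[𝓝 0] Icc 0 (1 / 2) := by
        filter_upwards [Iio_mem_nhds h01] with y hy
        simp only [mem_Iio] at hy
        apply propext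
        change (0 ≤ y ∧ y ≤ 1) ↔ (0 ≤ y ∧ y ≤ 1 / 2)
        constructor
        · exact fun h => ⟨h.1, hy.le⟩
        · exact fun h => ⟨h.1, h.2.trans h12.le⟩
      rw [iteratedDerivWithin, iteratedFDerivWithin_congr_set hs, ← iteratedDerivWithin]
      refine Filter.EventuallyEq.iteratedDerivWithin_eq ?_ (hL 0 h01.le)
      filter_upwards [self_mem_nhdsWithin] with y hy using hL y hy.2
    rw [e1, e0, hf, hg, iteratedDerivWithin_const_add hk, iteratedDerivWithin_const_add hk,
      (h5 k hk).2]

/-- Two lifts differ by a constant element of `Γ`. -/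
theorem pathLift_unique {γ : bicolLoops πw πb} {ξ η : ℝ → LieAlg Γ} (hξ : IsPathLift γ ξ)
    (hη : IsPathLift γ η) : ∃ g : Γ, ∀ s ∈ Icc (0 : ℝ) 1, ξ s = η s + incl Γ g := by
  have hc : ContinuousOn (fun s => ξ s - η s) (Icc 0 1) :=
    hξ.smooth.continuousOn.sub hη.smooth.continuousOn
  obtain ⟨g, hg⟩ : ∃ g, incl Γ g = ξ (1 / 2) - η (1 / 2) := by
    rw [← torusExp_eq_zero_iff, map_sub, hξ.mid, hη.mid, sub_self]
  refine ⟨g, fun s hs => ?_⟩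
  rw [← sub_eq_iff_eq_add', hg]
  rcases le_total s (1 / 2) with h | h
  · exact eq_of_countable (f := fun s => ξ s - η s) (a := 0) (b := 1 / 2)
      (hc.mono (Icc_subset_Icc_right (by norm_num))) (countable_pullLattice πb)
      (fun x hx => by
        change _ ∈ pullLattice πb
        rw [mem_pullLattice, map_sub, map_sub, ← πb.torus_exp, ← πb.torus_exp,
          hξ.black ⟨x, hx⟩, hη.black ⟨x, hx⟩, sub_self]) ⟨hs.1, h⟩ half_mem_b
  · exact eq_of_countable (f := fun s => ξ s - η s) (a := 1 / 2) (b := 1)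
      (hc.mono (Icc_subset_Icc_left (by norm_num))) (countable_pullLattice πw)
      (fun x hx => by
        change _ ∈ pullLattice πw
        rw [mem_pullLattice, map_sub, map_sub, ← πw.torus_exp, ← πw.torus_exp,
          hξ.white ⟨x, hx⟩, hη.white ⟨x, hx⟩, sub_self]) ⟨h, hs.2⟩ half_mem_w

/-- A smooth lift `[0,1] → 𝔥` of `Pth γ`. It is unique up to a constant in `Γ`. -/
def pathLift (γ : bicolLoops πw πb) : ℝ → LieAlg Γ := (exists_pathLift γ).choose

theorem pathLift_spec (γ : bicolLoops πw πb) : IsPathLift γ (pathLift γ) :=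
  (exists_pathLift γ).choose_spec.1

theorem pathLift_deriv (γ : bicolLoops πw πb) (k : ℕ) (hk : 1 ≤ k) :
    iteratedDerivWithin k (pathLift γ) (Icc 0 1) 1 =
      iteratedDerivWithin k (pathLift γ) (Icc 0 1) 0 :=
  (exists_pathLift γ).choose_spec.2 k hk

/-- The path `Pth γ : [0,1] → H`. -/
def Pth (γ : bicolLoops πw πb) (s : Icc (0 : ℝ) 1) : Torus Γ := torusExp Γ (pathLift γ s)

theorem isPathLift_add {γ ρ : bicolLoops πw πb} {ξ η : ℝ → LieAlg Γ} (hξ : IsPathLift γ ξ)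
    (hη : IsPathLift ρ η) : IsPathLift (γ + ρ) (ξ + η) where
  smooth := hξ.smooth.add hη.smooth
  white s := by
    rw [Pi.add_apply, map_add, map_add, hξ.white, hη.white]; rfl
  black s := by
    rw [Pi.add_apply, map_add, map_add, hξ.black, hη.black]; rfl
  mid := by
    rw [Pi.add_apply, map_add, hξ.mid, hη.mid]; rfl

theorem pathLift_add (γ ρ : bicolLoops πw πb) : ∃ g : Γ, ∀ s ∈ Icc (0 : ℝ) 1,
    pathLift (γ + ρ) s = pathLift γ s + pathLift ρ s + incl Γ g :=
  pathLift_unique (pathLift_spec _) (isPathLift_add (pathLift_spec γ) (pathLift_spec ρ))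

/-- The winding element `Δ'` of `Pth γ`. -/
def windingVec (γ : bicolLoops πw πb) : LieAlg Γ := pathLift γ 1 - pathLift γ 0

theorem windingVec_mem (γ : bicolLoops πw πb) : windingVec γ ∈ diffLattice πw πb := by
  obtain ⟨-, ⟨h3, h4⟩, -⟩ := γ.2
  obtain ⟨y, hy⟩ := torusExp_surjective Γ (γ.1.2.1 Defect.q)
  have e : windingVec γ = (pathLift γ 1 - y) + (y - pathLift γ 0) := by
    unfold windingVec; abel
  rw [e]
  refine AddSubgroup.add_mem_sup ?_ ?_
  · rw [mem_pullLattice, map_sub, map_sub, ← πw.torus_exp, ← πw.torus_exp, hy, h3, sub_eq_zero]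
    exact (pathLift_spec γ).white ⟨1, one_mem_w⟩
  · rw [mem_pullLattice, map_sub, map_sub, ← πb.torus_exp, ← πb.torus_exp, hy, h4, sub_eq_zero]
    exact ((pathLift_spec γ).black ⟨0, zero_mem_b⟩).symm

theorem zero_mem_I : (0 : ℝ) ∈ Icc (0 : ℝ) 1 := by simp
theorem one_mem_I : (1 : ℝ) ∈ Icc (0 : ℝ) 1 := by simp

/-- The homomorphism `Δ' ∘ Pth`. -/
def winding : bicolLoops πw πb →+ diffLattice πw πb :=
  AddMonoidHom.mk' (fun γ => ⟨windingVec γ, windingVec_mem γ⟩) (by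
    intro γ ρ
    apply Subtype.ext
    obtain ⟨g, hg⟩ := pathLift_add γ ρ
    change pathLift (γ + ρ) 1 - pathLift (γ + ρ) 0 =
      (pathLift γ 1 - pathLift γ 0) + (pathLift ρ 1 - pathLift ρ 0)
    rw [hg 1 one_mem_I, hg 0 zero_mem_I]
    abel)

theorem winding_coe (γ : bicolLoops πw πb) :
    ((winding γ : diffLattice πw πb) : LieAlg Γ) = pathLift γ 1 - pathLift γ 0 := rfl

end
end BiLoop

namespace BiLoop
noncomputable section
open scoped ContDiff InnerProductSpace Topology
open Set MeasureTheory intervalIntegral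

variable {Γ Λw Λb : Type*} [AddCommGroup Γ] [EvenLattice Γ] [AddCommGroup Λw] [EvenLattice Λw]
  [AddCommGroup Λb] [EvenLattice Λb]

/-- A normalised `2`-cocycle `ε` on `Λ_w - Λ_b` with values in the circle and with commutator
`ε(λ, μ) ε(μ, λ)⁻¹ = e^{2πi (½⟨μ, λ⟩ + ⟨μ, λ_b⟩)}` for every decomposition `λ = λ_w - λ_b`. -/
structure LatCocycle (πw : LatticeHom Γ Λw) (πb : LatticeHom Γ Λb) where
  ε : diffLattice πw πb → diffLattice πw πb → Circle
  cocycle : ∀ l m n, ε l m * ε (l + m) n = ε m n * ε l (m + n)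
  norm_left : ∀ l, ε 0 l = 1
  norm_right : ∀ l, ε l 0 = 1
  comm : ∀ (l m : diffLattice πw πb) (lw lb : LieAlg Γ), lw ∈ pullLattice πw →
    lb ∈ pullLattice πb → (l : LieAlg Γ) = lw - lb →
    ε l m * (ε m l)⁻¹ = Circle.exp (2 * Real.pi *
      ((1 / 2) * inner ℝ (m : LieAlg Γ) (l : LieAlg Γ) + inner ℝ (m : LieAlg Γ) lb))

variable {πw : LatticeHom Γ Λw} {πb : LatticeHom Γ Λb}

/-- `S'(ξ, η) = ½ ∫₀¹ ⟨ξ', η⟩ + ½ ⟨ξ(1) - ξ(0), η(0)⟩`. -/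
def pathS (ξ η : ℝ → LieAlg Γ) : ℝ :=
  (1 / 2) * (∫ s in (0 : ℝ)..1, inner ℝ (derivWithin ξ (Icc 0 1) s) (η s)) +
    (1 / 2) * inner ℝ (ξ 1 - ξ 0) (η 0)

theorem udI : UniqueDiffOn ℝ (Icc (0 : ℝ) 1) := uniqueDiffOn_Icc (by norm_num)

theorem derivWithin_cont {ξ : ℝ → LieAlg Γ} (h : ContDiffOn ℝ ∞ ξ (Icc 0 1)) :
    ContinuousOn (derivWithin ξ (Icc 0 1)) (Icc 0 1) :=
  ((contDiffOn_infty_iff_derivWithin udI).1 h).2.continuousOn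

theorem diffAt {ξ : ℝ → LieAlg Γ} (h : ContDiffOn ℝ ∞ ξ (Icc 0 1)) {s : ℝ} (hs : s ∈ Icc (0 : ℝ) 1) :
    DifferentiableWithinAt ℝ ξ (Icc 0 1) s :=
  ((contDiffOn_infty_iff_derivWithin udI).1 h).1 s hs

theorem pathS_integrable {ξ η : ℝ → LieAlg Γ} (hξ : ContDiffOn ℝ ∞ ξ (Icc 0 1))
    (hη : ContinuousOn η (Icc 0 1)) :
    IntervalIntegrable (fun s => inner ℝ (derivWithin ξ (Icc 0 1) s) (η s)) volume 0 1 := by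
  refine ContinuousOn.intervalIntegrable ?_
  rw [uIcc_of_le zero_le_one]
  exact (derivWithin_cont hξ).inner hη

/-- Values on `[0,1]` determine `S'`. -/
theorem pathS_congr {ξ ξ' η η' : ℝ → LieAlg Γ} (h1 : EqOn ξ ξ' (Icc 0 1)) (h2 : EqOn η η' (Icc 0 1)) :
    pathS ξ η = pathS ξ' η' := by
  unfold pathS
  rw [h1 one_mem_I, h1 zero_mem_I, h2 zero_mem_I]
  congr 2
  refine intervalIntegral.integral_congr fun s hs => ?_
  rw [uIcc_of_le zero_le_one] at hs
  rw [derivWithin_congr h1 (h1 hs), h2 hs]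

theorem integral_deriv {ξ : ℝ → LieAlg Γ} (hξ : ContDiffOn ℝ ∞ ξ (Icc 0 1)) :
    ∫ s in (0 : ℝ)..1, derivWithin ξ (Icc 0 1) s = ξ 1 - ξ 0 := by
  refine intervalIntegral.integral_eq_sub_of_hasDerivAt_of_le zero_le_one hξ.continuousOn
    (fun s hs => ?_) ?_
  · exact (diffAt hξ (Ioo_subset_Icc_self hs)).hasDerivWithinAt.hasDerivAt (Icc_mem_nhds hs.1 hs.2)
  · refine ContinuousOn.intervalIntegrable ?_
    rw [uIcc_of_le zero_le_one]
    exact derivWithin_cont hξ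

theorem integral_inner_const {ξ : ℝ → LieAlg Γ} (hξ : ContDiffOn ℝ ∞ ξ (Icc 0 1)) (v : LieAlg Γ) :
    ∫ s in (0 : ℝ)..1, inner ℝ (derivWithin ξ (Icc 0 1) s) v = inner ℝ (ξ 1 - ξ 0) v := by
  have hi : IntervalIntegrable (derivWithin ξ (Icc 0 1)) volume 0 1 := by
    refine ContinuousOn.intervalIntegrable ?_
    rw [uIcc_of_le zero_le_one]
    exact derivWithin_cont hξ
  have h1 := (innerSL ℝ v).intervalIntegral_comp_comm hi
  simp only [innerSL_apply_apply] at h1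
  rw [integral_deriv hξ] at h1
  simpa only [real_inner_comm] using h1

theorem pathS_add_right {ξ η η' : ℝ → LieAlg Γ} (hξ : ContDiffOn ℝ ∞ ξ (Icc 0 1))
    (hη : ContDiffOn ℝ ∞ η (Icc 0 1)) (hη' : ContDiffOn ℝ ∞ η' (Icc 0 1)) :
    pathS ξ (η + η') = pathS ξ η + pathS ξ η' := by
  unfold pathS
  simp only [Pi.add_apply, inner_add_right]
  rw [intervalIntegral.integral_add (pathS_integrable hξ hη.continuousOn)
    (pathS_integrable hξ hη'.continuousOn)]
  ring

theorem pathS_add_left {ξ ξ' η : ℝ → LieAlg Γ} (hξ : ContDiffOn ℝ ∞ ξ (Icc 0 1))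
    (hξ' : ContDiffOn ℝ ∞ ξ' (Icc 0 1)) (hη : ContDiffOn ℝ ∞ η (Icc 0 1)) :
    pathS (ξ + ξ') η = pathS ξ η + pathS ξ' η := by
  unfold pathS
  have e : ∫ s in (0 : ℝ)..1, inner ℝ (derivWithin (ξ + ξ') (Icc 0 1) s) (η s) =
      ∫ s in (0 : ℝ)..1, (inner ℝ (derivWithin ξ (Icc 0 1) s) (η s) +
        inner ℝ (derivWithin ξ' (Icc 0 1) s) (η s)) := by
    refine intervalIntegral.integral_congr fun s hs => ?_
    rw [uIcc_of_le zero_le_one] at hs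
    rw [derivWithin_add (diffAt hξ hs) (diffAt hξ' hs), inner_add_left]
  rw [e, intervalIntegral.integral_add (pathS_integrable hξ hη.continuousOn)
    (pathS_integrable hξ' hη.continuousOn)]
  simp only [Pi.add_apply]
  rw [show ξ 1 + ξ' 1 - (ξ 0 + ξ' 0) = (ξ 1 - ξ 0) + (ξ' 1 - ξ' 0) by abel, inner_add_left]
  ring

theorem pathS_const_right {ξ : ℝ → LieAlg Γ} (hξ : ContDiffOn ℝ ∞ ξ (Icc 0 1)) (v : LieAlg Γ) :
    pathS ξ (fun _ => v) = inner ℝ (ξ 1 - ξ 0) v := by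
  unfold pathS
  rw [integral_inner_const hξ]
  ring

theorem pathS_const_left (v : LieAlg Γ) (η : ℝ → LieAlg Γ) : pathS (fun _ => v) η = 0 := by
  simp [pathS]

/-- The phase `e^{2πi S'(ξ, η)}`, where `ξ` and `η` lift `Pth γ` and `Pth ρ`. -/
def expS (γ ρ : bicolLoops πw πb) : Circle :=
  Circle.exp (2 * Real.pi * pathS (pathLift γ) (pathLift ρ))

theorem expS_add_right (γ ρ σ : bicolLoops πw πb) :
    expS γ (ρ + σ) = expS γ ρ * expS γ σ := by
  obtain ⟨g, hg⟩ := pathLift_add ρ σ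
  obtain ⟨n, hn⟩ := inner_diff_incl πw πb (windingVec_mem γ) g
  have hγ := (pathLift_spec γ).smooth
  have hρ := (pathLift_spec ρ).smooth
  have hσ := (pathLift_spec σ).smooth
  have e : pathS (pathLift γ) (pathLift (ρ + σ)) =
      pathS (pathLift γ) (pathLift ρ) + pathS (pathLift γ) (pathLift σ) + n := by
    rw [pathS_congr (ξ' := pathLift γ) (η' := (pathLift ρ + pathLift σ) + fun _ => incl Γ g)
      (fun _ _ => rfl) (fun s hs => hg s hs), pathS_add_right (η := pathLift ρ + pathLift σ) (η' := fun _ => incl Γ g) hγ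
        (hρ.add hσ) contDiffOn_const,
      pathS_add_right hγ hρ hσ, pathS_const_right hγ]
    congr 1
  unfold expS
  rw [e, mul_add, mul_add, Circle.exp_add, Circle.exp_add, Circle.exp_two_pi_mul_int, mul_one]

theorem expS_add_left (γ ρ σ : bicolLoops πw πb) :
    expS (γ + ρ) σ = expS γ σ * expS ρ σ := by
  obtain ⟨g, hg⟩ := pathLift_add γ ρ
  have hγ := (pathLift_spec γ).smooth
  have hρ := (pathLift_spec ρ).smooth
  have hσ := (pathLift_spec σ).smooth
  have e : pathS (pathLift (γ + ρ)) (pathLift σ) =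
      pathS (pathLift γ) (pathLift σ) + pathS (pathLift ρ) (pathLift σ) := by
    rw [pathS_congr (ξ' := (pathLift γ + pathLift ρ) + fun _ => incl Γ g) (η' := pathLift σ)
      (fun s hs => hg s hs) (fun _ _ => rfl), pathS_add_left (ξ := pathLift γ + pathLift ρ)
      (ξ' := fun _ => incl Γ g) (hγ.add hρ) contDiffOn_const hσ,
      pathS_add_left hγ hρ hσ, pathS_const_left, add_zero]
  unfold expS
  rw [e, mul_add, Circle.exp_add]

theorem expS_zero_left (γ : bicolLoops πw πb) : expS 0 γ = 1 := by
  have := expS_add_left 0 0 γ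
  rw [add_zero] at this
  exact left_eq_mul.1 this

theorem comm_aux {G : Type*} [CommGroup G] {a b c d : G} (x y z : G) (h : a * b = c * d) :
    a * x * (b * (y * z)) = c * z * (d * (x * y)) := by
  calc a * x * (b * (y * z)) = (a * b) * (x * y * z) := by
        rw [mul_mul_mul_comm, mul_assoc x y z]
    _ = c * z * (d * (x * y)) := by
        rw [h, mul_comm (x * y) z, mul_mul_mul_comm]

theorem comm_aux' {G : Type*} [CommGroup G] {x y z w : G} (a b c : G) (h : x * y = z * w) :
    a * b * x * c * y = a * (b * c * z) * w := by
  calc a * b * x * c * y = a * (b * c * (x * y)) := by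
        rw [mul_assoc (a * b), mul_comm x c, mul_assoc, mul_assoc c, mul_assoc a, mul_assoc b]
    _ = a * (b * c * z) * w := by
        rw [h, mul_assoc a, mul_assoc (b * c)]

/-- The `2`-cocycle `c(γ, ρ) = ε(Δ'γ, Δ'ρ) e^{2πi S'(ξ, η)}` of the central extension. -/
def cocyc (ε : LatCocycle πw πb) (γ ρ : bicolLoops πw πb) : Circle :=
  ε.ε (winding γ) (winding ρ) * expS γ ρ

theorem cocyc_cocycle (ε : LatCocycle πw πb) (γ ρ σ : bicolLoops πw πb) :
    cocyc ε γ ρ * cocyc ε (γ + ρ) σ = cocyc ε ρ σ * cocyc ε γ (ρ + σ) := by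
  unfold cocyc
  rw [map_add, map_add, expS_add_left, expS_add_right]
  exact comm_aux _ _ _ (ε.cocycle _ _ _)

theorem cocyc_zero_left (ε : LatCocycle πw πb) (γ : bicolLoops πw πb) : cocyc ε 0 γ = 1 := by
  rw [cocyc, map_zero, ε.norm_left, expS_zero_left, one_mul]

/-- The central extension `L̃(T_w, H, T_b)` of the bicoloured torus loop group by the circle. -/
@[ext] structure CentralExt (ε : LatCocycle πw πb) where
  loop : bicolLoops πw πb
  phase : Circle

namespace CentralExt
variable {ε : LatCocycle πw πb}

instance : Mul (CentralExt ε) := ⟨fun g h => ⟨g.loop + h.loop, g.phase * h.phase * cocyc ε g.loop h.loop⟩⟩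
instance : One (CentralExt ε) := ⟨⟨0, 1⟩⟩
instance : Inv (CentralExt ε) := ⟨fun g => ⟨-g.loop, g.phase⁻¹ * (cocyc ε (-g.loop) g.loop)⁻¹⟩⟩

@[simp] theorem mul_loop (g h : CentralExt ε) : (g * h).loop = g.loop + h.loop := rfl
@[simp] theorem mul_phase (g h : CentralExt ε) :
    (g * h).phase = g.phase * h.phase * cocyc ε g.loop h.loop := rfl
@[simp] theorem one_loop : (1 : CentralExt ε).loop = 0 := rfl
@[simp] theorem one_phase : (1 : CentralExt ε).phase = 1 := rfl
@[simp] theorem inv_loop (g : CentralExt ε) : (g⁻¹).loop = -g.loop := rfl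
@[simp] theorem inv_phase (g : CentralExt ε) :
    (g⁻¹).phase = g.phase⁻¹ * (cocyc ε (-g.loop) g.loop)⁻¹ := rfl

instance : Group (CentralExt ε) := Group.ofLeftAxioms
  (fun a b c => by
    ext1
    · exact add_assoc _ _ _
    · simp only [mul_phase, mul_loop]
      exact comm_aux' _ _ _ (cocyc_cocycle ε a.loop b.loop c.loop))
  (fun a => by
    ext1
    · exact zero_add a.loop
    · change 1 * a.phase * cocyc ε 0 a.loop = a.phase
      rw [cocyc_zero_left, one_mul, mul_one])
  (fun a => by
    ext1
    · exact neg_add_cancel a.loop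
    · change a.phase⁻¹ * (cocyc ε (-a.loop) a.loop)⁻¹ * a.phase * cocyc ε (-a.loop) a.loop = 1
      rw [mul_assoc, mul_mul_mul_comm, inv_mul_cancel, inv_mul_cancel, one_mul])

/-- The homomorphism `Δ' ∘ Pth` on the central extension. -/
def windingHom : CentralExt ε →* Multiplicative (diffLattice πw πb) where
  toFun g := Multiplicative.ofAdd (winding g.loop)
  map_one' := by simp
  map_mul' g h := by simp

end CentralExt

/-- The normal subgroup of the elements of `L̃(T_w, H, T_b)` with `Δ'(Pth γ) = 0`. -/
def kerTilde (ε : LatCocycle πw πb) : Subgroup (CentralExt ε) :=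
  (CentralExt.windingHom (ε := ε)).ker

instance (ε : LatCocycle πw πb) : (kerTilde ε).Normal := MonoidHom.normal_ker _

theorem mem_kerTilde {ε : LatCocycle πw πb} (g : CentralExt ε) :
    g ∈ kerTilde ε ↔ winding g.loop = 0 := Iff.rfl

/-- The constant loop with value `h`. -/
def constLoop (πw : LatticeHom Γ Λw) (πb : LatticeHom Γ Λb) (h : Torus Γ) : bicolLoops πw πb :=
  ⟨(fun _ => πw.torus h, fun _ => h, fun _ => πb.torus h), ⟨rfl, rfl⟩, ⟨rfl, rfl⟩, by
    obtain ⟨x, hx⟩ := torusExp_surjective Γ h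
    refine ⟨fun _ => x, fun _ => x, ⟨contDiffOn_const, fun s => ?_⟩, ⟨contDiffOn_const, fun s => ?_⟩,
      fun k hk => ?_⟩
    · rw [← πw.torus_exp, hx]
    · rw [← πb.torus_exp, hx]
    · simp only [iteratedDerivWithin_const]
      simp⟩

theorem winding_constLoop (h : Torus Γ) : winding (constLoop πw πb h) = 0 := by
  obtain ⟨x, hx⟩ := torusExp_surjective Γ h
  have hl : IsPathLift (constLoop πw πb h) (fun _ => x) :=
    ⟨contDiffOn_const, fun s => by rw [hx]; rfl, fun s => by rw [hx]; rfl, hx⟩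
  obtain ⟨g, hg⟩ := pathLift_unique (pathLift_spec _) hl
  apply Subtype.ext
  rw [winding_coe, hg 1 one_mem_I, hg 0 zero_mem_I]
  simp

/-- The constant loop with value `h`, as an element of the subgroup `kerTilde`. -/
def constTilde (ε : LatCocycle πw πb) (h : Torus Γ) : kerTilde ε :=
  ⟨⟨constLoop πw πb h, 1⟩, winding_constLoop h⟩

section rep
variable {ε : LatCocycle πw πb}

/-- The lift `ξ : [0,1] → 𝔥` of `Pth γ`, for an element `(γ, z)` of `kerTilde`. -/
def lift (g : kerTilde ε) : ℝ → LieAlg Γ := pathLift g.1.loop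

theorem lift_smooth (g : kerTilde ε) : ContDiffOn ℝ ∞ (lift g) (Icc 0 1) :=
  (pathLift_spec _).smooth

theorem lift_closed (g : kerTilde ε) : lift g 1 = lift g 0 := by
  have h : winding g.1.loop = 0 := g.2
  have h2 := congrArg (fun x : diffLattice πw πb => (x : LieAlg Γ)) h
  exact sub_eq_zero.1 h2

theorem lift_integrable (g : kerTilde ε) : IntervalIntegrable (lift g) volume 0 1 := by
  refine ContinuousOn.intervalIntegrable ?_
  rw [uIcc_of_le zero_le_one]
  exact (lift_smooth g).continuousOn

theorem lift_mul (g h : kerTilde ε) : ∃ x : Γ, ∀ s ∈ Icc (0 : ℝ) 1,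
    lift (g * h) s = lift g s + lift h s + incl Γ x := pathLift_add g.1.loop h.1.loop

/-- The average `∫₀¹ ξ` of the lift. -/
def liftAvg (g : kerTilde ε) : LieAlg Γ := ∫ s in (0 : ℝ)..1, lift g s

theorem liftAvg_mul (g h : kerTilde ε) {x : Γ} (hx : ∀ s ∈ Icc (0 : ℝ) 1,
    lift (g * h) s = lift g s + lift h s + incl Γ x) :
    liftAvg (g * h) = liftAvg g + liftAvg h + incl Γ x := by
  unfold liftAvg
  rw [intervalIntegral.integral_congr (g := fun s => lift g s + lift h s + incl Γ x)
    (fun s hs => hx s (by rwa [uIcc_of_le zero_le_one] at hs)),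
    intervalIntegral.integral_add ((lift_integrable g).add (lift_integrable h))
      intervalIntegrable_const, intervalIntegral.integral_add (lift_integrable g) (lift_integrable h)]
  simp

/-- The average in `H` of the loop `Pth γ`. -/
def avg (g : kerTilde ε) : Torus Γ := torusExp Γ (liftAvg g)

theorem torusExp_incl {Γ : Type*} [AddCommGroup Γ] (x : Γ) : torusExp Γ (incl Γ x) = 0 := (torusExp_eq_zero_iff Γ _).2 ⟨x, rfl⟩

theorem avg_mul (g h : kerTilde ε) : avg (g * h) = avg g + avg h := by
  obtain ⟨x, hx⟩ := lift_mul g h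
  unfold avg
  rw [liftAvg_mul g h hx, map_add, map_add, torusExp_incl, add_zero]

/-- The element `γ_m(q) - Pth γ (1)` of `(Λ_w ∩ Λ_b) / Γ`. -/
def nu (g : kerTilde ε) : interGroup πw πb :=
  ⟨g.1.loop.1.2.1 Defect.q - torusExp Γ (lift g 1), by
    obtain ⟨-, ⟨h3, h4⟩, -⟩ := g.1.loop.2
    obtain ⟨y, hy⟩ := torusExp_surjective Γ (g.1.loop.1.2.1 Defect.q)
    refine ⟨y - lift g 1, ⟨?_, ?_⟩, by rw [map_sub, hy]⟩
    · change _ ∈ pullLattice πw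
      rw [mem_pullLattice, map_sub, map_sub, ← πw.torus_exp, ← πw.torus_exp, hy, h3, sub_eq_zero]
      exact ((pathLift_spec g.1.loop).white ⟨1, one_mem_w⟩).symm
    · change _ ∈ pullLattice πb
      rw [lift_closed, mem_pullLattice, map_sub, map_sub, ← πb.torus_exp, ← πb.torus_exp, hy, h4,
        sub_eq_zero]
      exact ((pathLift_spec g.1.loop).black ⟨0, zero_mem_b⟩).symm⟩

theorem nu_mul (g h : kerTilde ε) : nu (g * h) = nu g + nu h := by
  obtain ⟨x, hx⟩ := lift_mul g h
  apply Subtype.ext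
  change (g.1.loop.1.2.1 Defect.q + h.1.loop.1.2.1 Defect.q) - torusExp Γ (lift (g * h) 1) =
    (g.1.loop.1.2.1 Defect.q - torusExp Γ (lift g 1)) +
    (h.1.loop.1.2.1 Defect.q - torusExp Γ (lift h 1))
  rw [hx 1 one_mem_I, map_add, map_add, torusExp_incl]
  abel

/-- The function `ξ - ∫₀¹ ξ` on `[0,1]`. -/
def centred (g : kerTilde ε) (s : ℝ) : LieAlg Γ := lift g s - liftAvg g

theorem centred_smooth (g : kerTilde ε) : ContDiffOn ℝ ∞ (centred g) (Icc 0 1) :=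
  (lift_smooth g).sub contDiffOn_const

theorem centred_eq (g : kerTilde ε) : centred g = fun s => -liftAvg g + lift g s := by
  funext s; simp [centred, sub_eq_neg_add]

theorem periodize_eq (g : kerTilde ε) : EqOn (periodize (centred g)) (centred g) (Icc 0 1) := by
  intro s hs
  unfold periodize
  rcases hs.2.eq_or_lt with h | h
  · subst h
    simp [centred, lift_closed]
  · rw [Int.fract_eq_self.2 ⟨hs.1, h⟩]

/-- The smooth loop in `𝔥` with average zero that belongs to an element of `kerTilde`:
the periodic extension of `ξ - ∫₀¹ ξ`. -/
def meanZeroPart (g : kerTilde ε) : MeanZeroLoop (LieAlg Γ) :=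
  ⟨periodize (centred g), ⟨contDiff_periodize (centred_smooth g) (fun k => by
      rcases Nat.eq_zero_or_pos k with rfl | hk
      · simp [centred, lift_closed]
      · rw [centred_eq, iteratedDerivWithin_const_add hk, iteratedDerivWithin_const_add hk]
        exact pathLift_deriv g.1.loop k hk), periodize_periodic _⟩, by
    rw [intervalIntegral.integral_congr (g := centred g)
      (fun s hs => periodize_eq g (by rwa [uIcc_of_le zero_le_one] at hs))]
    unfold centred
    rw [intervalIntegral.integral_sub (lift_integrable g) intervalIntegrable_const]
    simp [liftAvg]⟩

theorem meanZeroPart_mul (g h : kerTilde ε) :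
    meanZeroPart (g * h) = meanZeroPart g + meanZeroPart h := by
  obtain ⟨x, hx⟩ := lift_mul g h
  apply MeanZeroLoop.ext
  funext s
  have hs : Int.fract s ∈ Icc (0 : ℝ) 1 := ⟨Int.fract_nonneg s, (Int.fract_lt_one s).le⟩
  change lift (g * h) (Int.fract s) - liftAvg (g * h) =
    (lift g (Int.fract s) - liftAvg g) + (lift h (Int.fract s) - liftAvg h)
  rw [hx _ hs, liftAvg_mul g h hx]
  abel

theorem S_meanZeroPart (g h : kerTilde ε) :
    MeanZeroLoop.S (meanZeroPart g) (meanZeroPart h) = pathS (lift g) (lift h) := by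
  have hclosed := lift_closed g
  unfold MeanZeroLoop.S pathS
  rw [hclosed, sub_self, inner_zero_left, mul_zero, add_zero]
  congr 1
  have e1 : ∫ s in (0 : ℝ)..1, inner ℝ (deriv (meanZeroPart g).fn s) ((meanZeroPart h).fn s) =
      ∫ s in (0 : ℝ)..1, (inner ℝ (derivWithin (lift g) (Icc 0 1) s) (lift h s) -
        inner ℝ (derivWithin (lift g) (Icc 0 1) s) (liftAvg h)) := by
    refine intervalIntegral.integral_congr_Ioo_of_le zero_le_one fun s hs => ?_
    have hs' := Ioo_subset_Icc_self hs
    have e2 : deriv (meanZeroPart g).fn s = derivWithin (lift g) (Icc 0 1) s := by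
      have h1 : deriv (meanZeroPart g).fn s = derivWithin (meanZeroPart g).fn (Icc 0 1) s :=
        (derivWithin_of_mem_nhds (Icc_mem_nhds hs.1 hs.2)).symm
      rw [h1, derivWithin_congr (f₁ := (meanZeroPart g).fn) (f := centred g)
        (periodize_eq g) (periodize_eq g hs'), centred_eq, derivWithin_const_add]
    have e3 : (meanZeroPart h).fn s = lift h s - liftAvg h := periodize_eq h hs'
    simp only [e2, e3, inner_sub_right]
  rw [e1, intervalIntegral.integral_sub (pathS_integrable (lift_smooth g) (lift_smooth h).continuousOn)
    (pathS_integrable (lift_smooth g) continuousOn_const), integral_inner_const (lift_smooth g),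
    hclosed, sub_self, inner_zero_left, sub_zero]

/-- Multiplication by a complex number of modulus one, as a unitary operator. -/
def phaseMul {K : Type*} [NormedAddCommGroup K] [InnerProductSpace ℂ K] (z : Circle) : K ≃ₗᵢ[ℂ] K where
  toLinearEquiv := LinearEquiv.smulOfUnit (Circle.toUnits z)
  norm_map' x := by
    change ‖(z : ℂ) • x‖ = ‖x‖
    rw [norm_smul, Circle.norm_coe, one_mul]

theorem phaseMul_apply {K : Type*} [NormedAddCommGroup K] [InnerProductSpace ℂ K] (z : Circle) (x : K) :
    phaseMul z x = (z : ℂ) • x := rfl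

/-- The representation `W_{χ,l}` of `kerTilde` on the Fock space of `V𝔥`:
the Weyl representation tensored with the characters `χ` and `l`. -/
def weylRep (ε : LatCocycle πw πb) (χ : AddChar (interGroup πw πb) Circle)
    (l : AddChar (Torus Γ) Circle) :
    kerTilde ε →* (Fock.FockSpace (MeanZeroLoop (LieAlg Γ)) ≃ₗᵢ[ℂ]
      Fock.FockSpace (MeanZeroLoop (LieAlg Γ))) :=
  MonoidHom.mk' (fun g => phaseMul (χ (nu g) * l (avg g) * g.1.phase) * Fock.weyl (meanZeroPart g)) (by
    intro g h
    ext1 x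
    simp only [LinearIsometryEquiv.coe_mul, Function.comp_apply, phaseMul_apply, map_smul, Fock.weyl_weyl, smul_smul,
      meanZeroPart_mul, MeanZeroLoop.inner_im, S_meanZeroPart]
    congr 1
    rw [nu_mul, avg_mul, AddChar.map_add_eq_mul, AddChar.map_add_eq_mul]
    have hp : (g * h).1.phase = g.1.phase * h.1.phase * expS g.1.loop h.1.loop := by
      change g.1.phase * h.1.phase * cocyc ε g.1.loop h.1.loop = _
      have hg : winding g.1.loop = 0 := g.2
      rw [cocyc, hg, ε.norm_left, one_mul]
    rw [hp]
    unfold expS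
    simp only [Circle.coe_mul, Circle.coe_exp]
    unfold lift
    push_cast
    ring)

end rep
end
end BiLoop

namespace BiLoop
noncomputable section
section induced
variable {G : Type*} [Group G] {N : Subgroup G} {K : Type*} [NormedAddCommGroup K]
  [InnerProductSpace ℂ K]

/-- A unitary representation is irreducible if its space is nonzero and `{0}` and the whole space
are the only invariant closed subspaces. -/
def IsIrreducible (R : G →* (K ≃ₗᵢ[ℂ] K)) : Prop :=
  Nontrivial K ∧ ∀ M : Submodule ℂ K, IsClosed (M : Set K) →
    (∀ g, ∀ v ∈ M, R g v ∈ M) → M = ⊥ ∨ M = ⊤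

/-- The vectors of the induced representation. A vector of the Hilbert sum, over the left cosets
`σ` of `N`, of the spaces `σ ×_N K` (pairs `(x, v) ∈ σ × K` modulo `(x n, v) ∼ (x, Q n v)`) is a
family `([x, f x])_{σ = x N}` with `f (x n) = Q(n)⁻¹ (f x)` and `∑_σ ‖f x‖² < ∞`. -/
def indSubmodule (Q : N →* (K ≃ₗᵢ[ℂ] K)) : Submodule ℂ (G → K) where
  carrier := {f | (∀ (x : G) (n : N), f (x * n) = Q n⁻¹ (f x)) ∧
    Memℓp (fun σ : G ⧸ N => f σ.out) 2}
  zero_mem' := ⟨fun _ _ => (map_zero _).symm, zero_memℓp⟩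
  add_mem' := by
    rintro f h ⟨hf, hf'⟩ ⟨hh, hh'⟩
    refine ⟨fun x n => ?_, hf'.add hh'⟩
    rw [Pi.add_apply, hf, hh, Pi.add_apply, map_add]
  smul_mem' := by
    rintro c f ⟨hf, hf'⟩
    refine ⟨fun x n => ?_, hf'.const_smul c⟩
    rw [Pi.smul_apply, hf, Pi.smul_apply, map_smul]

/-- The Hilbert space of the induced representation. -/
def IndSpace (Q : N →* (K ≃ₗᵢ[ℂ] K)) : Type _ := indSubmodule Q

namespace IndSpace
variable {Q : N →* (K ≃ₗᵢ[ℂ] K)}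

instance : AddCommGroup (IndSpace Q) := inferInstanceAs (AddCommGroup (indSubmodule Q))
instance : Module ℂ (IndSpace Q) := inferInstanceAs (Module ℂ (indSubmodule Q))

/-- The function on `G` that represents a vector. -/
def fn (f : IndSpace Q) : G → K := f.1

theorem fn_mul (f : IndSpace Q) (x : G) (n : N) : f.fn (x * n) = Q n⁻¹ (f.fn x) := f.2.1 x n

theorem ext {f h : IndSpace Q} (e : ∀ x, f.fn x = h.fn x) : f = h := Subtype.ext (funext e)

/-- The norm of `f x` depends on the coset of `x` only. -/
theorem norm_fn (f : IndSpace Q) {x y : G} (h : (x : G ⧸ N) = y) : ‖f.fn x‖ = ‖f.fn y‖ := by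
  have hn : x⁻¹ * y ∈ N := QuotientGroup.eq.1 h
  have := f.fn_mul x ⟨x⁻¹ * y, hn⟩
  rw [mul_inv_cancel_left] at this
  rw [this, LinearIsometryEquiv.norm_map]

/-- The family of the values of `f` at representatives of the cosets. -/
def toLp : IndSpace Q →ₗ[ℂ] lp (fun _ : G ⧸ N => K) 2 where
  toFun f := ⟨fun σ => f.fn σ.out, f.2.2⟩
  map_add' _ _ := rfl
  map_smul' _ _ := rfl

theorem toLp_injective : Function.Injective (toLp (Q := Q)) := by
  intro f h e
  refine ext fun x => ?_
  have e1 : f.fn (x : G ⧸ N).out = h.fn (x : G ⧸ N).out :=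
    congrFun (congrArg (fun u : lp (fun _ : G ⧸ N => K) 2 => (u : G ⧸ N → K)) e) (x : G ⧸ N)
  have hn : ((x : G ⧸ N).out)⁻¹ * x ∈ N := QuotientGroup.eq.1 (QuotientGroup.out_eq' (x : G ⧸ N))
  have hf := f.fn_mul (x : G ⧸ N).out ⟨_, hn⟩
  have hh := h.fn_mul (x : G ⧸ N).out ⟨_, hn⟩
  rw [mul_inv_cancel_left] at hf hh
  rw [hf, hh, e1]

instance : NormedAddCommGroup (IndSpace Q) :=
  NormedAddCommGroup.induced _ _ (toLp (Q := Q)) toLp_injective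

theorem norm_def (f : IndSpace Q) : ‖f‖ = ‖toLp f‖ := rfl

/-- The inner product is the sum over the cosets of the inner products of the values. -/
instance : InnerProductSpace ℂ (IndSpace Q) where
  norm_smul_le c f := by rw [norm_def, norm_def, map_smul, norm_smul]
  inner f h := inner ℂ (toLp f) (toLp h)
  norm_sq_eq_re_inner f := norm_sq_eq_re_inner (𝕜 := ℂ) (toLp f)
  conj_inner_symm f h := inner_conj_symm (𝕜 := ℂ) (toLp f) (toLp h)
  add_left f h k := by rw [map_add, inner_add_left]
  smul_left f h c := by rw [map_smul, inner_smul_left]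

theorem norm_sq (f : IndSpace Q) : ‖f‖ ^ 2 = ∑' σ : G ⧸ N, ‖f.fn σ.out‖ ^ 2 := by
  have := lp.norm_rpow_eq_tsum (p := 2) (by norm_num) (toLp f)
  simp only [ENNReal.toReal_ofNat, Real.rpow_ofNat] at this
  exact this

theorem out_smul (g : G) (σ : G ⧸ N) : ((g⁻¹ * σ.out : G) : G ⧸ N) = (g⁻¹ • σ).out := by
  rw [QuotientGroup.out_eq']
  conv_rhs => rw [← QuotientGroup.out_eq' σ]
  rfl

/-- The action `(g • f) x = f (g⁻¹ x)`, which maps `[x, v]` to `[g x, v]`. -/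
def act (g : G) : IndSpace Q →ₗ[ℂ] IndSpace Q where
  toFun f := ⟨fun x => f.fn (g⁻¹ * x), fun x n => by
      change f.fn (g⁻¹ * (x * n)) = _
      rw [← mul_assoc, fn_mul], by
    have h1 : Memℓp (fun σ : G ⧸ N => f.fn σ.out) 2 := f.2.2
    rw [memℓp_gen_iff (by norm_num)] at h1 ⊢
    refine ((MulAction.toPerm (g⁻¹) : Equiv.Perm (G ⧸ N)).summable_iff.2 h1).congr fun σ => ?_
    rw [f.norm_fn (out_smul g σ)]
    rfl⟩
  map_add' _ _ := rfl
  map_smul' _ _ := rfl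

theorem act_fn (g : G) (f : IndSpace Q) (x : G) : (act g f).fn x = f.fn (g⁻¹ * x) := rfl

theorem act_mul (g h : G) (f : IndSpace Q) : act (g * h) f = act g (act h f) :=
  ext fun x => by rw [act_fn, act_fn, act_fn, mul_inv_rev, mul_assoc]

theorem act_one (f : IndSpace Q) : act 1 f = f :=
  ext fun x => by rw [act_fn, inv_one, one_mul]

theorem norm_act (g : G) (f : IndSpace Q) : ‖act g f‖ = ‖f‖ := by
  have h : ‖act g f‖ ^ 2 = ‖f‖ ^ 2 := by
    rw [norm_sq, norm_sq, ← (MulAction.toPerm (g⁻¹) : Equiv.Perm (G ⧸ N)).tsum_eq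
      (fun σ : G ⧸ N => ‖f.fn σ.out‖ ^ 2)]
    refine tsum_congr fun σ => ?_
    rw [act_fn, f.norm_fn (out_smul g σ)]
    rfl
  exact (sq_eq_sq₀ (norm_nonneg _) (norm_nonneg _)).1 h

end IndSpace

/-- The representation of `G` induced from the representation `Q` of the subgroup `N`. -/
def indRep (Q : N →* (K ≃ₗᵢ[ℂ] K)) : G →* (IndSpace Q ≃ₗᵢ[ℂ] IndSpace Q) :=
  MonoidHom.mk' (fun g =>
    { toLinearEquiv := LinearEquiv.ofLinearMap (IndSpace.act g) (IndSpace.act g⁻¹)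
        (LinearMap.ext fun f => by
          rw [LinearMap.comp_apply, ← IndSpace.act_mul, mul_inv_cancel, IndSpace.act_one]; rfl)
        (LinearMap.ext fun f => by
          rw [LinearMap.comp_apply, ← IndSpace.act_mul, inv_mul_cancel, IndSpace.act_one]; rfl)
      norm_map' := fun f => IndSpace.norm_act g f })
    (fun g h => LinearIsometryEquiv.ext fun f => IndSpace.act_mul g h f)

theorem indRep_apply (Q : N →* (K ≃ₗᵢ[ℂ] K)) (g : G) (f : IndSpace Q) (x : G) :
    (indRep Q g f).fn x = f.fn (g⁻¹ * x) := rfl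

/-- The representation `Q^g(k) = Q(g⁻¹ k g)` of a normal subgroup that is conjugate to `Q`. -/
def conjRep [N.Normal] (Q : N →* (K ≃ₗᵢ[ℂ] K)) (g : G) : N →* (K ≃ₗᵢ[ℂ] K) :=
  Q.comp (MulAut.conjNormal g⁻¹).toMonoidHom

theorem conjRep_apply [hN : N.Normal] (Q : N →* (K ≃ₗᵢ[ℂ] K)) (g : G) (k : N) :
    conjRep Q g k = Q ⟨g⁻¹ * k * g, hN.conj_mem' k k.2 g⟩ := by
  refine congrArg Q (Subtype.ext ?_)
  simp

end induced
end
end BiLoop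

/-! ### The commutant of the Weyl operators on Fock space. -/

namespace Fock
noncomputable section
open scoped InnerProductSpace ComplexOrder
open UniformSpace

variable {V : Type*} [SeminormedAddCommGroup V] [InnerProductSpace ℂ V]

/-! Irreducibility of `weylRep` is a statement about the Weyl operators alone. The characters and
the circle component contribute only scalars of modulus one, and every loop in V𝔥 is the centred
lift of some element of N (`meanZeroPart_surjective`). So a bounded operator T that commutes with
`weylRep` commutes with all W(ξ).

For such a T put F(v) = ⟨e^0, T e^v⟩. Translating by W(-κ) gives ⟨e^κ, T e^μ⟩ = e^⟨κ,μ⟩ F(μ - κ)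
(`inner_coherent_of_commute`). Along each complex line F is entire, because F(v) = ⟨T* e^0, e^v⟩;
but the conjugate of F(v) is ⟨T e^0, e^(-v)⟩, which is entire too. A function that is both
holomorphic and antiholomorphic is constant, so T has the same matrix coefficients as the scalar
F(0). Coherent vectors being total, T is that scalar (`eq_smul_of_commute`). Applied to the
orthogonal projection onto a closed invariant subspace, this leaves only 0 and the whole space
(`isIrreducible_of_commutant`).

The induced representation is treated by Mackey's argument, with the constant loops ρ_α separating
the fibres over the cosets. The loop group is abelian, so conjugating ρ_α by g = (γ, z) changes only
the phase. Constants contribute nothing to S' in its first argument and ⟨Δ'γ, α⟩ in its second,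
while ε is normalised and ρ_α has zero winding; the net factor is e^(-2πi⟨Δ'γ, α⟩)
(`conj_const_phase`). Hence ρ_α acts by l(exp α) on the fibre over the trivial coset and by l(exp α)
e^(-2πi⟨Δ'γ, α⟩) on the fibre over gN. For g outside N the vector Δ'γ is nonzero, and a suitable
multiple α of it makes the extra factor -1 (`exists_exp_winding_ne`).

Let P be the projection onto a closed invariant subspace M of the induced representation. It
commutes with every ρ_α, so by comparison of eigenvalues it maps the fibre over the trivial coset
into itself. That fibre is a copy of `weylRep`, hence it lies in M or meets M only in 0, and in the
second case P kills it and it lies in the orthogonal complement of M. An invariant closed subspace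
that contains this fibre contains all its translates and is everything (`eq_top_of_single_mem`). So
M or its complement is the whole space (`isIrreducible_indRep`). Since the cosets are permuted
transitively, only the comparison with the trivial coset is needed. -/

/-- Matrix coefficients of coherent vectors are entire along complex lines. -/
theorem differentiable_inner_coherent (f : FockSpace V) (v : V) :
    Differentiable ℂ fun z : ℂ => inner ℂ f (coherent (z • v)) := by
  let a : ℕ → ℂ := fun k => ((Nat.factorial k : ℂ))⁻¹ * inner ℂ (f k) (monomial k (fun _ => v))
  have hs : ∀ t : ℂ, HasSum (fun k => t ^ k * a k) (inner ℂ f (coherent (t • v))) := by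
    intro t
    refine Eq.mp (congrArg (fun F => HasSum F _) (funext fun k => ?_))
      (lp.hasSum_inner (𝕜 := ℂ) f (coherent (t • v)))
    change inner ℂ (f k) (((Nat.factorial k : ℂ))⁻¹ • monomial k (fun _ => t • v)) = _
    -- Homogeneity in degree k. The inner product is linear on the right, so `t` comes out without a
    -- conjugate and the series is holomorphic rather than antiholomorphic.
    have e : monomial k (fun _ => t • v) = t ^ k • monomial k (fun _ => v) := by
      have := (monomialMul (V := V) k).map_smul_univ (fun _ => t) (fun _ => v)
      simp only [Finset.prod_const, Finset.card_univ, Fintype.card_fin] at this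
      exact this
    rw [e, inner_smul_right, inner_smul_right]
    simp only [a]
    ring
  have hb : HasFPowerSeriesOnBall (fun z : ℂ => inner ℂ f (coherent (z • v)))
      (FormalMultilinearSeries.ofScalars ℂ a) 0 ⊤ :=
    { r_le := by
        rw [FormalMultilinearSeries.radius_eq_top_of_summable_norm]
        intro r
        -- Summability in ℂ is absolute, so convergence at every real point `r` already makes the
        -- radius infinite.
        refine (hs (r : ℂ)).summable.norm.congr fun k => ?_
        rw [FormalMultilinearSeries.ofScalars_norm, norm_mul, norm_pow, mul_comm]
        simp
      r_pos := ENNReal.zero_lt_top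
      hasSum := fun {y} _ => by
        rw [zero_add]
        simpa only [FormalMultilinearSeries.ofScalars_apply_eq, smul_eq_mul, mul_comm] using hs y }
  have := hb.differentiableOn
  rwa [Metric.eball_top, differentiableOn_univ] at this

/-- An entire function whose complex conjugate is entire is constant. -/
theorem eq_of_differentiable_conj {g : ℂ → ℂ} (hg : Differentiable ℂ g)
    (hc : Differentiable ℂ fun z => (starRingEnd ℂ) (g z)) (z w : ℂ) : g z = g w := by
  refine is_const_of_deriv_eq_zero hg (fun x => ?_) z w
  have h1 := ((hg x).hasDerivAt.hasFDerivAt.restrictScalars ℝ)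
  have h2 := ((hc x).hasDerivAt.hasFDerivAt.restrictScalars ℝ)
  -- The real derivative of the conjugate of `g` is computed in two ways: `h2` shows it complex
  -- linear, `h3` shows it to be conjugation after multiplication by g'.
  have h3 := (Complex.conjCLE.toContinuousLinearMap.hasFDerivAt (x := g x)).comp x h1
  have h4 := h2.unique h3
  -- Evaluation at 1 identifies the derivative of the conjugate with the conjugate of g'; evaluation
  -- at i gives the same relation with the opposite sign, which forces g' = 0.
  have e1 := congrArg (fun A : ℂ →L[ℝ] ℂ => A 1) h4
  have e2 := congrArg (fun A : ℂ →L[ℝ] ℂ => A Complex.I) h4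
  simp at e1 e2
  rw [e1] at e2
  have h5 : (starRingEnd ℂ) (deriv g x) = 0 := by
    have : (2 * Complex.I) * (starRingEnd ℂ) (deriv g x) = 0 := by linear_combination e2
    exact (mul_eq_zero.1 this).resolve_left (by simp)
  simpa using h5

/-- An operator that commutes with the Weyl operators has matrix coefficients
`⟨e^κ, T e^μ⟩ = e^⟨κ,μ⟩ ⟨e⁰, T e^(μ-κ)⟩`. -/
theorem inner_coherent_of_commute {T : FockSpace V →L[ℂ] FockSpace V}
    (hT : ∀ ξ x, T (weyl ξ x) = weyl ξ (T x)) (κ μ : V) :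
    inner ℂ (coherent κ) (T (coherent μ)) =
      Complex.exp (inner ℂ κ μ) * inner ℂ (coherent 0) (T (coherent (μ - κ))) := by
  -- The unitary W(-κ) is applied to both entries and moved through `T`. It turns e^κ into a
  -- multiple of the vacuum and e^μ into a multiple of e^(μ-κ).
  rw [← (weyl (-κ)).inner_map_map, ← hT, weyl_apply, weyl_apply, weylCLM_coherent,
    weylCLM_coherent, map_smul, inner_smul_left, inner_smul_right, add_neg_cancel,
    ← sub_eq_add_neg, ← mul_assoc]
  congr 1
  -- The quadratic terms in κ of the two coefficients add up to -½ + 1 - ½ = 0 times ⟨κ,κ⟩, which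
  -- leaves exactly e^⟨κ,μ⟩.
  unfold weylCoeff
  rw [← Complex.exp_conj, ← Complex.exp_add]
  congr 1
  simp only [map_sub, map_mul, map_neg, inner_conj_symm, inner_neg_left, inner_neg_right, map_div₀,
    map_one, map_ofNat]
  ring

/-- Schur's lemma for the Weyl operators: their commutant consists of scalars. -/
theorem eq_smul_of_commute {T : FockSpace V →L[ℂ] FockSpace V}
    (hT : ∀ ξ x, T (weyl ξ x) = weyl ξ (T x)) :
    ∃ c : ℂ, ∀ x, T x = c • x := by
  have hG : ∀ v : V, inner ℂ (coherent 0) (T (coherent v)) =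
      inner ℂ (coherent (0 : V)) (T (coherent 0)) := by
    intro v
    -- The vacuum matrix coefficient is restricted to the complex line through `v`, and its values
    -- at z = 1 and z = 0 are compared.
    have h := eq_of_differentiable_conj (g := fun z => inner ℂ (coherent 0) (T (coherent (z • v))))
      ?_ ?_ 1 0
    · simpa using h
    · simp only [← ContinuousLinearMap.adjoint_inner_left]
      exact differentiable_inner_coherent _ v
    · have e : ∀ z : ℂ, (starRingEnd ℂ) (inner ℂ (coherent 0) (T (coherent (z • v)))) =
          inner ℂ (T (coherent 0)) (coherent (z • -v)) := by
        intro z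
        -- Taking μ = 0 and κ = -zv trades the vector on the right, on which the coefficient depends
        -- holomorphically, for one on the left; conjugating then gives a holomorphic function
        -- again.
        have := inner_coherent_of_commute hT (z • -v) 0
        rw [inner_zero_right, Complex.exp_zero, one_mul, smul_neg, sub_neg_eq_add, zero_add] at this
        rw [← this, inner_conj_symm, smul_neg]
      simp only [e]
      exact differentiable_inner_coherent _ _
  refine ⟨inner ℂ (coherent (0 : V)) (T (coherent 0)), fun x => ?_⟩
  have : T = inner ℂ (coherent (0 : V)) (T (coherent 0)) •
      ContinuousLinearMap.id ℂ (FockSpace V) := by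
    refine clm_ext_coherent fun μ => ?_
    rw [← sub_eq_zero]
    have h0 : ∀ f : FockSpace V, (∀ κ, inner ℂ (coherent κ) f = 0) → f = 0 := fun f hf =>
      eq_zero_of_inner_coherent f fun v => by rw [← inner_conj_symm, hf, map_zero]
    refine h0 _ fun κ => ?_
    -- With the vacuum coefficient constant, what remains of the matrix coefficient of `T` is that
    -- constant times e^⟨κ,μ⟩ = ⟨e^κ, e^μ⟩.
    rw [inner_sub_right, inner_coherent_of_commute hT, hG, smul_apply,
      ContinuousLinearMap.id_apply, inner_smul_right, inner_coherent]
    ring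
  conv_lhs => rw [this]
  rfl

/-- The vacuum `coherent 0` is a unit vector. This holds even for V = 0, hence also for lattices of
rank zero. -/
instance : Nontrivial (FockSpace V) :=
  ⟨coherent 0, 0, fun h => by
    have := inner_coherent (0 : V) 0
    rw [h, inner_zero_left, inner_zero_left, Complex.exp_zero] at this
    exact zero_ne_one this⟩

end
end Fock

/-! ### Invariant subspaces and commutants of unitary representations. -/

namespace BiLoop
noncomputable section
section invariant
variable {G : Type*} [Group G] {K : Type*} [NormedAddCommGroup K] [InnerProductSpace ℂ K]

theorem apply_inv_apply (R : G →* (K ≃ₗᵢ[ℂ] K)) (g : G) (v : K) : R g (R g⁻¹ v) = v := by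
  have := DFunLike.congr_fun (map_mul R g g⁻¹) v
  rw [mul_inv_cancel, map_one] at this
  exact this.symm

/-- The orthogonal complement of an invariant subspace is invariant. -/
theorem orthogonal_invariant {R : G →* (K ≃ₗᵢ[ℂ] K)} {M : Submodule ℂ K}
    (hM : ∀ g, ∀ v ∈ M, R g v ∈ M) (g : G) {v : K} (hv : v ∈ Mᗮ) : R g v ∈ Mᗮ := by
  rw [Submodule.mem_orthogonal] at hv ⊢
  intro u hu
  -- Unitarity moves R(g) to the other entry as R(g⁻¹), and M is invariant under g⁻¹ as well.
  have h := hv _ (hM g⁻¹ u hu)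
  rw [← (R g).inner_map_map] at h
  rwa [apply_inv_apply] at h

/-- The orthogonal projection onto an invariant subspace is an intertwiner. -/
theorem starProjection_commute {R : G →* (K ≃ₗᵢ[ℂ] K)} {M : Submodule ℂ K}
    [M.HasOrthogonalProjection] (hM : ∀ g, ∀ v ∈ M, R g v ∈ M) (g : G) (v : K) :
    M.starProjection (R g v) = R g (M.starProjection v) := by
  -- Writing v as its projection plus the rest and applying R(g) gives again a decomposition along M
  -- and its complement; such a decomposition is unique.
  refine (Submodule.eq_starProjection_of_mem_orthogonal
    (hM g _ (M.starProjection_apply_mem v)) ?_)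
  rw [← map_sub]
  exact orthogonal_invariant hM g (M.sub_starProjection_mem_orthogonal v)

/-- A unitary representation on a nonzero Hilbert space whose commutant consists of scalars is
irreducible. -/
theorem isIrreducible_of_commutant [CompleteSpace K] [Nontrivial K] {R : G →* (K ≃ₗᵢ[ℂ] K)}
    (h : ∀ T : K →L[ℂ] K, (∀ g x, T (R g x) = R g (T x)) → ∃ c : ℂ, ∀ x, T x = c • x) :
    IsIrreducible R := by
  refine ⟨inferInstance, fun M hc hM => ?_⟩
  have : CompleteSpace M := hc.completeSpace_coe
  obtain ⟨c, hP⟩ := h M.starProjection fun g x => starProjection_commute hM g x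
  -- That the scalar is 0 or 1 is not needed: a projection fixes M, so c = 0 forces M = 0, while for
  -- c ≠ 0 every `x` is c⁻¹ times a vector of M.
  by_cases h0 : c = 0
  · left
    rw [Submodule.eq_bot_iff]
    intro x hx
    rw [← Submodule.starProjection_eq_self_iff.2 hx, hP, h0, zero_smul]
  · right
    rw [Submodule.eq_top_iff']
    intro x
    have := M.smul_mem c⁻¹ (M.starProjection_apply_mem x)
    rwa [hP, inv_smul_smul₀ h0] at this

end invariant
end
end BiLoop

/-! ### The Hilbert space of an induced representation. -/

namespace BiLoop
noncomputable section
section induced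
variable {G : Type*} [Group G] {N : Subgroup G} {K : Type*} [NormedAddCommGroup K]
  [InnerProductSpace ℂ K]

theorem map_mul_apply (R : G →* (K ≃ₗᵢ[ℂ] K)) (g h : G) (v : K) : R (g * h) v = R g (R h v) :=
  DFunLike.congr_fun (map_mul R g h) v

namespace IndSpace
variable {Q : N →* (K ≃ₗᵢ[ℂ] K)}

/-- Values prescribed at the chosen representatives propagate along each coset by equivariance, with
no condition to satisfy because N acts freely on the right. Together with the isometry property this
makes `IndSpace` a copy of an ℓ² sum, and hence complete, which the orthogonal projections below
require. -/
theorem toLp_surjective : Function.Surjective (toLp (Q := Q)) := by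
  intro u
  -- The element of N that carries the chosen representative of the coset of `x` to `x`.
  have hn : ∀ x : G, ((x : G ⧸ N).out)⁻¹ * x ∈ N := fun x =>
    QuotientGroup.eq.1 (QuotientGroup.out_eq' (x : G ⧸ N))
  -- At a representative this element is 1, so the extension does not alter the prescribed value
  -- there.
  have hc : ∀ σ : G ⧸ N, Q (⟨_, hn σ.out⟩ : N)⁻¹ (u (σ.out : G ⧸ N)) = u σ := by
    intro σ
    have e : (⟨_, hn σ.out⟩ : N) = 1 := by
      apply Subtype.ext
      change ((σ.out : G ⧸ N).out)⁻¹ * σ.out = 1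
      rw [QuotientGroup.out_eq', inv_mul_cancel]
    rw [e, inv_one, map_one, QuotientGroup.out_eq']
    rfl
  refine ⟨⟨fun x => Q (⟨_, hn x⟩ : N)⁻¹ (u (x : G ⧸ N)), fun x n => ?_, ?_⟩, ?_⟩
  · have e : ((x * n : G) : G ⧸ N) = x := QuotientGroup.mk_mul_of_mem x n.2
    -- Right translation by `n` keeps the coset and its representative, so the transporting element
    -- is just multiplied by `n`; this is the equivariance of the extension.
    have e2 : (⟨_, hn (x * n)⟩ : N) = ⟨_, hn x⟩ * n := by
      apply Subtype.ext
      change (((x * n : G) : G ⧸ N).out)⁻¹ * (x * n) = ((x : G ⧸ N).out)⁻¹ * x * n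
      rw [e, mul_assoc]
    change Q (⟨_, hn (x * n)⟩ : N)⁻¹ (u ((x * n : G) : G ⧸ N)) = _
    rw [e2, e, mul_inv_rev, map_mul_apply]
  · simp only [hc]
    exact lp.memℓp u
  · ext σ
    exact hc σ

instance [CompleteSpace K] : CompleteSpace (IndSpace Q) := by
  let e : IndSpace Q ≃ₗᵢ[ℂ] lp (fun _ : G ⧸ N => K) 2 :=
    LinearIsometryEquiv.ofSurjective ⟨toLp, fun f => (norm_def f).symm⟩ toLp_surjective
  exact (completeSpace_congr (e := e.toLinearEquiv.toEquiv) e.isometry.isUniformEmbedding).2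
    inferInstance

theorem inner_def (f h : IndSpace Q) :
    inner ℂ f h = ∑' σ : G ⧸ N, inner ℂ (f.fn σ.out) (h.fn σ.out) :=
  lp.inner_eq_tsum (𝕜 := ℂ) (toLp f) (toLp h)

theorem mk_eq_one {x : G} : (x : G ⧸ N) = ((1 : G) : G ⧸ N) ↔ x ∈ N := by
  rw [eq_comm, QuotientGroup.eq, inv_one, one_mul]

theorem out_mem_iff (σ : G ⧸ N) : σ.out ∈ N ↔ σ = ((1 : G) : G ⧸ N) := by
  rw [← mk_eq_one, QuotientGroup.out_eq']

open Classical in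
/-- The vector `[1, v]`. -/
def single (Q : N →* (K ≃ₗᵢ[ℂ] K)) (v : K) : IndSpace Q :=
  ⟨fun x => if h : x ∈ N then Q (⟨x, h⟩ : N)⁻¹ v else 0, fun x n => by
    beta_reduce
    by_cases h : x ∈ N
    · have h2 : x * n ∈ N := N.mul_mem h n.2
      rw [dif_pos h, dif_pos h2, ← map_mul_apply, ← mul_inv_rev]
      rfl
    · have h2 : x * n ∉ N := fun h' => h ((N.mul_mem_cancel_right n.2).1 h')
      rw [dif_neg h, dif_neg h2, map_zero], by
    rw [memℓp_gen_iff (by norm_num)]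
    refine summable_of_ne_finset_zero (s := {((1 : G) : G ⧸ N)}) fun σ hσ => ?_
    beta_reduce
    rw [dif_neg (fun h => hσ (Finset.mem_singleton.2 ((out_mem_iff σ).1 h)))]
    simp⟩

theorem single_fn_mem (v : K) (n : N) : (single Q v).fn n = Q n⁻¹ v := dif_pos n.2

theorem single_fn_notMem (v : K) {x : G} (hx : x ∉ N) : (single Q v).fn x = 0 := dif_neg hx

theorem single_fn_one (v : K) : (single Q v).fn 1 = v := by
  have := single_fn_mem (Q := Q) v 1
  rwa [inv_one, map_one] at this

/-- A vector that is supported on `N` is determined by its value at the unit. -/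
theorem eq_single {f : IndSpace Q} (hf : ∀ x ∉ N, f.fn x = 0) : f = single Q (f.fn 1) := by
  refine ext fun x => ?_
  by_cases h : x ∈ N
  · have := f.fn_mul 1 ⟨x, h⟩
    rw [one_mul] at this
    exact this.trans (single_fn_mem (f.fn 1) ⟨x, h⟩).symm
  · rw [hf x h, single_fn_notMem _ h]

theorem fn_add (f h : IndSpace Q) (x : G) : (f + h).fn x = f.fn x + h.fn x := rfl

theorem fn_smul (c : ℂ) (f : IndSpace Q) (x : G) : (c • f).fn x = c • f.fn x := rfl

theorem fn_zero (x : G) : (0 : IndSpace Q).fn x = 0 := rfl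

/-- Only the trivial coset contributes to the sum. Its chosen representative need not be 1, but it
lies in N, and Q of it acts on both entries and cancels by unitarity. So values at 1 can be
extracted by inner products, independently of the choice of representatives. -/
theorem inner_single (v : K) (f : IndSpace Q) : inner ℂ (single Q v) f = inner ℂ v (f.fn 1) := by
  rw [inner_def, tsum_eq_single ((1 : G) : G ⧸ N)]
  · have hm := (out_mem_iff ((1 : G) : G ⧸ N)).2 rfl
    have h1 := single_fn_mem (Q := Q) v ⟨_, hm⟩
    have h2 := f.fn_mul 1 ⟨_, hm⟩
    rw [one_mul] at h2
    change inner ℂ ((single Q v).fn ((⟨_, hm⟩ : N) : G)) (f.fn ((⟨_, hm⟩ : N) : G)) = _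
    rw [h1, h2, LinearIsometryEquiv.inner_map_map]
  · intro σ hσ
    rw [single_fn_notMem _ fun h => hσ ((out_mem_iff σ).1 h), inner_zero_left]

/-- The isometric embedding `v ↦ [1, v]`. -/
def singleIsometry (Q : N →* (K ≃ₗᵢ[ℂ] K)) : K →ₗᵢ[ℂ] IndSpace Q :=
  LinearMap.isometryOfInner
    { toFun := single Q
      map_add' := fun v w => by
        -- Both sides are supported on N, so by `eq_single` it suffices to compare their values at
        -- the unit.
        rw [eq_single (f := single Q v + single Q w) fun x hx => by
          rw [fn_add, single_fn_notMem _ hx, single_fn_notMem _ hx, add_zero]]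
        rw [fn_add, single_fn_one, single_fn_one]
      map_smul' := fun c v => by
        rw [RingHom.id_apply, eq_single (f := c • single Q v) fun x hx => by
          rw [fn_smul, single_fn_notMem _ hx, smul_zero]]
        rw [fn_smul, single_fn_one] }
    (fun v w => by
      change inner ℂ (single Q v) (single Q w) = _
      rw [inner_single, single_fn_one])

/-- Elements of `N` act on the fibre over the trivial coset by `Q`. -/
theorem indRep_single (n : N) (v : K) : indRep Q n (single Q v) = single Q (Q n v) := by
  -- Left translation by `n` preserves the support N, and the value at the unit is the value of the
  -- original vector at n⁻¹, which is Q(n) v.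
  rw [eq_single (f := indRep Q n (single Q v)) fun x hx => by
    rw [indRep_apply, single_fn_notMem]
    exact fun h => hx ((N.mul_mem_cancel_left (N.inv_mem n.2)).1 h)]
  congr 1
  rw [indRep_apply, mul_one]
  have := single_fn_mem (Q := Q) v n⁻¹
  rwa [inv_inv] at this

/-- A closed invariant subspace that contains the fibre over the trivial coset is everything. -/
theorem eq_top_of_single_mem [CompleteSpace K] {M : Submodule ℂ (IndSpace Q)}
    (hc : IsClosed (M : Set (IndSpace Q))) (hM : ∀ g, ∀ v ∈ M, indRep Q g v ∈ M)
    (h : ∀ v, single Q v ∈ M) : M = ⊤ := by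
  have : CompleteSpace M := hc.completeSpace_coe
  rw [← Submodule.orthogonal_eq_bot_iff, Submodule.eq_bot_iff]
  intro f hf
  refine ext fun x => ?_
  -- Translating by x⁻¹ moves the value of `f` at `x` to the unit without leaving the orthogonal
  -- complement. Pairing with the vector [1, f x] of M then gives ⟨f x, f x⟩ = 0.
  have h1 := orthogonal_invariant hM x⁻¹ hf
  have h2 := (Submodule.mem_orthogonal _ _).1 h1 _ (h (f.fn x))
  rw [inner_single, indRep_apply, inv_inv, mul_one] at h2
  rw [inner_self_eq_zero.1 h2, fn_zero]

/-- An element of a normal subgroup acts on the fibre over the coset of `x` by the representation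
that is conjugate by `x`. -/
theorem indRep_fn_of_mem [N.Normal] (a : N) (f : IndSpace Q) (x : G) :
    (indRep Q a f).fn x = conjRep Q x a (f.fn x) := by
  rw [indRep_apply, conjRep_apply]
  have hx : x⁻¹ * a * x ∈ N := Subgroup.Normal.conj_mem' inferInstance (a : G) a.2 x
  -- Uses a⁻¹x = x (x⁻¹ax)⁻¹: left translation by `a` becomes right translation by an element of N,
  -- where equivariance applies.
  have := f.fn_mul x (⟨_, hx⟩ : N)⁻¹
  rw [inv_inv] at this
  rw [← this]
  congr 1
  simp [mul_assoc]

end IndSpace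

/-! ### Mackey's criterion with scalar separating elements. -/

open IndSpace

/-- Mackey's criterion, in the case in which the conjugate representations are separated from the
representation itself by elements that act by scalars. -/
theorem isIrreducible_indRep [N.Normal] [CompleteSpace K] {Q : N →* (K ≃ₗᵢ[ℂ] K)}
    (hQ : IsIrreducible Q)
    (h : ∀ x ∉ N, ∃ (a : N) (c d : ℂ), c ≠ d ∧ (∀ v, Q a v = c • v) ∧
      ∀ v, conjRep Q x a v = d • v) : IsIrreducible (indRep Q) := by
  have := hQ.1
  refine ⟨(singleIsometry Q).injective.nontrivial, fun M hc hM => ?_⟩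
  have : CompleteSpace M := hc.completeSpace_coe
  -- The projection maps the fibre over the trivial coset into itself; this is the only place where
  -- the separating elements enter.
  have hP : ∀ v, ∃ w, M.starProjection (single Q v) = single Q w := by
    refine fun v => ⟨_, eq_single fun x hx => ?_⟩
    obtain ⟨a, c, d, hcd, hca, hda⟩ := h x hx
    -- The projected vector is an eigenvector of `a` with eigenvalue `c`, inherited from [1, v]. But
    -- `a` multiplies its value at `x` by `d` ≠ `c`, so this value vanishes.
    have h1 := starProjection_commute hM a (single Q v)
    rw [indRep_single, hca] at h1
    have h2 : single Q (c • v) = c • single Q v := (singleIsometry Q).map_smul c v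
    have h3 := congrArg (fun f : IndSpace Q => f.fn x) (h2 ▸ h1)
    simp only [map_smul] at h3
    rw [fn_smul, indRep_fn_of_mem, hda, ← sub_eq_zero, ← sub_smul] at h3
    exact (smul_eq_zero.1 h3).resolve_left (sub_ne_zero.2 hcd)
  -- The part of M inside the fibre over the trivial coset is a closed Q-invariant subspace of K, so
  -- it is zero or everything.
  rcases hQ.2 (M.comap (singleIsometry Q).toLinearMap)
    (hc.preimage (singleIsometry Q).continuous) (fun n v hv => by
      change single Q (Q n v) ∈ M
      rw [← indRep_single]
      exact hM n _ hv) with h0 | h0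
  · left
    rw [← Submodule.orthogonal_eq_top_iff]
    -- If M meets the fibre only in 0, the projection kills the fibre, since it maps it into both M
    -- and the fibre. The fibre then lies in the complement of M, which is closed and invariant and
    -- so is the whole space.
    refine eq_top_of_single_mem M.isClosed_orthogonal
      (fun g v hv => orthogonal_invariant hM g hv) fun v => ?_
    obtain ⟨w, hw⟩ := hP v
    have hw0 : w ∈ M.comap (singleIsometry Q).toLinearMap := by
      change single Q w ∈ M
      rw [← hw]
      exact M.starProjection_apply_mem _
    rw [h0, Submodule.mem_bot] at hw0
    have h1 := M.sub_starProjection_mem_orthogonal (single Q v)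
    rw [hw, hw0] at h1
    have h2 : single Q 0 = 0 := (singleIsometry Q).map_zero
    rwa [h2, sub_zero] at h1
  · right
    refine eq_top_of_single_mem hc hM fun v => ?_
    have : v ∈ M.comap (singleIsometry Q).toLinearMap := by rw [h0]; trivial
    exact this

end induced
end
end BiLoop

/-! ### Bicoloured loops with explicit lifts. -/

namespace BiLoop
noncomputable section
open scoped ContDiff InnerProductSpace Topology
open Set MeasureTheory intervalIntegral

variable {Γ Λw Λb : Type*} [AddCommGroup Γ] [EvenLattice Γ] [AddCommGroup Λw] [EvenLattice Λw]
  [AddCommGroup Λb] [EvenLattice Λb] {πw : LatticeHom Γ Λw} {πb : LatticeHom Γ Λb}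

/-- The bicoloured loop that a smooth loop in `𝔥` defines. -/
def expLoop (πw : LatticeHom Γ Λw) (πb : LatticeHom Γ Λb) {ξ : ℝ → LieAlg Γ} (hξ : SmoothLoop ξ) :
    bicolLoops πw πb :=
  ⟨(fun s => πw.torus (torusExp Γ (ξ s)),
    -- The point q corresponds to both ends of [0,1]. The value at 0 is used, which fits the black
    -- half by definition and the white half by periodicity.
    fun d => torusExp Γ (ξ (match d with | Defect.p => 1 / 2 | Defect.q => 0)),
    fun s => πb.torus (torusExp Γ (ξ s))), ⟨rfl, rfl⟩,
    ⟨by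
      have h : ξ 1 = ξ 0 := by simpa using hξ.2 0
      change πw.torus (torusExp Γ (ξ 0)) = πw.torus (torusExp Γ (ξ 1))
      rw [h], rfl⟩,
    ξ, ξ, ⟨hξ.1.contDiffOn, fun s => (πw.torus_exp _).symm⟩,
    ⟨hξ.1.contDiffOn, fun s => (πb.torus_exp _).symm⟩, fun k _ => by
      have c : ∀ x, ContDiffAt ℝ k ξ x := fun x =>
        (hξ.1.of_le (by exact_mod_cast le_top)).contDiffAt
      rw [iteratedDerivWithin_eq_iteratedDeriv udw (c _) half_mem_w,
        iteratedDerivWithin_eq_iteratedDeriv udb (c _) half_mem_b,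
        iteratedDerivWithin_eq_iteratedDeriv udw (c _) one_mem_w,
        iteratedDerivWithin_eq_iteratedDeriv udb (c _) zero_mem_b]
      refine ⟨rfl, ?_⟩
      -- At p both halves are restrictions of one smooth function. At q the derivatives are taken at
      -- 1 and at 0, and they agree because differentiation commutes with the shift by the period.
      have h := iteratedDeriv_comp_add_const k ξ 1
      rw [show (fun z => ξ (z + 1)) = ξ from funext hξ.2] at h
      have := congrFun h 0
      simpa using this.symm⟩

/-- The lift `pathLift` is only chosen, so computations go through an explicit lift and
`pathLift_unique`. The remaining ambiguity is a constant in Γ, to which all the quantities below are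
insensitive. -/
theorem isPathLift_expLoop {ξ : ℝ → LieAlg Γ} (hξ : SmoothLoop ξ) :
    IsPathLift (expLoop πw πb hξ) ξ :=
  ⟨hξ.1.contDiffOn, fun _ => rfl, fun _ => rfl, rfl⟩

theorem isPathLift_constLoop (α : LieAlg Γ) :
    IsPathLift (constLoop πw πb (torusExp Γ α)) (fun _ => α) :=
  ⟨contDiffOn_const, fun _ => rfl, fun _ => rfl, rfl⟩

/-! ### Irreducibility of W and its restriction to the constant loops. -/

section rep
variable {ε : LatCocycle πw πb}

/-- The interval has length one, so a constant shift of the lift shifts the average by the same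
amount. Hence the shift by Γ disappears from the centred lift and, after exponentiation, from the
average in H. -/
theorem liftAvg_of_isPathLift {g : kerTilde ε} {ξ : ℝ → LieAlg Γ} {x : Γ}
    (hξ : IntervalIntegrable ξ volume 0 1)
    (hx : ∀ s ∈ Icc (0 : ℝ) 1, lift g s = ξ s + incl Γ x) :
    liftAvg g = (∫ s in (0 : ℝ)..1, ξ s) + incl Γ x := by
  unfold liftAvg
  rw [intervalIntegral.integral_congr (g := fun s => ξ s + incl Γ x)
    (fun s hs => hx s (by rwa [uIcc_of_le zero_le_one] at hs)),
    intervalIntegral.integral_add hξ intervalIntegrable_const]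
  simp

/-- A periodic function is a closed lift of its own exponential, and one with average zero is
already centred. This is what makes N large enough to contain, up to scalars, every Weyl operator.
-/
theorem meanZeroPart_surjective (ξ : MeanZeroLoop (LieAlg Γ)) :
    ∃ g : kerTilde ε, meanZeroPart g = ξ := by
  obtain ⟨x, hx⟩ := pathLift_unique (pathLift_spec (expLoop πw πb ξ.smooth))
    (isPathLift_expLoop ξ.smooth)
  have h1 : ξ.fn 1 = ξ.fn 0 := by simpa using ξ.smooth.2 0
  have hk : (⟨expLoop πw πb ξ.smooth, 1⟩ : CentralExt ε) ∈ kerTilde ε := by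
    rw [mem_kerTilde]
    apply Subtype.ext
    change pathLift (expLoop πw πb ξ.smooth) 1 - pathLift (expLoop πw πb ξ.smooth) 0 = 0
    -- The lift agrees with the loop up to one constant, and the loop has equal values at 0 and 1,
    -- so the winding vanishes.
    rw [hx 1 one_mem_I, hx 0 zero_mem_I, h1, add_sub_add_right_eq_sub, sub_self]
  refine ⟨⟨_, hk⟩, MeanZeroLoop.ext (funext fun s => ?_)⟩
  have hs : Int.fract s ∈ Icc (0 : ℝ) 1 := ⟨Int.fract_nonneg s, (Int.fract_lt_one s).le⟩
  have h2 := liftAvg_of_isPathLift (g := ⟨_, hk⟩)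
    (ξ.smooth.continuous.intervalIntegrable _ _) hx
  refine (congrArg₂ (· - ·) (hx _ hs) h2).trans ?_
  -- The constant in Γ cancels between lift and average. What is left is the loop at the fractional
  -- part of `s`, where `periodize` evaluates it, and periodicity returns to `s`.
  rw [ξ.mean, zero_add, add_sub_cancel_right, Int.fract]
  have := ξ.smooth.2.sub_int_mul_eq (x := s) ⌊s⌋
  rwa [mul_one] at this

theorem weylRep_apply (χ : AddChar (interGroup πw πb) Circle) (l : AddChar (Torus Γ) Circle)
    (g : kerTilde ε) (v : Fock.FockSpace (MeanZeroLoop (LieAlg Γ))) :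
    weylRep ε χ l g v = ((χ (nu g) * l (avg g) * g.1.phase : Circle) : ℂ) •
      Fock.weyl (meanZeroPart g) v := rfl

/-- The factors from χ, l and the circle are nonzero numbers, so commuting with the representation
is the same as commuting with its Weyl factors, and by surjectivity these are all Weyl operators. -/
theorem isIrreducible_weylRep (χ : AddChar (interGroup πw πb) Circle)
    (l : AddChar (Torus Γ) Circle) : IsIrreducible (weylRep ε χ l) := by
  refine isIrreducible_of_commutant fun T hT => Fock.eq_smul_of_commute fun ξ x => ?_
  obtain ⟨g, rfl⟩ := meanZeroPart_surjective (ε := ε) ξ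
  have h := hT g x
  rw [weylRep_apply, weylRep_apply, map_smul] at h
  exact smul_right_injective _ (Circle.coe_ne_zero _) h

/-- The element of `kerTilde` with a constant loop and an arbitrary phase acts by a scalar. -/
theorem weylRep_const (χ : AddChar (interGroup πw πb) Circle) (l : AddChar (Torus Γ) Circle)
    (α : LieAlg Γ) {g : kerTilde ε} (hg : g.1.loop = constLoop πw πb (torusExp Γ α))
    (v : Fock.FockSpace (MeanZeroLoop (LieAlg Γ))) :
    weylRep ε χ l g v = ((l (torusExp Γ α) * g.1.phase : Circle) : ℂ) • v := by
  -- The chosen lift is the constant α + x with x in Γ. Exponentiation kills x, so χ is evaluated at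
  -- 0 and l at exp α, and the centred lift vanishes.
  obtain ⟨x, hx⟩ := pathLift_unique (pathLift_spec g.1.loop)
    (hg ▸ isPathLift_constLoop (πw := πw) (πb := πb) α)
  have hA := liftAvg_of_isPathLift (g := g) intervalIntegrable_const hx
  rw [intervalIntegral.integral_const, sub_zero, one_smul] at hA
  have hnu : nu g = 0 := by
    apply Subtype.ext
    change g.1.loop.1.2.1 Defect.q - torusExp Γ (lift g 1) = 0
    have h1 : lift g 1 = α + incl Γ x := hx 1 one_mem_I
    rw [h1, hg, map_add, torusExp_incl, add_zero]
    exact sub_self _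
  have havg : avg g = torusExp Γ α := by
    unfold avg
    rw [hA, map_add, torusExp_incl, add_zero]
  have hmz : meanZeroPart g = 0 := by
    apply MeanZeroLoop.ext
    funext s
    have hs : Int.fract s ∈ Icc (0 : ℝ) 1 := ⟨Int.fract_nonneg s, (Int.fract_lt_one s).le⟩
    refine (congrArg₂ (· - ·) (hx _ hs) hA).trans ?_
    exact sub_self _
  rw [weylRep_apply, hnu, havg, hmz, AddChar.map_zero_eq_one, one_mul, Fock.weyl_apply,
    Fock.weylCLM_zero]
  rfl

theorem weylRep_constTilde (χ : AddChar (interGroup πw πb) Circle) (l : AddChar (Torus Γ) Circle)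
    (α : LieAlg Γ) (v : Fock.FockSpace (MeanZeroLoop (LieAlg Γ))) :
    weylRep ε χ l (constTilde ε (torusExp Γ α)) v = (l (torusExp Γ α) : ℂ) • v := by
  rw [weylRep_const χ l α rfl]
  change ((l (torusExp Γ α) * 1 : Circle) : ℂ) • v = _
  rw [mul_one]

/-! ### Conjugation of the constant loops and their characters. -/

theorem expS_const_left (α : LieAlg Γ) (γ : bicolLoops πw πb) :
    expS (constLoop πw πb (torusExp Γ α)) γ = 1 := by
  obtain ⟨x, hx⟩ := pathLift_unique (pathLift_spec _)
    (isPathLift_constLoop (πw := πw) (πb := πb) α)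
  unfold expS
  rw [pathS_congr (ξ' := fun _ => α + incl Γ x) hx (fun _ _ => rfl), pathS_const_left, mul_zero,
    Circle.exp_zero]

/-- The integral and the boundary term of S' each give ½⟨Δ'γ, α⟩. The chosen lift of the constant
loop may differ from α by an element of Γ, but this pairs integrally with Δ'γ and leaves the phase
unchanged. The contrast with `expS_const_left`, where nothing survives, is the source of the
character -Δ'γ. -/
theorem expS_const_right (γ : bicolLoops πw πb) (α : LieAlg Γ) :
    expS γ (constLoop πw πb (torusExp Γ α)) =
      Circle.exp (2 * Real.pi * inner ℝ (winding γ : LieAlg Γ) α) := by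
  obtain ⟨x, hx⟩ := pathLift_unique (pathLift_spec _)
    (isPathLift_constLoop (πw := πw) (πb := πb) α)
  obtain ⟨n, hn⟩ := inner_diff_incl πw πb (windingVec_mem γ) x
  unfold expS
  rw [pathS_congr (η' := fun _ => α + incl Γ x) (fun _ _ => rfl) hx,
    pathS_const_right (pathLift_spec γ).smooth, inner_add_right, mul_add, Circle.exp_add]
  change _ * Circle.exp (2 * Real.pi * inner ℝ (windingVec γ) (incl Γ x)) = _
  rw [hn, Circle.exp_two_pi_mul_int, mul_one]
  rfl

/-- The phase of the conjugate of a constant loop. -/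
theorem conj_const_phase (g : CentralExt ε) (α : LieAlg Γ) :
    (g⁻¹ * (constTilde ε (torusExp Γ α) : CentralExt ε) * g).phase =
      Circle.exp (-(2 * Real.pi * inner ℝ (winding g.loop : LieAlg Γ) α)) := by
  have hk : ((constTilde ε (torusExp Γ α) : kerTilde ε) : CentralExt ε) =
    ⟨constLoop πw πb (torusExp Γ α), 1⟩ := rfl
  simp only [hk, CentralExt.mul_phase, CentralExt.inv_phase, CentralExt.mul_loop,
    CentralExt.inv_loop]
  unfold cocyc
  -- Since the constant loop has winding 0, ε is trivial against it, and adding it to -γ does not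
  -- change ε(-Δ'γ, Δ'γ). Bimultiplicativity of `expS` isolates the single factor e^(2πiS'(-γ, α)).
  rw [map_add, winding_constLoop, ε.norm_right, add_zero, expS_add_left, expS_const_left,
    expS_const_right, one_mul, mul_one, mul_one, map_neg]
  rw [show -(2 * Real.pi * inner ℝ (winding g.loop : LieAlg Γ) α) =
    2 * Real.pi * inner ℝ ((-winding g.loop : diffLattice πw πb) : LieAlg Γ) α by
      rw [AddSubgroup.coe_neg, inner_neg_left]; ring]
  -- The value of the cocycle at (-γ, γ) occurs once in the product and once, inverted, in the phase
  -- of g⁻¹; likewise the phase of g. Both cancel in the commutative circle group.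
  generalize ε.ε (-winding g.loop) (winding g.loop) * expS (-g.loop) g.loop = c
  generalize Circle.exp _ = d
  generalize g.phase = z
  rw [← mul_inv, mul_assoc _ z c, mul_right_comm, inv_mul_cancel, one_mul]

theorem conjRep_weylRep_const (χ : AddChar (interGroup πw πb) Circle)
    (l : AddChar (Torus Γ) Circle) (g : CentralExt ε) (α : LieAlg Γ)
    (v : Fock.FockSpace (MeanZeroLoop (LieAlg Γ))) :
    conjRep (weylRep ε χ l) g (constTilde ε (torusExp Γ α)) v =
      ((l (torusExp Γ α) * Circle.exp (-(2 * Real.pi *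
        inner ℝ (winding g.loop : LieAlg Γ) α)) : Circle) : ℂ) • v := by
  -- The loop group is abelian, so the conjugate has the same constant loop with a new phase;
  -- therefore the scalar action is needed for arbitrary phase and not only for `constTilde`.
  rw [conjRep_apply, weylRep_const χ l α ?_, conj_const_phase]
  change -g.loop + constLoop πw πb (torusExp Γ α) + g.loop = _
  abel

/-- The character of the constant loops changes under conjugation by an element with
`Δ' ≠ 0`. -/
theorem exists_exp_winding_ne (l : AddChar (Torus Γ) Circle) {g : CentralExt ε}
    (hg : g ∉ kerTilde ε) :
    ∃ α : LieAlg Γ, l (torusExp Γ α) * Circle.exp (-(2 * Real.pi *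
      inner ℝ (winding g.loop : LieAlg Γ) α)) ≠ l (torusExp Γ α) := by
  have h0 : (winding g.loop : LieAlg Γ) ≠ 0 := fun h => hg (Subtype.ext h)
  have h1 : inner ℝ (winding g.loop : LieAlg Γ) (winding g.loop : LieAlg Γ) ≠ 0 :=
    inner_self_ne_zero.2 h0
  -- The choice α = Δ'γ / (2⟨Δ'γ, Δ'γ⟩) makes ⟨Δ'γ, α⟩ = ½, so that the extra factor is e^(-πi) =
  -- -1.
  refine ⟨(2 * inner ℝ (winding g.loop : LieAlg Γ) (winding g.loop : LieAlg Γ))⁻¹ •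
    (winding g.loop : LieAlg Γ), fun h => ?_⟩
  rw [mul_eq_left, inner_smul_right] at h
  have e : -(2 * Real.pi * ((2 * inner ℝ (winding g.loop : LieAlg Γ) (winding g.loop : LieAlg Γ))⁻¹
      * inner ℝ (winding g.loop : LieAlg Γ) (winding g.loop : LieAlg Γ))) = -Real.pi := by
    field_simp
  rw [e] at h
  have := congrArg (fun z : Circle => (z : ℂ)) h
  simp [Circle.coe_exp, Complex.exp_pi_mul_I] at this
  norm_num at this

end rep
end
end BiLoop

/-! ### The proposition. -/

/-- Let `H` be the torus with lattice `Γ`, let `L̃(T_w, H, T_b)` be the centrally extended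
bicoloured torus loop group and let `χ` and `l` be characters of `(Λ_w ∩ Λ_b)/Γ` and of `H`. The
representation `W_{χ,l}` of the normal subgroup `kerTilde` is irreducible, and so is the
representation of `L̃(T_w, H, T_b)` induced from it. The constant loops act in
`W_{χ,l}` by `l`, and in its conjugate by an element `g` outside the subgroup by the character
`l - Δ'`, which is different from `l`. -/
theorem mainTheorem4 {Γ Λw Λb : Type*} [AddCommGroup Γ] [BiLoop.EvenLattice Γ] [AddCommGroup Λw]
    [BiLoop.EvenLattice Λw] [AddCommGroup Λb] [BiLoop.EvenLattice Λb]
    (πw : BiLoop.LatticeHom Γ Λw) (πb : BiLoop.LatticeHom Γ Λb) (ε : BiLoop.LatCocycle πw πb)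
    (χ : AddChar (BiLoop.interGroup πw πb) Circle) (l : AddChar (BiLoop.Torus Γ) Circle)
    (hl : Continuous fun α : BiLoop.LieAlg Γ => l (BiLoop.torusExp Γ α)) :
    BiLoop.IsIrreducible (BiLoop.weylRep ε χ l) ∧
    BiLoop.IsIrreducible (BiLoop.indRep (BiLoop.weylRep ε χ l)) ∧
    ∀ g : BiLoop.CentralExt ε, g ∉ BiLoop.kerTilde ε →
      (∀ (α : BiLoop.LieAlg Γ) (v : Fock.FockSpace (BiLoop.MeanZeroLoop (BiLoop.LieAlg Γ))),
        BiLoop.weylRep ε χ l (BiLoop.constTilde ε (BiLoop.torusExp Γ α)) v = (l (BiLoop.torusExp Γ α) : ℂ) • v ∧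
        BiLoop.conjRep (BiLoop.weylRep ε χ l) g (BiLoop.constTilde ε (BiLoop.torusExp Γ α)) v =
          ((l (BiLoop.torusExp Γ α) * Circle.exp (-(2 * Real.pi *
            inner ℝ (BiLoop.winding g.loop : BiLoop.LieAlg Γ) α)) : Circle) : ℂ) • v) ∧
      ∃ α : BiLoop.LieAlg Γ, l (BiLoop.torusExp Γ α) * Circle.exp (-(2 * Real.pi *
            inner ℝ (BiLoop.winding g.loop : BiLoop.LieAlg Γ) α)) ≠ l (BiLoop.torusExp Γ α) := by
  refine ⟨BiLoop.isIrreducible_weylRep χ l, BiLoop.isIrreducible_indRep (BiLoop.isIrreducible_weylRep χ l)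
    fun g hg => ?_, fun g hg => ⟨fun α v => ⟨?_, BiLoop.conjRep_weylRep_const χ l g α v⟩,
      BiLoop.exists_exp_winding_ne l hg⟩⟩
  · obtain ⟨α, hα⟩ := BiLoop.exists_exp_winding_ne l hg
    -- The separating element for `g` is the constant loop exp α on which the two characters differ;
    -- their values there are the two scalars, and they stay distinct in ℂ because the circle embeds
    -- injectively.
    refine ⟨BiLoop.constTilde ε (BiLoop.torusExp Γ α), _, _, fun h => hα (Circle.coe_injective h.symm),
      fun v => BiLoop.weylRep_constTilde χ l α v, BiLoop.conjRep_weylRep_const χ l g α⟩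
  · exact BiLoop.weylRep_constTilde χ l α v
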